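/- Let $n\ge 0$ be an integer and $\alpha>-1$. Let $\mathbb B_n$ be the open unit ball of $\mathbb C^n$, with $\langle z,w\rangle=\sum_k z_k\overline{w_k}$, let $\nu$ be Lebesgue measure on $\mathbb B_n$ normalized by $\nu(\mathbb B_n)=1$, and let $$d\nu_\alpha(z)=c_\alpha(1-|z|^2)^\alpha\,d\nu(z),\qquad c_\alpha=\frac{\Gamma(n+\alpha+1)}{n!\,\Gamma(\alpha+1)}.$$ For $z,w\in\mathbb B_n$ put $K_z^\alpha(w)=(1-\langle w,z\rangle)^{-(n+1+\alpha)}$ and $k_z^\alpha(w)=(1-|z|^2)^{(n+1+\alpha)/2}K_z^\alpha(w)$. Let $\varphi_0(w)=-w$ and, for $z\in\mathbb B_n\setminus\{0\}$, $$\varphi_z(w)=\frac{z-P_zw-\sqrt{1-|z|^2}\,(w-P_zw)}{1-\langle w,z\rangle},\qquad P_zw=\frac{\langle w,z\rangle}{|z|^2}z .$$ For $\tau\in L^1(\mathbb B_n,d\nu_\alpha)$ the Berezin transform is $\widetilde\tau(z)=\int_{\mathbb B_n}|k_z^\alpha(w)|^2\tau(w)\,d\nu_\alpha(w)$, and $\tau\in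 BMO^1_\alpha(\mathbb B_n,\mathbb C)$ means that $\sup_{z\in\mathbb B_n}\int_{\mathbb B_n}|\tau\circ\varphi_z-\widetilde\tau(z)|\,d\nu_\alpha<\infty$. Let $(e_i)_{i\ge1}$ be the standard basis of the complex sequence space $\ell^2$. Let $A^2_\alpha(\mathbb B_n,\ell^2)$ be the space of holomorphic functions $f:\mathbb B_n\to\ell^2$ with $\int_{\mathbb B_n}\|f\|_{\ell^2}^2\,d\nu_\alpha<\infty$, with the $L^2(\nu_\alpha)$ norm. For an integrable symbol $b:\mathbb B_n\to\mathcal L(\ell^2)$, the Toeplitz operator $T_b$ is defined on the dense subspace of bounded holomorphic functions $f:\mathbb B_n\to\ell^2$ by $$T_bf(z)=\int_{\mathbb B_n}\overline{K_z^\alpha(w)}\;b(w)(f(w))\,d\nu_\alpha(w),\qquad z\in\mathbb B_n .$$ **Theorem.** Let $\tau\in BMO^1_\alpha(\mathbb B_n,\mathbb C)$ be such that $\widetilde\tau$ is bounded on $\mathbb B_n$ and $\widetilde\tau(z)\to0$ as $z\to\partial\mathbb B_n$ (that is, as $|z|\to1^-$). Let $b(z)\in\mathcal L(\ell^2)$,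 $z\in\mathbb B_n$, be the diagonal operator with $b(z)e_i=\tau(z)\,2^{-i}e_i$ for $i=1,2,\dots$. Then $T_b$ extends to a compact operator from $A^2_\alpha(\mathbb B_n,\ell^2)$ to itself. -/

import Mathlib

open MeasureTheory Filter Topology Metric
open scoped ENNReal

noncomputable section

namespace VectorBergman

/-- The `n`-dimensional complex Euclidean space. Mathlib's inner product is conjugate linear in the
first variable, so the classical `⟨z, w⟩ = ∑ zₖ conj wₖ` is `inner ℂ w z` below. -/
abbrev Cn (n : ℕ) : Type := EuclideanSpace ℂ (Fin n)

/-- The open unit ball of `ℂⁿ`. Functions on the ball are represented by functions on `ℂⁿ` whose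
values outside the ball are never used. -/
abbrev unitBall (n : ℕ) : Set (Cn n) := ball 0 1

/-- Lebesgue measure on the unit ball, normalized to have total mass one. -/
def nu (n : ℕ) : Measure (Cn n) :=
  (volume (unitBall n))⁻¹ • volume.restrict (unitBall n)

/-- The constant `c_α = Γ(n + α + 1) / (n! Γ(α + 1))`. -/
def cAlpha (n : ℕ) (α : ℝ) : ℝ :=
  Real.Gamma (n + α + 1) / (n.factorial * Real.Gamma (α + 1))

/-- The weighted measure `dν_α(z) = c_α (1 - |z|²)^α dν(z)` on the unit ball. -/
def nuAlpha (n : ℕ) (α : ℝ) : Measure (Cn n) :=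
  (nu n).withDensity fun z => ENNReal.ofReal (cAlpha n α * (1 - ‖z‖ ^ 2) ^ α)

/-- The reproducing kernel `K_w(z) = (1 - ⟨z, w⟩)^{-(n+1+α)}` (principal branch; the base has
positive real part for `z, w` in the ball). -/
def kernel (n : ℕ) (α : ℝ) (w z : Cn n) : ℂ :=
  1 / (1 - inner ℂ w z) ^ ((n + 1 + α : ℝ) : ℂ)

/-- The normalized kernel `k_w(z) = (1 - |w|²)^{(n+1+α)/2} / (1 - ⟨z, w⟩)^{n+1+α}`. -/
def normKernel (n : ℕ) (α : ℝ) (w z : Cn n) : ℂ :=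
  (((1 - ‖w‖ ^ 2) ^ ((n + 1 + α) / 2) : ℝ) : ℂ) / (1 - inner ℂ w z) ^ ((n + 1 + α : ℝ) : ℂ)

/-- The involutive automorphism `φ_a` of the unit ball interchanging `0` and `a`
(for `a = 0` it is `z ↦ -z`). -/
def phi {n : ℕ} (a z : Cn n) : Cn n :=
  if a = 0 then -z
  else
    let P : Cn n := (inner ℂ a z / ((‖a‖ ^ 2 : ℝ) : ℂ)) • a
    (1 - inner ℂ a z)⁻¹ • (a - P - ((Real.sqrt (1 - ‖a‖ ^ 2) : ℝ) : ℂ) • (z - P))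

section Banach

variable {E F : Type*} [NormedAddCommGroup E] [NormedSpace ℂ E]
  [NormedAddCommGroup F] [NormedSpace ℂ F]

/-- The Berezin transform `b̃(z) = ∫ |k_z(w)|² b(w) dν_α(w)`. -/
def berezin (n : ℕ) (α : ℝ) (b : Cn n → E) (z : Cn n) : E :=
  ∫ w, ((‖normKernel n α z w‖ ^ 2 : ℝ) : ℂ) • b w ∂(nuAlpha n α)

/-- `b ∈ BMO¹_α(𝔹ₙ, E)`: `b ∈ L¹_α` and `sup_{z ∈ 𝔹ₙ} ‖b ∘ φ_z - b̃(z)‖_{L¹_α} < ∞`. -/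
def MemBMO (n : ℕ) (α : ℝ) (b : Cn n → E) : Prop :=
  Integrable b (nuAlpha n α) ∧
    ⨆ z ∈ unitBall n,
      eLpNorm (fun w => b (phi z w) - berezin n α b z) 1 (nuAlpha n α) < ⊤

/-- `f ∈ H^∞(𝔹ₙ, E)`: bounded holomorphic functions on the ball. -/
def MemHInfty (n : ℕ) (f : Cn n → E) : Prop :=
  DifferentiableOn ℂ f (unitBall n) ∧ ∃ C : ℝ, ∀ z ∈ unitBall n, ‖f z‖ ≤ C

variable (E) in
/-- The Bergman space `A²_α(𝔹ₙ, E)`: the subspace of `L²_α(𝔹ₙ, E)` of (classes of) holomorphic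
functions on the ball, with the `L²_α` norm. -/
def bergman (n : ℕ) (α : ℝ) : Submodule ℂ (Lp E 2 (nuAlpha n α)) where
  carrier := {G | ∃ g : Cn n → E, DifferentiableOn ℂ g (unitBall n) ∧ G =ᵐ[nuAlpha n α] g}
  zero_mem' := ⟨0, differentiableOn_const 0, Lp.coeFn_zero E 2 _⟩
  add_mem' := by
    rintro G H ⟨g, hg, hG⟩ ⟨h, hh, hH⟩
    exact ⟨g + h, hg.add hh, (Lp.coeFn_add G H).trans (hG.add hH)⟩
  smul_mem' := by
    rintro c G ⟨g, hg, hG⟩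
    exact ⟨c • g, hg.const_smul c, (Lp.coeFn_smul c G).trans (hG.const_smul c)⟩

/-- The Toeplitz integral `T_b f(z) = ∫ b(w)(f(w)) conj(K_z(w)) dν_α(w)`. -/
def toeplitz (n : ℕ) (α : ℝ) (b : Cn n → E →L[ℂ] F) (f : Cn n → E) (z : Cn n) : F :=
  ∫ w, (starRingEnd ℂ (kernel n α z w)) • b w (f w) ∂(nuAlpha n α)

/-- `T` is the bounded extension to `A²_α(𝔹ₙ, E)` of the Toeplitz operator with symbol `b`, which
is defined by the Toeplitz integral on the dense subspace `H^∞(𝔹ₙ, E)`. -/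
def IsToeplitz (n : ℕ) (α : ℝ) (b : Cn n → E →L[ℂ] F)
    (T : bergman E n α →L[ℂ] bergman F n α) : Prop :=
  ∀ f : Cn n → E, MemHInfty n f →
    ∀ G : bergman E n α, (G : Lp E 2 (nuAlpha n α)) =ᵐ[nuAlpha n α] f →
      (T G : Lp F 2 (nuAlpha n α)) =ᵐ[nuAlpha n α] toeplitz n α b f

end Banach

/-- The complex Hilbert space `ℓ²`. The basis vector `e_i`, `i = 1, 2, …`, has index `i - 1`. -/
abbrev ell2 : Type := lp (fun _ : ℕ => ℂ) 2

/-- The orthonormal basis vector of `ℓ²` with (zero-based) index `i`. -/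
def basisVec (i : ℕ) : ell2 := lp.single 2 i (1 : ℂ)

/-- Multiplication by one of the weights `2^{-1}, 2^{-2}, …` does not increase the modulus. -/
theorem norm_weight_mul_le (i : ℕ) (c : ℂ) : ‖(1 / 2 ^ (i + 1) : ℂ) * c‖ ≤ ‖c‖ := by
  rw [norm_mul]
  refine mul_le_of_le_one_left (norm_nonneg _) ?_
  rw [norm_div, norm_pow, norm_one, Complex.norm_ofNat]
  exact div_le_one_of_le₀ (one_le_pow₀ (by norm_num)) (by positivity)

/-- The diagonal operator on `ℓ²` with diagonal `2^{-1}, 2^{-2}, 2^{-3}, …`. -/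
def diagOp : ell2 →L[ℂ] ell2 :=
  LinearMap.mkContinuous
    { toFun := fun x => ⟨fun i => (1 / 2 ^ (i + 1) : ℂ) * x i,
        (lp.memℓp x).mono' fun i => norm_weight_mul_le i (x i)⟩
      map_add' := fun x y => by
        ext i
        exact mul_add _ (x i) (y i)
      map_smul' := fun c x => by ext i; simp [mul_left_comm] }
    1 (fun x => by
      rw [one_mul]
      exact lp.norm_mono (by norm_num) fun i => norm_weight_mul_le i (x i))

/-- The operator-valued symbol `b(z) = τ(z) diag(2^{-1}, 2^{-2}, …)`. -/
def diagSymbol {n : ℕ} (τ : Cn n → ℂ) (z : Cn n) : ell2 →L[ℂ] ell2 :=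
  τ z • diagOp

/-- The defining property of the symbol: `b(z) e_i = τ(z) 2^{-i} e_i` for `i = 1, 2, …`. -/
theorem diagSymbol_basisVec {n : ℕ} (τ : Cn n → ℂ) (z : Cn n) (i : ℕ) :
    diagSymbol τ z (basisVec i) = (τ z / 2 ^ (i + 1)) • basisVec i := by
  ext j
  by_cases h : j = i
  · subst h
    simp [diagSymbol, diagOp, basisVec, div_eq_mul_inv]
  · simp [diagSymbol, diagOp, basisVec, h]

end VectorBergman

end

/-!
# Compactness of a diagonal Toeplitz operator with a `BMO` symbol

Write `q(z, u) = |k_z(u)|²` for the Berezin weight (`bweight`) and `N = n + 1 + α`. The change of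
variables `u = φ_z(w)` turns integration against `q(z, ·) dν_α` into integration of `τ ∘ φ_z`, so
the hypotheses on `τ` give a bound `M` for the averages `∫ |τ| q(z, ·) dν_α`
(`exists_average_bound`). The argument first produces a compact operator `S` on the scalar Bergman
space with Toeplitz form `⟪g, S f⟫ = ∫ ḡ τ f dν_α`, and then passes to `ℓ²`.

*Boundedness.* Applied to the weighted translate `f(φ_u(v)) / (1 - ⟨v, u⟩)^N` of a holomorphic
`f`, the sub-mean value property bounds `|f(u)|²` by the integral of `|f|²` over a
pseudohyperbolic ball about `u`, with weight at most a constant times `q(w, u)`. By Tonelli `∫ |τ|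
|f|² dν_α ≤ K ‖f‖²` (`carlesonBound_of_averages`), so the Toeplitz form of `τ` is bounded and `S`
exists.

*Small averages.* Let `a_γ(z) = ∫ γ(|φ_z(u)|²) q(z, u) τ(u) dν_α(u)` (`average`), where `γ` is a
bump supported in `[0, ε²]` with `∫ γ(|v|²) (1 - |v|²)^N dν_α(v) = 1`. Moving the average from the
symbol onto `f ḡ`, and using the Schwarz lemma for the weighted translates of `f` and `g`, the
forms of `a_γ` and `τ` differ by at most `C ε M ‖f‖ ‖g‖` (`norm_integral_average_sub_le`). It
remains to show that `a_γ` has a compact operator.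

*Vanishing at the boundary.* For the weight `γ(t) = (1 - s² t)^{-N}` the norm formula for the
reproducing kernel expresses `a_γ(z)` as an average, over `u`, of the Berezin transform of `τ` at
the points `φ_z(s u)`, which tend to the boundary uniformly as `|z| → 1` (`average_kernel_eq`,
`tendsto_average_kernel`). The closed span of these weights in `C[0, 1]` contains all powers of
`t`, because the binomial series in `s²` has no zero coefficient, and so is everything by
Weierstrass (`vanishing_eq_top`). Hence `a_γ(z) → 0` for every continuous `γ` (`tendsto_average`).
A bounded symbol that vanishes at the boundary has a compact operator: cut off to `|z| ≤ r`, it is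
a norm convergent integral of rank one operators `⟪K_z, ·⟫ K_z`
(`isCompactOperator_of_vanishing`).

*Vector values.* By the reproducing formula the Toeplitz integral of `τ` is `S` up to the total
mass of `ν_α`. That mass is `1`, but it is simply carried along as a factor. On `A²_α(𝔹ₙ, ℓ²)` the
operator acts in the `i`-th coordinate as `2^{-i}` times the scalar one, and the sum over `i`
converges in norm (`exists_isCompactOperator_diag`).
-/

open MeasureTheory Filter Topology Metric
open scoped ENNReal

noncomputable section

namespace VectorBergman

variable {n : ℕ} {α : ℝ}

/-! ### The automorphisms of the ball -/

/-- The linear part `A w = s w + ⟨w, a⟩ / (1 + s) a`, `s = √(1 - |a|²)`, of the numerator `a - A w`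
of `φ_a`. It is `P_a + s (1 - P_a)`, written so that `a = 0` needs no separate treatment. -/
def moebiusLin (a : Cn n) : Cn n →L[ℂ] Cn n :=
  ((Real.sqrt (1 - ‖a‖ ^ 2) : ℝ) : ℂ) • ContinuousLinearMap.id ℂ (Cn n) +
    (((1 + Real.sqrt (1 - ‖a‖ ^ 2))⁻¹ : ℝ) : ℂ) • (innerSL ℂ a).smulRight a

theorem moebiusLin_apply (a w : Cn n) :
    moebiusLin a w = ((Real.sqrt (1 - ‖a‖ ^ 2) : ℝ) : ℂ) • w +
      ((((1 + Real.sqrt (1 - ‖a‖ ^ 2))⁻¹ : ℝ) : ℂ) * inner ℂ a w) • a := by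
  simp [moebiusLin, smul_smul]

theorem one_sub_norm_sq_pos {a : Cn n} (ha : ‖a‖ < 1) : 0 < 1 - ‖a‖ ^ 2 := by
  nlinarith [norm_nonneg a]

theorem norm_inner_lt_one {a w : Cn n} (ha : ‖a‖ < 1) (hw : ‖w‖ ≤ 1) : ‖inner ℂ a w‖ < 1 := by
  have := norm_inner_le_norm (𝕜 := ℂ) a w
  nlinarith [norm_nonneg a, norm_nonneg w]

theorem one_sub_inner_re_pos {a w : Cn n} (ha : ‖a‖ < 1) (hw : ‖w‖ ≤ 1) :
    0 < (1 - inner ℂ a w).re := by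
  have h1 := norm_inner_lt_one ha hw
  have h2 := Complex.re_le_norm (inner ℂ a w)
  simp only [Complex.sub_re, Complex.one_re]
  linarith

theorem one_sub_inner_ne_zero {a w : Cn n} (ha : ‖a‖ < 1) (hw : ‖w‖ ≤ 1) :
    1 - inner ℂ a w ≠ 0 := by
  intro h
  have := one_sub_inner_re_pos ha hw
  simp [h] at this

/-- The formula for `φ_a` without case distinction. -/
theorem phi_eq {a : Cn n} (ha : ‖a‖ < 1) (w : Cn n) :
    phi a w = (1 - inner ℂ a w)⁻¹ • (a - moebiusLin a w) := by
  rw [moebiusLin_apply]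
  by_cases h : a = 0
  · simp [phi, h]
  have hpos := one_sub_norm_sq_pos ha
  have hn : ((‖a‖ ^ 2 : ℝ) : ℂ) ≠ 0 := by
    exact_mod_cast (pow_pos (norm_pos_iff.2 h) 2).ne'
  have hs2 : Real.sqrt (1 - ‖a‖ ^ 2) ^ 2 = 1 - ‖a‖ ^ 2 := Real.sq_sqrt hpos.le
  have hs0 : 0 ≤ Real.sqrt (1 - ‖a‖ ^ 2) := Real.sqrt_nonneg _
  simp only [phi, h, if_false]
  set s := Real.sqrt (1 - ‖a‖ ^ 2)
  have hk : (((1 + s)⁻¹ : ℝ) : ℂ) = (1 - (s : ℂ)) / ((‖a‖ ^ 2 : ℝ) : ℂ) := by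
    rw [eq_div_iff hn]
    have : (1 + s)⁻¹ * ‖a‖ ^ 2 = 1 - s := by
      rw [inv_mul_eq_iff_eq_mul₀ (by positivity)]
      nlinarith
    exact_mod_cast this
  rw [hk]
  congr 1
  module

theorem inner_moebiusLin {a : Cn n} (ha : ‖a‖ < 1) (w : Cn n) :
    inner ℂ a (moebiusLin a w) = inner ℂ a w := by
  have hpos := one_sub_norm_sq_pos ha
  have hs2 : Real.sqrt (1 - ‖a‖ ^ 2) ^ 2 = 1 - ‖a‖ ^ 2 := Real.sq_sqrt hpos.le
  have hs0 : 0 ≤ Real.sqrt (1 - ‖a‖ ^ 2) := Real.sqrt_nonneg _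
  rw [moebiusLin_apply]
  set s := Real.sqrt (1 - ‖a‖ ^ 2)
  have hi : inner ℂ a a = ((‖a‖ ^ 2 : ℝ) : ℂ) := by
    rw [inner_self_eq_norm_sq_to_K]; norm_cast
  simp only [inner_add_right, inner_smul_right, hi]
  have h1 : (1 + s)⁻¹ * ‖a‖ ^ 2 = 1 - s := by
    rw [inv_mul_eq_iff_eq_mul₀ (by positivity)]
    nlinarith
  have h2 : (((1 + s)⁻¹ : ℝ) : ℂ) * ((‖a‖ ^ 2 : ℝ) : ℂ) = 1 - s := by exact_mod_cast h1
  linear_combination (inner ℂ a w) * h2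

theorem inner_moebiusLin_moebiusLin {a : Cn n} (ha : ‖a‖ < 1) (v w : Cn n) :
    inner ℂ (moebiusLin a v) (moebiusLin a w) =
      (1 - (‖a‖ ^ 2 : ℝ)) * inner ℂ v w + inner ℂ v a * inner ℂ a w := by
  have hpos := one_sub_norm_sq_pos ha
  have hs2 : Real.sqrt (1 - ‖a‖ ^ 2) ^ 2 = 1 - ‖a‖ ^ 2 := Real.sq_sqrt hpos.le
  have hs0 : 0 ≤ Real.sqrt (1 - ‖a‖ ^ 2) := Real.sqrt_nonneg _
  rw [moebiusLin_apply a v, inner_add_left, inner_smul_left, inner_smul_left, inner_moebiusLin ha,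
    moebiusLin_apply a w, inner_add_right, inner_smul_right, inner_smul_right]
  set s := Real.sqrt (1 - ‖a‖ ^ 2)
  simp only [map_mul, Complex.conj_ofReal, inner_conj_symm]
  have h1 : s * (1 + s)⁻¹ + (1 + s)⁻¹ = 1 := by field_simp; ring
  have h2 : (s : ℂ) * (((1 + s)⁻¹ : ℝ) : ℂ) + (((1 + s)⁻¹ : ℝ) : ℂ) = 1 := by exact_mod_cast h1
  have h3 : (s : ℂ) ^ 2 = 1 - (‖a‖ ^ 2 : ℝ) := by exact_mod_cast hs2
  linear_combination (inner ℂ v a * inner ℂ a w) * h2 + (inner ℂ v w) * h3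

/-- The fundamental identity
`1 - ⟨φ_a w, φ_a v⟩ = (1 - |a|²) (1 - ⟨w, v⟩) / ((1 - ⟨w, a⟩) (1 - ⟨a, v⟩))`. -/
theorem one_sub_inner_phi_phi {a v w : Cn n} (ha : ‖a‖ < 1) (hv : ‖v‖ ≤ 1) (hw : ‖w‖ ≤ 1) :
    1 - inner ℂ (phi a v) (phi a w) =
      (1 - (‖a‖ ^ 2 : ℝ)) * (1 - inner ℂ v w) / ((1 - inner ℂ a w) * (1 - inner ℂ v a)) := by
  have h1 := one_sub_inner_ne_zero ha hw
  have h2 : 1 - inner ℂ v a ≠ 0 := by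
    have := one_sub_inner_ne_zero ha hv
    rw [← inner_conj_symm]
    intro h
    apply this
    have := congrArg (starRingEnd ℂ) h
    simpa using this
  have hi : inner ℂ a a = ((‖a‖ ^ 2 : ℝ) : ℂ) := by
    rw [inner_self_eq_norm_sq_to_K]; norm_cast
  have hA : inner ℂ (moebiusLin a v) a = inner ℂ v a := by
    rw [← inner_conj_symm, inner_moebiusLin ha, inner_conj_symm]
  rw [phi_eq ha, phi_eq ha, inner_smul_left, inner_smul_right, inner_sub_left, inner_sub_right,
    inner_sub_right, inner_moebiusLin ha, inner_moebiusLin_moebiusLin ha, hA, hi]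
  simp only [map_inv₀, map_sub, map_one, inner_conj_symm]
  field_simp
  ring

theorem one_sub_norm_phi_sq {a w : Cn n} (ha : ‖a‖ < 1) (hw : ‖w‖ ≤ 1) :
    1 - ‖phi a w‖ ^ 2 = (1 - ‖a‖ ^ 2) * (1 - ‖w‖ ^ 2) / ‖1 - inner ℂ a w‖ ^ 2 := by
  have h := one_sub_inner_phi_phi ha hw hw
  have hc : 1 - inner ℂ w a = starRingEnd ℂ (1 - inner ℂ a w) := by simp
  rw [hc, Complex.mul_conj, inner_self_eq_norm_sq_to_K, inner_self_eq_norm_sq_to_K,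
    Complex.normSq_eq_norm_sq] at h
  have h' : ((1 - ‖phi a w‖ ^ 2 : ℝ) : ℂ) =
      (((1 - ‖a‖ ^ 2) * (1 - ‖w‖ ^ 2) / ‖1 - inner ℂ a w‖ ^ 2 : ℝ) : ℂ) := by
    push_cast at h ⊢
    exact h
  exact_mod_cast h'

theorem norm_phi_lt_one {a w : Cn n} (ha : ‖a‖ < 1) (hw : ‖w‖ < 1) : ‖phi a w‖ < 1 := by
  have h := one_sub_norm_phi_sq ha hw.le
  have h0 := norm_pos_iff.2 (one_sub_inner_ne_zero ha hw.le)
  have : 0 < 1 - ‖phi a w‖ ^ 2 := by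
    rw [h]
    have := one_sub_norm_sq_pos ha
    have := one_sub_norm_sq_pos hw
    positivity
  nlinarith [norm_nonneg (phi a w)]

theorem moebiusLin_self {a : Cn n} (ha : ‖a‖ < 1) : moebiusLin a a = a := by
  have hpos := one_sub_norm_sq_pos ha
  have hs2 : Real.sqrt (1 - ‖a‖ ^ 2) ^ 2 = 1 - ‖a‖ ^ 2 := Real.sq_sqrt hpos.le
  have hs0 : 0 ≤ Real.sqrt (1 - ‖a‖ ^ 2) := Real.sqrt_nonneg _
  rw [moebiusLin_apply]
  set s := Real.sqrt (1 - ‖a‖ ^ 2)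
  have hi : inner ℂ a a = ((‖a‖ ^ 2 : ℝ) : ℂ) := by
    rw [inner_self_eq_norm_sq_to_K]; norm_cast
  have h1 : (1 + s)⁻¹ * ‖a‖ ^ 2 = 1 - s := by
    rw [inv_mul_eq_iff_eq_mul₀ (by positivity)]
    nlinarith
  have h2 : (((1 + s)⁻¹ : ℝ) : ℂ) * ((‖a‖ ^ 2 : ℝ) : ℂ) = 1 - s := by exact_mod_cast h1
  rw [hi, h2]
  module

theorem moebiusLin_moebiusLin {a : Cn n} (ha : ‖a‖ < 1) (w : Cn n) :
    moebiusLin a (moebiusLin a w) = ((1 - ‖a‖ ^ 2 : ℝ) : ℂ) • w + inner ℂ a w • a := by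
  have hpos := one_sub_norm_sq_pos ha
  have hs2 : Real.sqrt (1 - ‖a‖ ^ 2) ^ 2 = 1 - ‖a‖ ^ 2 := Real.sq_sqrt hpos.le
  have hs0 : 0 ≤ Real.sqrt (1 - ‖a‖ ^ 2) := Real.sqrt_nonneg _
  rw [moebiusLin_apply a (moebiusLin a w), inner_moebiusLin ha, moebiusLin_apply]
  have h3 : ((1 - ‖a‖ ^ 2 : ℝ) : ℂ) =
      (Real.sqrt (1 - ‖a‖ ^ 2) : ℝ) * (Real.sqrt (1 - ‖a‖ ^ 2) : ℝ) := by
    rw [← Complex.ofReal_mul, ← sq, hs2]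
  rw [h3]
  set s := Real.sqrt (1 - ‖a‖ ^ 2)
  have h1 : s * (1 + s)⁻¹ + (1 + s)⁻¹ = 1 := by field_simp; ring
  have h2 : (((1 + s)⁻¹ : ℝ) : ℂ) = 1 - (s : ℂ) * (((1 + s)⁻¹ : ℝ) : ℂ) := by
    rw [eq_sub_iff_add_eq, add_comm]; exact_mod_cast h1
  rw [smul_add, smul_smul, smul_smul, add_assoc, ← add_smul]
  congr 2
  linear_combination (inner ℂ a w) * h2

theorem phi_phi {a w : Cn n} (ha : ‖a‖ < 1) (hw : ‖w‖ < 1) : phi a (phi a w) = w := by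
  have h1 := one_sub_inner_ne_zero ha hw.le
  have hpos : ((1 - ‖a‖ ^ 2 : ℝ) : ℂ) ≠ 0 := by exact_mod_cast (one_sub_norm_sq_pos ha).ne'
  have hi : inner ℂ a a = ((‖a‖ ^ 2 : ℝ) : ℂ) := by
    rw [inner_self_eq_norm_sq_to_K]; norm_cast
  have h2 : 1 - inner ℂ a (phi a w) = ((1 - ‖a‖ ^ 2 : ℝ) : ℂ) / (1 - inner ℂ a w) := by
    rw [phi_eq ha, inner_smul_right, inner_sub_right, inner_moebiusLin ha, hi]
    push_cast
    field_simp
    ring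
  rw [phi_eq ha, h2, phi_eq ha, map_smul, map_sub, moebiusLin_self ha, moebiusLin_moebiusLin ha]
  have h3 : a - (((1 - ‖a‖ ^ 2 : ℝ) : ℂ) • w + inner ℂ a w • a) =
      (1 - inner ℂ a w) • a - ((1 - ‖a‖ ^ 2 : ℝ) : ℂ) • w := by module
  rw [h3, smul_sub _ ((1 - inner ℂ a w) • a), inv_smul_smul₀ h1, sub_sub_cancel,
    inv_div, smul_smul, smul_smul]
  have h4 : (1 - inner ℂ a w) / ((1 - ‖a‖ ^ 2 : ℝ) : ℂ) * (1 - inner ℂ a w)⁻¹ *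
      ((1 - ‖a‖ ^ 2 : ℝ) : ℂ) = 1 := by field_simp
  rw [h4, one_smul]

theorem phi_zero {a : Cn n} (ha : ‖a‖ < 1) : phi a 0 = a := by
  simp [phi_eq ha]

/-! ### Change of variables under the automorphisms -/

/-- The complex derivative of `φ_a` at `w`. -/
def phiDeriv (a w : Cn n) : Cn n →L[ℂ] Cn n :=
  -(1 - inner ℂ a w)⁻¹ • (moebiusLin a - (innerSL ℂ a).smulRight (phi a w))

theorem hasFDerivAt_phi {a w : Cn n} (ha : ‖a‖ < 1) (hw : ‖w‖ < 1) :
    HasFDerivAt (phi a) (phiDeriv a w) w := by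
  have hd := one_sub_inner_ne_zero ha hw.le
  have h1 : HasFDerivAt (fun w : Cn n => 1 - inner ℂ a w) (-(innerSL ℂ a)) w :=
    ((innerSL ℂ a).hasFDerivAt).const_sub 1
  have h1' : HasFDerivAt (fun w : Cn n => (1 - inner ℂ a w)⁻¹)
      ((-((1 - inner ℂ a w) ^ 2)⁻¹) • (-(innerSL ℂ a))) w :=
    (hasDerivAt_inv hd).comp_hasFDerivAt w h1
  have h2 : HasFDerivAt (fun w : Cn n => a - moebiusLin a w) (-(moebiusLin a)) w :=
    ((moebiusLin a).hasFDerivAt).const_sub a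
  have h3 := h1'.smul h2
  have : phi a = fun w => (1 - inner ℂ a w)⁻¹ • (a - moebiusLin a w) :=
    funext fun w => phi_eq ha w
  rw [this]
  refine h3.congr_fderiv ?_
  ext1 v
  simp only [phiDeriv, phi_eq ha, add_apply, smul_apply,
    neg_apply, ContinuousLinearMap.smulRight_apply,
    sub_apply, innerSL_apply_apply]
  have e : (-((1 - inner ℂ a w) ^ 2)⁻¹ * -inner ℂ a v) =
      (1 - inner ℂ a w)⁻¹ * (inner ℂ a v * (1 - inner ℂ a w)⁻¹) := by
    field_simp
  rw [smul_eq_mul, e]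
  module

/-- The determinant of the linear part is `s^{n-1}`; the factor `s` on the left avoids a natural
subtraction and covers `n = 0`. -/
theorem det_moebiusLin {a : Cn n} (ha : ‖a‖ < 1) :
    LinearMap.det (moebiusLin a : Cn n →ₗ[ℂ] Cn n) * (Real.sqrt (1 - ‖a‖ ^ 2) : ℝ) =
      ((Real.sqrt (1 - ‖a‖ ^ 2) : ℝ) : ℂ) ^ n := by
  have hpos := one_sub_norm_sq_pos ha
  have hs2 : Real.sqrt (1 - ‖a‖ ^ 2) ^ 2 = 1 - ‖a‖ ^ 2 := Real.sq_sqrt hpos.le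
  have hs0 : 0 < Real.sqrt (1 - ‖a‖ ^ 2) := Real.sqrt_pos.2 hpos
  have hA : (moebiusLin a : Cn n →ₗ[ℂ] Cn n) = ((Real.sqrt (1 - ‖a‖ ^ 2) : ℝ) : ℂ) •
      LinearMap.transvection (innerSL ℂ a : Cn n →ₗ[ℂ] ℂ)
        ((((1 + Real.sqrt (1 - ‖a‖ ^ 2))⁻¹ / Real.sqrt (1 - ‖a‖ ^ 2) : ℝ) : ℂ) • a) := by
    ext1 w
    have hs : ((Real.sqrt (1 - ‖a‖ ^ 2) : ℝ) : ℂ) ≠ 0 := by exact_mod_cast hs0.ne'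
    simp only [ContinuousLinearMap.coe_coe, moebiusLin_apply, LinearMap.smul_apply,
      LinearMap.transvection.apply, innerSL_apply_apply, smul_add, smul_smul, Complex.ofReal_div]
    congr 2
    field_simp
  have hi : inner ℂ a a = ((‖a‖ ^ 2 : ℝ) : ℂ) := by
    rw [inner_self_eq_norm_sq_to_K]; norm_cast
  rw [hA, LinearMap.det_smul, LinearMap.transvection.det, finrank_euclideanSpace_fin]
  simp only [ContinuousLinearMap.coe_coe, innerSL_apply_apply, inner_smul_right, hi]
  set s := Real.sqrt (1 - ‖a‖ ^ 2)
  have h1 : (1 + (1 + s)⁻¹ / s * ‖a‖ ^ 2) * s = 1 := by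
    field_simp
    nlinarith
  have h2 : (1 + (((1 + s)⁻¹ / s : ℝ) : ℂ) * ((‖a‖ ^ 2 : ℝ) : ℂ)) * s = 1 := by exact_mod_cast h1
  linear_combination (s : ℂ) ^ n * h2

/-- The real Jacobian determinant of `φ_a`: up to a scalar, the complex derivative is `moebiusLin a`
composed with a transvection. -/
theorem det_phiDeriv {a w : Cn n} (ha : ‖a‖ < 1) (hw : ‖w‖ < 1) :
    ((phiDeriv a w).restrictScalars ℝ).det =
      ((1 - ‖a‖ ^ 2) / ‖1 - inner ℂ a w‖ ^ 2) ^ (n + 1) := by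
  have hd := one_sub_inner_ne_zero ha hw.le
  have hpos := one_sub_norm_sq_pos ha
  have hs2 : Real.sqrt (1 - ‖a‖ ^ 2) ^ 2 = 1 - ‖a‖ ^ 2 := Real.sq_sqrt hpos.le
  have hs0 : 0 < Real.sqrt (1 - ‖a‖ ^ 2) := Real.sqrt_pos.2 hpos
  have hi : inner ℂ a a = ((‖a‖ ^ 2 : ℝ) : ℂ) := by
    rw [inner_self_eq_norm_sq_to_K]; norm_cast
  have hD : (phiDeriv a w : Cn n →ₗ[ℂ] Cn n) = (-(1 - inner ℂ a w)⁻¹) •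
      ((moebiusLin a : Cn n →ₗ[ℂ] Cn n) ∘ₗ
        LinearMap.transvection (-(innerSL ℂ a : Cn n →ₗ[ℂ] ℂ))
          ((1 - inner ℂ a w)⁻¹ • (a - w))) := by
    ext1 v
    simp only [phiDeriv, ContinuousLinearMap.coe_coe, smul_apply,
      sub_apply, ContinuousLinearMap.smulRight_apply, innerSL_apply_apply,
      LinearMap.smul_apply, LinearMap.comp_apply, LinearMap.transvection.apply, LinearMap.neg_apply,
      map_add, map_smul, map_sub, moebiusLin_self ha, phi_eq ha]
    module
  have hdet : LinearMap.det (phiDeriv a w : Cn n →ₗ[ℂ] Cn n) * (Real.sqrt (1 - ‖a‖ ^ 2) : ℝ) =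
      (-(1 - inner ℂ a w)⁻¹) ^ n * ((Real.sqrt (1 - ‖a‖ ^ 2) : ℝ) : ℂ) ^ n *
        (((1 - ‖a‖ ^ 2 : ℝ) : ℂ) / (1 - inner ℂ a w)) := by
    rw [hD, LinearMap.det_smul, LinearMap.det_comp, LinearMap.transvection.det,
      finrank_euclideanSpace_fin, ← det_moebiusLin ha]
    simp only [LinearMap.neg_apply, ContinuousLinearMap.coe_coe, innerSL_apply_apply,
      inner_smul_right, inner_sub_right, hi]
    have : 1 + -((1 - inner ℂ a w)⁻¹ * (((‖a‖ ^ 2 : ℝ) : ℂ) - inner ℂ a w)) =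
        ((1 - ‖a‖ ^ 2 : ℝ) : ℂ) / (1 - inner ℂ a w) := by
      push_cast
      field_simp
      ring
    rw [this]
    ring
  have hnorm := congrArg (fun z : ℂ => ‖z‖ ^ 2) hdet
  simp only [norm_mul, norm_pow, norm_neg, norm_inv, norm_div, Complex.norm_real,
    Real.norm_of_nonneg hs0.le, Real.norm_of_nonneg hpos.le, mul_pow, ← pow_mul, mul_comm n 2,
    div_pow] at hnorm
  rw [pow_mul _ 2 n, pow_mul _ 2 n, hs2] at hnorm
  have hR : ((phiDeriv a w).restrictScalars ℝ).det =
      ‖LinearMap.det (phiDeriv a w : Cn n →ₗ[ℂ] Cn n)‖ ^ 2 := by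
    have := LinearMap.det_restrictScalars (R := ℝ) (f := (phiDeriv a w : Cn n →ₗ[ℂ] Cn n))
    rw [Algebra.norm_complex_apply, Complex.normSq_eq_norm_sq] at this
    exact this
  rw [hR]
  have hdn : ‖1 - inner ℂ a w‖ ≠ 0 := norm_ne_zero_iff.2 hd
  have := mul_right_cancel₀ hpos.ne' (hnorm.trans (b := _) (c := ((1 - ‖a‖ ^ 2) /
    ‖1 - inner ℂ a w‖ ^ 2) ^ (n + 1) * (1 - ‖a‖ ^ 2)) ?_)
  · exact this
  · rw [inv_pow, inv_pow, div_pow]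
    field_simp
    ring

/-- The weight `|k_z(w)|² = ((1 - |z|²) / |1 - ⟨w, z⟩|²)^{n+1+α}` of the Berezin transform. -/
def bweight (n : ℕ) (α : ℝ) (z w : Cn n) : ℝ :=
  ((1 - ‖z‖ ^ 2) / ‖1 - inner ℂ z w‖ ^ 2) ^ (n + 1 + α)

theorem norm_normKernel_sq {z w : Cn n} (hz : ‖z‖ < 1) :
    ‖normKernel n α z w‖ ^ 2 = bweight n α z w := by
  have hpos := one_sub_norm_sq_pos hz
  rw [normKernel, norm_div, Complex.norm_cpow_real, Complex.norm_real,
    Real.norm_of_nonneg (by positivity), bweight, Real.div_rpow hpos.le (by positivity), div_pow,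
    ← Real.rpow_mul_natCast hpos.le, ← Real.rpow_natCast_mul (norm_nonneg _),
    ← Real.rpow_mul_natCast (norm_nonneg _)]
  congr 2
  · push_cast; ring
  · push_cast; ring

theorem measurable_nuAlpha_density :
    Measurable fun z : Cn n => ENNReal.ofReal (cAlpha n α * (1 - ‖z‖ ^ 2) ^ α) := by
  fun_prop

theorem lintegral_nuAlpha (Φ : Cn n → ℝ≥0∞) :
    ∫⁻ z, Φ z ∂(nuAlpha n α) = (volume (unitBall n))⁻¹ *
      ∫⁻ z in unitBall n, ENNReal.ofReal (cAlpha n α * (1 - ‖z‖ ^ 2) ^ α) * Φ z := by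
  rw [nuAlpha, lintegral_withDensity_eq_lintegral_mul_non_measurable _
    measurable_nuAlpha_density (ae_of_all _ fun _ => ENNReal.ofReal_lt_top), nu,
    lintegral_smul_measure]
  rfl

theorem nuAlpha_compl_unitBall : nuAlpha n α (unitBall n)ᶜ = 0 := by
  refine withDensity_absolutelyContinuous _ _ ?_
  simp [nu, measurableSet_ball.compl]

theorem ae_mem_unitBall : ∀ᵐ z ∂(nuAlpha n α), ‖z‖ < 1 := by
  have : ∀ᵐ z ∂(nuAlpha n α), z ∈ unitBall n := by
    rw [ae_iff]; exact nuAlpha_compl_unitBall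
  filter_upwards [this] with z hz using by simpa using hz

theorem cAlpha_pos (hα : -1 < α) : 0 < cAlpha n α := by
  have h1 : 0 < Real.Gamma (n + α + 1) := Real.Gamma_pos_of_pos
    (by have : (0 : ℝ) ≤ n := n.cast_nonneg; linarith)
  have h2 : 0 < Real.Gamma (α + 1) := Real.Gamma_pos_of_pos (by linarith)
  unfold cAlpha
  positivity

theorem phi_image_unitBall {a : Cn n} (ha : ‖a‖ < 1) : phi a '' unitBall n = unitBall n := by
  ext w
  simp only [Set.mem_image, mem_ball_zero_iff]
  constructor
  · rintro ⟨v, hv, rfl⟩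
    exact norm_phi_lt_one ha hv
  · exact fun hw => ⟨phi a w, norm_phi_lt_one ha hw, phi_phi ha hw⟩

theorem phi_injOn {a : Cn n} (ha : ‖a‖ < 1) : Set.InjOn (phi a) (unitBall n) := by
  intro v hv w hw h
  rw [mem_ball_zero_iff] at hv hw
  rw [← phi_phi ha hv, h, phi_phi ha hw]

theorem phi_jacobian {a w : Cn n} (ha : ‖a‖ < 1) (hw : ‖w‖ < 1) :
    |((phiDeriv a w).restrictScalars ℝ).det| * (1 - ‖phi a w‖ ^ 2) ^ α =
      (1 - ‖w‖ ^ 2) ^ α * bweight n α a w := by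
  have hpos := one_sub_norm_sq_pos ha
  have hposw := one_sub_norm_sq_pos hw
  have hd := norm_pos_iff.2 (one_sub_inner_ne_zero ha hw.le)
  have hx : 0 < (1 - ‖a‖ ^ 2) / ‖1 - inner ℂ a w‖ ^ 2 := by positivity
  rw [det_phiDeriv ha hw, abs_of_nonneg (by positivity), one_sub_norm_phi_sq ha hw.le, bweight,
    mul_div_right_comm, Real.mul_rpow hx.le hposw.le, Real.rpow_add hx, ← Real.rpow_natCast]
  push_cast
  ring

/-- Change of variables under the automorphism `φ_a`, for functions with values in `[0, ∞]`. -/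
theorem lintegral_comp_phi {a : Cn n} (hα : -1 < α) (ha : ‖a‖ < 1) (Φ : Cn n → ℝ≥0∞) :
    ∫⁻ w, Φ w ∂(nuAlpha n α) =
      ∫⁻ w, Φ (phi a w) * ENNReal.ofReal (bweight n α a w) ∂(nuAlpha n α) := by
  rw [lintegral_nuAlpha, lintegral_nuAlpha]
  congr 1
  conv_lhs => rw [← phi_image_unitBall ha]
  rw [lintegral_image_eq_lintegral_abs_det_fderiv_mul volume measurableSet_ball
    (fun w hw => ((hasFDerivAt_phi ha (by simpa using hw)).restrictScalars ℝ).hasFDerivWithinAt)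
    (phi_injOn ha)]
  refine setLIntegral_congr_fun measurableSet_ball fun w hw => ?_
  rw [mem_ball_zero_iff] at hw
  have hc := (cAlpha_pos (n := n) hα).le
  have h := phi_jacobian (α := α) ha hw
  have hposw := one_sub_norm_sq_pos hw
  rw [← mul_assoc, ← ENNReal.ofReal_mul (abs_nonneg _), mul_left_comm, h, ← mul_assoc,
    ENNReal.ofReal_mul (by positivity)]
  ring

theorem lintegral_phi_comp {a : Cn n} (hα : -1 < α) (ha : ‖a‖ < 1) (Φ : Cn n → ℝ≥0∞) :
    ∫⁻ w, Φ (phi a w) ∂(nuAlpha n α) =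
      ∫⁻ w, Φ w * ENNReal.ofReal (bweight n α a w) ∂(nuAlpha n α) := by
  rw [lintegral_comp_phi hα ha]
  refine lintegral_congr_ae ?_
  filter_upwards [ae_mem_unitBall] with w hw
  rw [phi_phi ha hw]

theorem integral_nuAlpha {E : Type*} [NormedAddCommGroup E] [NormedSpace ℝ E] (hα : -1 < α)
    (Φ : Cn n → E) :
    ∫ z, Φ z ∂(nuAlpha n α) = (volume (unitBall n))⁻¹.toReal •
      ∫ z in unitBall n, (cAlpha n α * (1 - ‖z‖ ^ 2) ^ α) • Φ z := by
  rw [nuAlpha, integral_withDensity_eq_integral_toReal_smul measurable_nuAlpha_density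
    (ae_of_all _ fun _ => ENNReal.ofReal_lt_top), nu, integral_smul_measure]
  congr 1
  refine setIntegral_congr_fun measurableSet_ball fun z hz => ?_
  have hposw := one_sub_norm_sq_pos (mem_ball_zero_iff.1 hz)
  have hc := (cAlpha_pos (n := n) hα).le
  rw [ENNReal.toReal_ofReal (by positivity)]

/-- Change of variables under the automorphism `φ_a`, for vector-valued functions. -/
theorem integral_comp_phi {E : Type*} [NormedAddCommGroup E] [NormedSpace ℝ E] {a : Cn n}
    (hα : -1 < α) (ha : ‖a‖ < 1) (Φ : Cn n → E) :
    ∫ w, Φ w ∂(nuAlpha n α) = ∫ w, bweight n α a w • Φ (phi a w) ∂(nuAlpha n α) := by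
  rw [integral_nuAlpha hα, integral_nuAlpha hα]
  congr 1
  conv_lhs => rw [← phi_image_unitBall ha]
  rw [integral_image_eq_integral_abs_det_fderiv_smul volume measurableSet_ball
    (fun w hw => ((hasFDerivAt_phi ha (by simpa using hw)).restrictScalars ℝ).hasFDerivWithinAt)
    (phi_injOn ha)]
  refine setIntegral_congr_fun measurableSet_ball fun w hw => ?_
  rw [mem_ball_zero_iff] at hw
  have h := phi_jacobian (α := α) ha hw
  rw [smul_smul, smul_smul, mul_left_comm, h, mul_assoc]

theorem integral_phi_comp {E : Type*} [NormedAddCommGroup E] [NormedSpace ℝ E] {a : Cn n}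
    (hα : -1 < α) (ha : ‖a‖ < 1) (Φ : Cn n → E) :
    ∫ w, Φ (phi a w) ∂(nuAlpha n α) = ∫ w, bweight n α a w • Φ w ∂(nuAlpha n α) := by
  rw [integral_comp_phi hα ha]
  refine integral_congr_ae ?_
  filter_upwards [ae_mem_unitBall] with w hw
  rw [phi_phi ha hw]

/-! ### Invariance, finiteness and positivity of the measure -/

theorem measurePreserving_nuAlpha (U : Cn n ≃ₗᵢ[ℂ] Cn n) :
    MeasurePreserving U (nuAlpha n α) (nuAlpha n α) := by
  have hU : MeasurePreserving U (volume : Measure (Cn n)) volume :=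
    (LinearIsometryEquiv.measurePreserving (E := Cn n) (F := Cn n)
      { toLinearEquiv := U.toLinearEquiv.restrictScalars ℝ, norm_map' := U.norm_map })
  have hB : U ⁻¹' unitBall n = unitBall n := by
    ext w; simp
  refine ⟨U.continuous.measurable, ?_⟩
  ext s hs
  rw [Measure.map_apply U.continuous.measurable hs, ← lintegral_indicator_one hs,
    ← lintegral_indicator_one (U.continuous.measurable hs), lintegral_nuAlpha, lintegral_nuAlpha]
  congr 1
  conv_rhs => rw [← hU.setLIntegral_comp_preimage_emb U.toHomeomorph.measurableEmbedding, hB]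
  refine lintegral_congr fun w => ?_
  rw [U.norm_map]
  rfl

theorem integrableOn_one_sub_norm_sq_rpow (hα : -1 < α) :
    IntegrableOn (fun z : Cn n => (1 - ‖z‖ ^ 2) ^ α) (unitBall n) := by
  rcases Nat.eq_zero_or_pos n with rfl | hn
  · have : (fun z : Cn 0 => (1 - ‖z‖ ^ 2) ^ α) = fun _ => 1 := by
      ext z
      simp [Subsingleton.elim z 0]
    rw [this]
    exact integrableOn_const (by simp)
  · have : Nonempty (Fin n) := ⟨⟨0, hn⟩⟩
    rw [integrableOn_fun_norm_addHaar volume (f := fun y : ℝ => (1 - y ^ 2) ^ α),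
      ← integrableOn_Ioc_iff_integrableOn_Ioo,
      ← intervalIntegrable_iff_integrableOn_Ioc_of_le zero_le_one]
    have h1 : IntervalIntegrable (fun y : ℝ => (1 - y) ^ α) volume 0 1 := by
      have := (intervalIntegral.intervalIntegrable_rpow' (a := 0) (b := 1) hα).comp_sub_left 1
      simpa using this.symm
    have h2 : ContinuousOn (fun y : ℝ => y ^ (Module.finrank ℝ (Cn n) - 1) * (1 + y) ^ α)
        (Set.uIcc 0 1) := by
      refine (by fun_prop : Continuous fun y : ℝ =>
        y ^ (Module.finrank ℝ (Cn n) - 1)).continuousOn.mul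
          (ContinuousOn.rpow_const (by fun_prop) fun y hy => Or.inl ?_)
      rw [Set.uIcc_of_le zero_le_one] at hy
      linarith [hy.1]
    refine (h1.mul_continuousOn h2).congr ?_
    intro y hy
    rw [Set.uIoc_of_le zero_le_one] at hy
    have : (1 - y ^ 2 : ℝ) = (1 - y) * (1 + y) := by ring
    simp only [smul_eq_mul]
    rw [this, Real.mul_rpow (by linarith [hy.2]) (by linarith [hy.1])]
    ring

theorem isFiniteMeasure_nuAlpha (hα : -1 < α) : IsFiniteMeasure (nuAlpha n α) := by
  refine ⟨?_⟩
  rw [← lintegral_one, lintegral_nuAlpha]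
  refine ENNReal.mul_lt_top ?_ ?_
  · exact ENNReal.inv_lt_top.2 (measure_ball_pos _ _ one_pos)
  · have := ((integrableOn_one_sub_norm_sq_rpow (n := n) hα).const_mul
      (cAlpha n α)).lintegral_lt_top
    simpa using this

theorem nuAlpha_ball_pos (hα : -1 < α) {r : ℝ} (hr : 0 < r) (hr1 : r ≤ 1) :
    0 < nuAlpha n α (ball 0 r) := by
  rw [nuAlpha, withDensity_apply _ measurableSet_ball]
  rw [setLIntegral_pos_iff measurable_nuAlpha_density]
  have hsub : ball (0 : Cn n) r ⊆ Function.support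
      (fun z : Cn n => ENNReal.ofReal (cAlpha n α * (1 - ‖z‖ ^ 2) ^ α)) ∩ ball 0 r := by
    intro z hz
    refine ⟨?_, hz⟩
    have := one_sub_norm_sq_pos (a := z) (by rw [mem_ball_zero_iff] at hz; linarith)
    have hc := cAlpha_pos (n := n) hα
    have : 0 < cAlpha n α * (1 - ‖z‖ ^ 2) ^ α := by positivity
    simpa using this
  refine lt_of_lt_of_le ?_ (measure_mono hsub)
  rw [nu, Measure.smul_apply, Measure.restrict_apply measurableSet_ball,
    Set.inter_eq_left.2 (ball_subset_ball hr1), smul_eq_mul]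
  exact ENNReal.mul_pos (ENNReal.inv_ne_zero.2 measure_ball_lt_top.ne)
    (measure_ball_pos _ _ hr).ne'

/-! ### The mean value property and the reproducing formula -/

/-- Multiplication by a unimodular scalar. -/
def rotation (c : ℂ) (hc : ‖c‖ = 1) : Cn n ≃ₗᵢ[ℂ] Cn n where
  toLinearEquiv := LinearEquiv.smulOfNeZero ℂ (Cn n) c (by rintro rfl; simp at hc)
  norm_map' w := by simp [norm_smul, hc]

@[simp] theorem rotation_apply (c : ℂ) (hc : ‖c‖ = 1) (w : Cn n) : rotation c hc w = c • w := rfl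

/-- Mean value property: a rotation invariant measure on a ball integrates a holomorphic function to
its value at the centre times the total mass. -/
theorem integral_eq_of_rotation_invariant {μ : Measure (Cn n)} [SFinite μ]
    (hμ : ∀ (c : ℂ) (hc : ‖c‖ = 1), MeasurePreserving (rotation c hc : Cn n → Cn n) μ μ)
    {R : ℝ} (hR : ∀ᵐ w ∂μ, ‖w‖ < R) {h : Cn n → ℂ} (hd : DifferentiableOn ℂ h (ball 0 R))
    (hi : Integrable h μ) : ∫ w, h w ∂μ = μ.real Set.univ • h 0 := by
  have hc (θ : ℝ) : ‖circleMap 0 1 θ‖ = 1 := by simp [circleMap]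
  let ρ : Measure ℝ := volume.restrict (Set.Ioc 0 (2 * Real.pi))
  have hskew : MeasurePreserving (fun p : ℝ × Cn n => (p.1, circleMap 0 1 p.1 • p.2))
      (ρ.prod μ) (ρ.prod μ) := by
    refine (MeasurePreserving.id ρ).skew_product (g := fun θ w => circleMap 0 1 θ • w)
      (by fun_prop) (ae_of_all _ fun θ => ?_)
    exact (hμ _ (hc θ)).map_eq
  have hint : Integrable (fun p : ℝ × Cn n => h (circleMap 0 1 p.1 • p.2)) (ρ.prod μ) :=
    hskew.integrable_comp_of_integrable (g := fun p : ℝ × Cn n => h p.2) (hi.comp_snd ρ)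
  have h1 : ∫ θ, ∫ w, h (circleMap 0 1 θ • w) ∂μ ∂ρ = (2 * Real.pi) • ∫ w, h w ∂μ := by
    have (θ : ℝ) : ∫ w, h (circleMap 0 1 θ • w) ∂μ = ∫ w, h w ∂μ :=
      (hμ _ (hc θ)).integral_comp (rotation _ (hc θ)).toHomeomorph.measurableEmbedding h
    simp only [this, integral_const, ρ]
    simp [Real.pi_pos.le]
  have h2 : ∫ w, ∫ θ, h (circleMap 0 1 θ • w) ∂ρ ∂μ = (2 * Real.pi) • (μ.real Set.univ • h 0) := by
    have : ∀ᵐ w ∂μ, ∫ θ, h (circleMap 0 1 θ • w) ∂ρ = (2 * Real.pi) • h 0 := by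
      filter_upwards [hR] with w hw
      have hdc : DiffContOnCl ℂ (fun c : ℂ => h (c • w)) (ball 0 |1|) := by
        apply DifferentiableOn.diffContOnCl
        refine hd.comp (by fun_prop) fun c hc => ?_
        rw [abs_one, closure_ball _ one_ne_zero, mem_closedBall_zero_iff] at hc
        rw [mem_ball_zero_iff, norm_smul]
        nlinarith [norm_nonneg w, norm_nonneg c]
      have := hdc.circleAverage
      rw [Real.circleAverage, zero_smul, intervalIntegral.integral_of_le (by positivity)] at this
      rw [← this, smul_smul, mul_inv_cancel₀ (by positivity), one_smul]
    rw [integral_congr_ae this, integral_const]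
    rw [smul_comm]
  have h3 := integral_integral_swap (f := fun θ w => h (circleMap 0 1 θ • w)) hint
  rw [h1, h2] at h3
  exact smul_right_injective ℂ (by positivity : (2 * Real.pi) ≠ 0) h3

theorem integral_ball_nuAlpha (hα : -1 < α) {r : ℝ} (hr : r ≤ 1) {h : Cn n → ℂ}
    (hd : DifferentiableOn ℂ h (unitBall n)) (hi : IntegrableOn h (ball 0 r) (nuAlpha n α)) :
    ∫ w in ball 0 r, h w ∂(nuAlpha n α) = (nuAlpha n α).real (ball 0 r) • h 0 := by
  have := isFiniteMeasure_nuAlpha (n := n) hα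
  have key := integral_eq_of_rotation_invariant (μ := (nuAlpha n α).restrict (ball 0 r)) (R := r)
    (fun c hc => ?_) ?_ (hd.mono (ball_subset_ball hr)) hi
  · simpa [Measure.real] using key
  · have := (measurePreserving_nuAlpha (n := n) (α := α) (rotation c hc)).restrict_preimage
      (s := ball 0 r) measurableSet_ball
    have e : (rotation c hc : Cn n → Cn n) ⁻¹' ball 0 r = ball 0 r := by
      ext w; simp
    rwa [e] at this
  · filter_upwards [ae_restrict_mem measurableSet_ball] with w hw using by simpa using hw

theorem aestronglyMeasurable_of_continuousOn {E : Type*} [NormedAddCommGroup E]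
    [SecondCountableTopologyEither (Cn n) E] {f : Cn n → E}
    (hf : ContinuousOn f (unitBall n)) : AEStronglyMeasurable f (nuAlpha n α) := by
  refine AEStronglyMeasurable.mono_ac (withDensity_absolutelyContinuous _ _) ?_
  exact (hf.aestronglyMeasurable measurableSet_ball).smul_measure _

theorem integrable_of_continuousOn_of_bound {E : Type*} [NormedAddCommGroup E]
    [SecondCountableTopologyEither (Cn n) E] (hα : -1 < α) {f : Cn n → E}
    (hf : ContinuousOn f (unitBall n)) {C : ℝ} (hC : ∀ w, ‖w‖ < 1 → ‖f w‖ ≤ C) :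
    Integrable f (nuAlpha n α) := by
  have := isFiniteMeasure_nuAlpha (n := n) hα
  exact Integrable.of_bound (aestronglyMeasurable_of_continuousOn hf) C
    (ae_mem_unitBall.mono fun w hw => hC w hw)

theorem integral_nuAlpha_of_differentiableOn (hα : -1 < α) {h : Cn n → ℂ}
    (hd : DifferentiableOn ℂ h (unitBall n)) (hi : Integrable h (nuAlpha n α)) :
    ∫ w, h w ∂(nuAlpha n α) = (nuAlpha n α).real Set.univ • h 0 := by
  have e : (nuAlpha n α).restrict (ball 0 1) = nuAlpha n α :=
    Measure.restrict_eq_self_of_ae_mem (ae_mem_unitBall.mono fun w hw => by simpa using hw)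
  have := integral_ball_nuAlpha hα le_rfl hd hi.integrableOn
  rw [e] at this
  rw [this, Measure.real, Measure.real, ← e, Measure.restrict_apply_univ, e]

theorem differentiableOn_phi {a : Cn n} (ha : ‖a‖ < 1) :
    DifferentiableOn ℂ (phi a) (unitBall n) := fun _ hw =>
  (hasFDerivAt_phi ha (by simpa using hw)).differentiableAt.differentiableWithinAt

theorem mapsTo_phi {a : Cn n} (ha : ‖a‖ < 1) : Set.MapsTo (phi a) (unitBall n) (unitBall n) :=
  fun w hw => by
    rw [mem_ball_zero_iff] at hw ⊢
    exact norm_phi_lt_one ha hw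

theorem one_sub_norm_le {z w : Cn n} (hw : ‖w‖ ≤ 1) : 1 - ‖z‖ ≤ ‖1 - inner ℂ z w‖ := by
  have h1 := norm_inner_le_norm (𝕜 := ℂ) z w
  have h2 := norm_sub_norm_le 1 (inner ℂ z w)
  rw [norm_one] at h2
  nlinarith [norm_nonneg z, norm_nonneg w]

theorem bweight_nonneg {z w : Cn n} (hz : ‖z‖ ≤ 1) : 0 ≤ bweight n α z w := by
  refine Real.rpow_nonneg (div_nonneg ?_ (by positivity)) _
  nlinarith [norm_nonneg z]

theorem exponent_pos (n : ℕ) (hα : -1 < α) : 0 < (n : ℝ) + 1 + α := by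
  have : (0 : ℝ) ≤ n := n.cast_nonneg
  linarith

theorem one_sub_inner_mem_slitPlane {z w : Cn n} (hz : ‖z‖ < 1) (hw : ‖w‖ ≤ 1) :
    1 - inner ℂ z w ∈ Complex.slitPlane :=
  Or.inl (one_sub_inner_re_pos hz hw)

theorem differentiableAt_one_sub_inner_cpow {z w : Cn n} (hz : ‖z‖ < 1) (hw : ‖w‖ < 1) (s : ℂ) :
    DifferentiableAt ℂ (fun w : Cn n => (1 - inner ℂ z w) ^ s) w := by
  refine DifferentiableAt.cpow ?_ (by fun_prop) (one_sub_inner_mem_slitPlane hz hw.le)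
  exact (differentiableAt_const _).sub (innerSL ℂ z).differentiableAt

theorem conj_one_sub_inner (z w : Cn n) :
    starRingEnd ℂ (1 - inner ℂ z w) = 1 - inner ℂ w z := by simp

theorem conj_one_sub_inner_cpow {z w : Cn n} (hz : ‖z‖ < 1) (hw : ‖w‖ ≤ 1) (s : ℝ) :
    starRingEnd ℂ ((1 - inner ℂ z w) ^ (s : ℂ)) = (1 - inner ℂ w z) ^ (s : ℂ) := by
  rw [← conj_one_sub_inner z w, Complex.conj_cpow _ _ (Complex.slitPlane_arg_ne_pi
    (one_sub_inner_mem_slitPlane hz hw)), Complex.conj_ofReal]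

theorem differentiableOn_kernel {a : Cn n} (ha : ‖a‖ < 1) :
    DifferentiableOn ℂ (kernel n α a) (unitBall n) := by
  intro w hw
  rw [mem_ball_zero_iff] at hw
  refine DifferentiableAt.differentiableWithinAt ?_
  change DifferentiableAt ℂ (fun w => 1 / (1 - inner ℂ a w) ^ ((n + 1 + α : ℝ) : ℂ)) w
  simp only [one_div]
  refine (differentiableAt_one_sub_inner_cpow ha hw _).fun_inv ?_
  rw [Complex.cpow_ne_zero_iff]
  exact Or.inl (one_sub_inner_ne_zero ha hw.le)

theorem norm_kernel_le (hα : -1 < α) {a w : Cn n} (ha : ‖a‖ < 1) (hw : ‖w‖ ≤ 1) :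
    ‖kernel n α a w‖ ≤ 1 / (1 - ‖a‖) ^ (n + 1 + α) := by
  rw [kernel, norm_div, norm_one, Complex.norm_cpow_real]
  have := exponent_pos n hα
  have h0 : 0 < 1 - ‖a‖ := by linarith
  have := one_sub_norm_le (z := a) hw
  gcongr

/-- The Berezin weight splits as `|k_a|² = (1 - |a|²)^N K_a conj K_a`. -/
theorem bweight_smul_eq {a w : Cn n} (ha : ‖a‖ < 1) (hw : ‖w‖ ≤ 1) (g : ℂ) :
    bweight n α a w • (g * (1 - inner ℂ a w) ^ ((n + 1 + α : ℝ) : ℂ)) =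
      (((1 - ‖a‖ ^ 2) ^ (n + 1 + α) : ℝ) : ℂ) * (starRingEnd ℂ (kernel n α a w) * g) := by
  have hd := one_sub_inner_ne_zero ha hw
  have hc : (1 - inner ℂ a w) ^ ((n + 1 + α : ℝ) : ℂ) ≠ 0 := by
    rw [Complex.cpow_ne_zero_iff]; exact Or.inl hd
  have hpos := one_sub_norm_sq_pos ha
  have hb : (bweight n α a w : ℂ) = (((1 - ‖a‖ ^ 2) ^ (n + 1 + α) : ℝ) : ℂ) /
      ((1 - inner ℂ a w) ^ ((n + 1 + α : ℝ) : ℂ) *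
        starRingEnd ℂ ((1 - inner ℂ a w) ^ ((n + 1 + α : ℝ) : ℂ))) := by
    rw [Complex.mul_conj, Complex.normSq_eq_norm_sq, Complex.norm_cpow_real, bweight,
      Real.div_rpow hpos.le (by positivity), ← Real.rpow_mul_natCast (norm_nonneg _),
      ← Real.rpow_natCast_mul (norm_nonneg _), mul_comm (n + 1 + α)]
    push_cast
    rfl
  have hc' : starRingEnd ℂ ((1 - inner ℂ a w) ^ ((n + 1 + α : ℝ) : ℂ)) ≠ 0 := by
    simpa using hc
  rw [Complex.real_smul, hb, kernel, map_div₀, map_one]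
  field_simp

/-- The reproducing formula; the total mass of `ν_α` is kept as a factor. -/
theorem integral_conj_kernel_mul (hα : -1 < α) {a : Cn n} (ha : ‖a‖ < 1) {g : Cn n → ℂ}
    (hd : DifferentiableOn ℂ g (unitBall n)) (hi : Integrable g (nuAlpha n α)) :
    ∫ w, starRingEnd ℂ (kernel n α a w) * g w ∂(nuAlpha n α) =
      (nuAlpha n α).real Set.univ * g a := by
  have hpos := one_sub_norm_sq_pos ha
  -- The mean value property is applied to `h ∘ φ_a`, where `h` is chosen so that the weight of the
  -- change of variables leaves only the conjugate kernel.
  let h : Cn n → ℂ := fun w => g w * (1 - inner ℂ a w) ^ ((n + 1 + α : ℝ) : ℂ)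
  have hh : DifferentiableOn ℂ h (unitBall n) := hd.mul fun w hw =>
    (differentiableAt_one_sub_inner_cpow ha (by simpa using hw) _).differentiableWithinAt
  have hhφ : DifferentiableOn ℂ (fun w => h (phi a w)) (unitBall n) :=
    hh.comp (differentiableOn_phi ha) (mapsTo_phi ha)
  have hK : Integrable (fun w => (((1 - ‖a‖ ^ 2) ^ (n + 1 + α) : ℝ) : ℂ) *
      (starRingEnd ℂ (kernel n α a w) * g w)) (nuAlpha n α) := by
    refine Integrable.const_mul (hi.bdd_mul (c := 1 / (1 - ‖a‖) ^ (n + 1 + α)) ?_ ?_) _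
    · exact (Complex.continuous_conj.comp_aestronglyMeasurable
        (aestronglyMeasurable_of_continuousOn (differentiableOn_kernel ha).continuousOn))
    · filter_upwards [ae_mem_unitBall] with w hw
      rw [RCLike.norm_conj]
      exact norm_kernel_le hα ha hw.le
  have hae : (fun w => bweight n α a w • h w) =ᵐ[nuAlpha n α] fun w =>
      (((1 - ‖a‖ ^ 2) ^ (n + 1 + α) : ℝ) : ℂ) * (starRingEnd ℂ (kernel n α a w) * g w) := by
    filter_upwards [ae_mem_unitBall] with w hw
    exact bweight_smul_eq ha hw.le _
  have hint : Integrable (fun w => h (phi a w)) (nuAlpha n α) := by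
    refine ⟨aestronglyMeasurable_of_continuousOn hhφ.continuousOn, ?_⟩
    have hfin := (hK.congr hae.symm).2
    rw [hasFiniteIntegral_iff_enorm] at hfin ⊢
    rw [lintegral_phi_comp hα ha (fun w => ‖h w‖ₑ)]
    refine lt_of_eq_of_lt (lintegral_congr fun w => ?_) hfin
    rw [enorm_smul, mul_comm, Real.enorm_of_nonneg (bweight_nonneg ha.le)]
  have h1 := integral_nuAlpha_of_differentiableOn hα hhφ hint
  rw [integral_phi_comp hα ha, integral_congr_ae hae, integral_const_mul, phi_zero ha] at h1
  have h2 : h a = g a * (((1 - ‖a‖ ^ 2) ^ (n + 1 + α) : ℝ) : ℂ) := by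
    simp only [h]
    rw [inner_self_eq_norm_sq_to_K, Complex.ofReal_cpow hpos.le]
    push_cast
    rfl
  have h3 : (((1 - ‖a‖ ^ 2) ^ (n + 1 + α) : ℝ) : ℂ) ≠ 0 := by
    exact_mod_cast (Real.rpow_pos_of_pos hpos _).ne'
  rw [h2, Complex.real_smul] at h1
  refine mul_left_cancel₀ h3 (h1.trans ?_)
  ring

/-! ### Sub-mean value estimates -/

theorem bweight_le (hα : -1 < α) {v w : Cn n} (hv : ‖v‖ ≤ 1 / 4) (hw : ‖w‖ ≤ 1) :
    bweight n α v w ≤ (16 / 9) ^ (n + 1 + α) := by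
  have h1 := one_sub_norm_le (z := v) hw
  have h2 : 9 / 16 ≤ ‖1 - inner ℂ v w‖ ^ 2 := by nlinarith
  refine Real.rpow_le_rpow (div_nonneg ?_ (by positivity)) ?_ (exponent_pos n hα).le
  · nlinarith [norm_nonneg v]
  · rw [div_le_iff₀ (by linarith)]
    nlinarith [norm_nonneg v]

theorem norm_sq_lt_half_of_norm_phi_lt {v w : Cn n} (hv : ‖v‖ ≤ 1 / 4) (hw : ‖w‖ < 1)
    (h : ‖phi v w‖ < 1 / 4) : ‖w‖ ^ 2 < 1 / 2 := by
  have hv1 : ‖v‖ < 1 := by linarith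
  have h1 := one_sub_norm_le (z := v) hw.le
  have h2 : 9 / 16 ≤ ‖1 - inner ℂ v w‖ ^ 2 := by nlinarith
  have h3 := one_sub_norm_phi_sq hv1 hw.le
  rw [eq_div_iff (by positivity)] at h3
  have h4 : 15 / 16 < 1 - ‖phi v w‖ ^ 2 := by nlinarith [norm_nonneg (phi v w)]
  have hw2 := one_sub_norm_sq_pos hw
  nlinarith [norm_nonneg v, mul_nonneg (sq_nonneg ‖v‖) hw2.le,
    mul_pos (sub_pos.2 h4) (by linarith : 0 < ‖1 - inner ℂ v w‖ ^ 2)]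

/-- The squared `L²` norm of `h` over the pseudohyperbolic ball `|w|² < 1/2` about the origin. -/
def localSq (n : ℕ) (α : ℝ) (h : Cn n → ℂ) : ℝ≥0∞ :=
  ∫⁻ w in {w | ‖w‖ ^ 2 < 1 / 2}, ‖h w‖ₑ ^ 2 ∂(nuAlpha n α)

theorem setLIntegral_phi_comp (hα : -1 < α) {v : Cn n} (hv : ‖v‖ < 1) {S : Set (Cn n)}
    (hS : MeasurableSet S) (Ψ : Cn n → ℝ≥0∞) :
    ∫⁻ w in S, Ψ (phi v w) ∂(nuAlpha n α) =
      ∫⁻ w, S.indicator 1 (phi v w) * Ψ w * ENNReal.ofReal (bweight n α v w) ∂(nuAlpha n α) := by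
  have key := lintegral_phi_comp hα hv (fun w => S.indicator 1 (phi v w) * Ψ w)
  rw [← key, ← lintegral_indicator hS]
  refine lintegral_congr_ae ?_
  filter_upwards [ae_mem_unitBall] with w hw
  rw [phi_phi hv hw]
  by_cases h : w ∈ S <;> simp [h]

/-- Sub-mean value estimate: apply the mean value property to `(h ∘ φ_v)²` on a small ball. -/
theorem enorm_sq_le_localSq (hα : -1 < α) {h : Cn n → ℂ} (hd : DifferentiableOn ℂ h (unitBall n))
    {v : Cn n} (hv : ‖v‖ ≤ 1 / 4) :
    nuAlpha n α (ball 0 (1 / 4)) * ‖h v‖ₑ ^ 2 ≤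
      ENNReal.ofReal ((16 / 9) ^ (n + 1 + α)) * localSq n α h := by
  have hv1 : ‖v‖ < 1 := by linarith
  have := isFiniteMeasure_nuAlpha (n := n) hα
  have hψ : DifferentiableOn ℂ (fun w => h (phi v w) ^ 2) (unitBall n) :=
    (hd.comp (differentiableOn_phi hv1) (mapsTo_phi hv1)).pow 2
  have hint : IntegrableOn (fun w => h (phi v w) ^ 2) (ball 0 (1 / 4)) (nuAlpha n α) := by
    refine (ContinuousOn.integrableOn_compact (isCompact_closedBall 0 (1 / 4)) ?_).mono_set
      ball_subset_closedBall
    exact hψ.continuousOn.mono (closedBall_subset_ball (by norm_num))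
  have h1 := integral_ball_nuAlpha hα (by norm_num) hψ hint
  have h2 := enorm_integral_le_lintegral_enorm (μ := (nuAlpha n α).restrict (ball 0 (1 / 4)))
    (fun w => h (phi v w) ^ 2)
  rw [h1, enorm_smul, phi_zero hv1, enorm_pow, Real.enorm_of_nonneg measureReal_nonneg,
    ofReal_measureReal] at h2
  refine h2.trans ?_
  simp only [enorm_pow]
  rw [setLIntegral_phi_comp hα hv1 measurableSet_ball (fun w => ‖h w‖ₑ ^ 2), localSq,
    ← lintegral_indicator (measurableSet_lt (by fun_prop) measurable_const),
    ← lintegral_const_mul' _ _ ENNReal.ofReal_ne_top]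
  refine lintegral_mono_ae ?_
  filter_upwards [ae_mem_unitBall] with w hw
  by_cases hm : phi v w ∈ ball (0 : Cn n) (1 / 4)
  · have hm' : w ∈ {w : Cn n | ‖w‖ ^ 2 < 1 / 2} :=
      norm_sq_lt_half_of_norm_phi_lt hv hw (mem_ball_zero_iff.1 hm)
    rw [Set.indicator_of_mem hm, Set.indicator_of_mem hm', mul_comm, Pi.one_apply, one_mul]
    exact mul_le_mul_left (ENNReal.ofReal_le_ofReal (bweight_le hα hv hw.le)) _
  · rw [Set.indicator_of_notMem hm, zero_mul, zero_mul]
    exact zero_le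

/-- The constant of the sub-mean value estimate. -/
def subMeanConst (n : ℕ) (α : ℝ) : ℝ :=
  (16 / 9) ^ (n + 1 + α) / (nuAlpha n α).real (ball 0 (1 / 4))

theorem norm_le_localSq (hα : -1 < α) {h : Cn n → ℂ} (hd : DifferentiableOn ℂ h (unitBall n))
    (hfin : localSq n α h ≠ ∞) {v : Cn n} (hv : ‖v‖ ≤ 1 / 4) :
    ‖h v‖ ≤ Real.sqrt (subMeanConst n α * (localSq n α h).toReal) := by
  have := isFiniteMeasure_nuAlpha (n := n) hα
  refine Real.le_sqrt_of_sq_le ?_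
  have h1 := enorm_sq_le_localSq hα hd hv
  have hpos : 0 < (nuAlpha n α).real (ball 0 (1 / 4)) :=
    ENNReal.toReal_pos (nuAlpha_ball_pos hα (by norm_num) (by norm_num)).ne' (measure_ne_top _ _)
  have h2 := ENNReal.toReal_mono (ENNReal.mul_ne_top ENNReal.ofReal_ne_top hfin) h1
  rw [ENNReal.toReal_mul, ENNReal.toReal_mul, ENNReal.toReal_pow, toReal_enorm,
    ENNReal.toReal_ofReal (by positivity)] at h2
  rw [subMeanConst, div_mul_eq_mul_div, le_div_iff₀ hpos, mul_comm]
  exact h2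

/-- Near the centre, `f ḡ` varies by a small multiple of the bounds for `f` and `g`
(Schwarz lemma). -/
theorem norm_mul_conj_sub_le {f g : Cn n → ℂ} (hf : DifferentiableOn ℂ f (unitBall n))
    (hg : DifferentiableOn ℂ g (unitBall n)) {A B : ℝ} (hA : ∀ v, ‖v‖ ≤ 1 / 4 → ‖f v‖ ≤ A)
    (hB : ∀ v, ‖v‖ ≤ 1 / 4 → ‖g v‖ ≤ B) {v : Cn n} (hv : ‖v‖ < 1 / 4) :
    ‖f v * starRingEnd ℂ (g v) - f 0 * starRingEnd ℂ (g 0)‖ ≤ 16 * ‖v‖ * (A * B) := by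
  have key {f : Cn n → ℂ} (hf : DifferentiableOn ℂ f (unitBall n)) {A : ℝ}
      (hA : ∀ v, ‖v‖ ≤ 1 / 4 → ‖f v‖ ≤ A) : ‖f v - f 0‖ ≤ 8 * A * ‖v‖ := by
    have := Complex.dist_le_div_mul_dist_of_mapsTo_ball (R₁ := 1 / 4) (R₂ := 2 * A) (z := v)
      (c := 0) (hf.mono (ball_subset_ball (by norm_num))) (fun w hw => ?_) (by simpa using hv)
    · rw [dist_zero_right, dist_eq_norm] at this
      linarith
    · rw [mem_closedBall, dist_eq_norm]
      have h1 := hA w (by simpa using (mem_ball_zero_iff.1 hw).le)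
      have h2 := hA 0 (by simp)
      linarith [norm_sub_le (f w) (f 0)]
  have e : f v * starRingEnd ℂ (g v) - f 0 * starRingEnd ℂ (g 0) =
      (f v - f 0) * starRingEnd ℂ (g v) + f 0 * starRingEnd ℂ (g v - g 0) := by
    rw [map_sub]; ring
  rw [e]
  refine (norm_add_le _ _).trans ?_
  rw [norm_mul, norm_mul, RCLike.norm_conj, RCLike.norm_conj]
  have h1 := key hf hA
  have h2 := key hg hB
  have h3 := hB v hv.le
  have h4 := hA 0 (by simp)
  have hA0 : 0 ≤ A := (norm_nonneg _).trans h4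
  have hB0 : 0 ≤ B := (norm_nonneg _).trans h3
  have e1 : ‖f v - f 0‖ * ‖g v‖ ≤ (8 * A * ‖v‖) * B := by gcongr
  have e2 : ‖f 0‖ * ‖g v - g 0‖ ≤ A * (8 * B * ‖v‖) := by gcongr
  linarith

/-! ### The Bergman space as a Hilbert space -/

/-- A holomorphic representative of an element of the Bergman space. -/
def holRep {E : Type*} [NormedAddCommGroup E] [NormedSpace ℂ E] (f : bergman E n α) : Cn n → E :=
  f.2.choose

theorem differentiableOn_holRep {E : Type*} [NormedAddCommGroup E] [NormedSpace ℂ E]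
    (f : bergman E n α) : DifferentiableOn ℂ (holRep f) (unitBall n) :=
  f.2.choose_spec.1

theorem coeFn_ae_eq_holRep {E : Type*} [NormedAddCommGroup E] [NormedSpace ℂ E]
    (f : bergman E n α) : (f : Lp E 2 (nuAlpha n α)) =ᵐ[nuAlpha n α] holRep f :=
  f.2.choose_spec.2

theorem hasFDerivAt_conj_kernel {z w : Cn n} (hz : ‖z‖ < 1) (hw : ‖w‖ < 1) :
    HasFDerivAt (fun z : Cn n => ((1 - inner ℂ w z) ^ ((n + 1 + α : ℝ) : ℂ))⁻¹)
      ((((n + 1 + α : ℝ) : ℂ) * (1 - inner ℂ w z) ^ (-((n + 1 + α : ℝ) : ℂ) - 1)) • innerSL ℂ w)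
      z := by
  have h1 : HasFDerivAt (fun z : Cn n => 1 - inner ℂ w z) (-(innerSL ℂ w)) z :=
    ((innerSL ℂ w).hasFDerivAt).const_sub 1
  have h0 : HasDerivAt (fun x : ℂ => x ^ (-((n + 1 + α : ℝ) : ℂ))) _ (1 - inner ℂ w z) :=
    (hasDerivAt_id _).cpow_const (one_sub_inner_mem_slitPlane hw hz.le)
  have h2 := h0.comp_hasFDerivAt z h1
  simp only [Complex.cpow_neg, Function.comp_def] at h2
  refine h2.congr_fderiv ?_
  rw [smul_neg, ← neg_smul]
  congr 1
  simp only [id]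
  ring

/-- The Bergman projection integral of an integrable function is holomorphic. -/
theorem differentiableOn_integral_conj_kernel {E : Type*} [NormedAddCommGroup E]
    [NormedSpace ℂ E] (hα : -1 < α) {ψ : Cn n → E}
    (hψ : Integrable ψ (nuAlpha n α)) :
    DifferentiableOn ℂ (fun z => ∫ w, starRingEnd ℂ (kernel n α z w) • ψ w ∂(nuAlpha n α))
      (unitBall n) := by
  have hN := exponent_pos n hα
  have e (z : Cn n) (hz : ‖z‖ < 1) :
      ∫ w, starRingEnd ℂ (kernel n α z w) • ψ w ∂(nuAlpha n α) =
        ∫ w, ((1 - inner ℂ w z) ^ ((n + 1 + α : ℝ) : ℂ))⁻¹ • ψ w ∂(nuAlpha n α) := by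
    refine integral_congr_ae ?_
    filter_upwards [ae_mem_unitBall] with w hw
    rw [kernel, map_div₀, map_one, one_div, conj_one_sub_inner_cpow hz hw.le]
  intro z₀ hz₀
  rw [mem_ball_zero_iff] at hz₀
  obtain ⟨ρ, hρ, hρ1⟩ := exists_between hz₀
  have hρ0 : 0 < 1 - ρ := by linarith
  refine DifferentiableAt.differentiableWithinAt ?_
  have hnhds : ball (0 : Cn n) ρ ∈ 𝓝 z₀ := isOpen_ball.mem_nhds (by simpa using hρ)
  have hev : (fun z => ∫ w, starRingEnd ℂ (kernel n α z w) • ψ w ∂(nuAlpha n α)) =ᶠ[𝓝 z₀]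
      fun z => ∫ w, ((1 - inner ℂ w z) ^ ((n + 1 + α : ℝ) : ℂ))⁻¹ • ψ w ∂(nuAlpha n α) := by
    filter_upwards [hnhds] with z hz
    rw [mem_ball_zero_iff] at hz
    exact e z (by linarith)
  refine DifferentiableAt.congr_of_eventuallyEq ?_ hev
  have hcont (z : Cn n) (hz : ‖z‖ < 1) (s : ℂ) :
      ContinuousOn (fun w : Cn n => (1 - inner ℂ w z) ^ s) (unitBall n) := by
    refine ContinuousOn.cpow (by fun_prop) continuousOn_const fun w hw => ?_
    exact one_sub_inner_mem_slitPlane (by simpa using hw) hz.le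
  have hlow (z w : Cn n) (hz : ‖z‖ < ρ) (hw : ‖w‖ < 1) : 1 - ρ ≤ ‖1 - inner ℂ w z‖ := by
    have := one_sub_norm_le (z := z) hw.le
    have h3 : ‖1 - inner ℂ w z‖ = ‖1 - inner ℂ z w‖ := by
      rw [← conj_one_sub_inner z w, RCLike.norm_conj]
    linarith
  have hmeas (z : Cn n) (hz : ‖z‖ < 1) : AEStronglyMeasurable
      (fun w => ((1 - inner ℂ w z) ^ ((n + 1 + α : ℝ) : ℂ))⁻¹ • ψ w) (nuAlpha n α) := by
    refine AEStronglyMeasurable.smul (aestronglyMeasurable_of_continuousOn ?_) hψ.1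
    refine (hcont z hz _).inv₀ fun w hw => ?_
    rw [Complex.cpow_ne_zero_iff]
    exact Or.inl (one_sub_inner_ne_zero (by simpa using hw) hz.le)
  have hsm : AEStronglyMeasurable (fun w : Cn n => innerSL ℂ w) (nuAlpha n α) :=
    (innerSL ℂ).continuous.aestronglyMeasurable
  refine (hasFDerivAt_integral_of_dominated_of_fderiv_le (𝕜 := ℂ) (s := ball 0 ρ)
    (bound := fun w => ((n + 1 + α) * (1 - ρ) ^ (-(n + 1 + α) - 1)) * ‖ψ w‖)
    (F' := fun z w => ((((n + 1 + α : ℝ) : ℂ) *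
      (1 - inner ℂ w z) ^ (-((n + 1 + α : ℝ) : ℂ) - 1)) • innerSL ℂ w).smulRight (ψ w))
    hnhds ?_ ?_ ?_ ?_ (hψ.norm.const_mul _) ?_).differentiableAt
  · filter_upwards [hnhds] with z hz
    rw [mem_ball_zero_iff] at hz
    exact hmeas z (by linarith)
  · refine hψ.bdd_smul ((1 - ρ) ^ (n + 1 + α))⁻¹ ?_ ?_
    · refine aestronglyMeasurable_of_continuousOn ((hcont z₀ hz₀ _).inv₀ fun w hw => ?_)
      rw [Complex.cpow_ne_zero_iff]
      exact Or.inl (one_sub_inner_ne_zero (by simpa using hw) hz₀.le)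
    · filter_upwards [ae_mem_unitBall] with w hw
      rw [norm_inv, Complex.norm_cpow_real]
      have := hlow z₀ w hρ hw
      gcongr
  · have h5 : AEStronglyMeasurable (fun w : Cn n => ((n + 1 + α : ℝ) : ℂ) *
        (1 - inner ℂ w z₀) ^ (-((n + 1 + α : ℝ) : ℂ) - 1)) (nuAlpha n α) :=
      (aestronglyMeasurable_of_continuousOn (hcont z₀ hz₀ _)).const_mul _
    exact (ContinuousLinearMap.smulRightL ℂ (Cn n) E).aestronglyMeasurable_comp₂ (h5.smul hsm) hψ.1
  · filter_upwards [ae_mem_unitBall] with w hw z hz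
    rw [mem_ball_zero_iff] at hz
    have h1 := hlow z w hz hw
    have e2 : -((n + 1 + α : ℝ) : ℂ) - 1 = ((-(n + 1 + α) - 1 : ℝ) : ℂ) := by push_cast; ring
    rw [ContinuousLinearMap.norm_smulRight_apply, norm_smul, norm_mul, e2,
      Complex.norm_cpow_real, Complex.norm_real, Real.norm_of_nonneg hN.le, innerSL_apply_norm]
    refine mul_le_mul_of_nonneg_right ?_ (norm_nonneg _)
    have h4 : ‖1 - inner ℂ w z‖ ^ (-(n + 1 + α) - 1) ≤ (1 - ρ) ^ (-(n + 1 + α) - 1) :=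
      Real.rpow_le_rpow_of_nonpos hρ0 h1 (by linarith)
    calc (n + 1 + α) * ‖1 - inner ℂ w z‖ ^ (-(n + 1 + α) - 1) * ‖w‖
        ≤ (n + 1 + α) * (1 - ρ) ^ (-(n + 1 + α) - 1) * 1 := by gcongr
      _ = _ := mul_one _
  · filter_upwards [ae_mem_unitBall] with w hw z hz
    rw [mem_ball_zero_iff] at hz
    have := (hasFDerivAt_conj_kernel (α := α) (z := z) (by linarith) hw).smul_const (ψ w)
    exact this

theorem memLp_kernel (hα : -1 < α) {a : Cn n} (ha : ‖a‖ < 1) :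
    MemLp (kernel n α a) 2 (nuAlpha n α) := by
  have := isFiniteMeasure_nuAlpha (n := n) hα
  exact MemLp.of_bound
    (aestronglyMeasurable_of_continuousOn (differentiableOn_kernel ha).continuousOn) _
    (ae_mem_unitBall.mono fun w hw => norm_kernel_le hα ha hw.le)

theorem inner_toLp_kernel (hα : -1 < α) {a : Cn n} (ha : ‖a‖ < 1) (G : Lp ℂ 2 (nuAlpha n α)) :
    inner ℂ ((memLp_kernel hα ha).toLp _) G =
      ∫ w, starRingEnd ℂ (kernel n α a w) * G w ∂(nuAlpha n α) := by
  rw [L2.inner_def]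
  refine integral_congr_ae ?_
  filter_upwards [(memLp_kernel hα ha).coeFn_toLp] with w hw
  rw [hw, RCLike.inner_apply, mul_comm]

theorem integrable_coeFn_Lp {E : Type*} [NormedAddCommGroup E] (hα : -1 < α)
    (G : Lp E 2 (nuAlpha n α)) : Integrable G (nuAlpha n α) := by
  have := isFiniteMeasure_nuAlpha (n := n) hα
  exact (Lp.memLp G).integrable (by norm_num)

theorem inner_toLp_kernel_bergman (hα : -1 < α) {a : Cn n} (ha : ‖a‖ < 1) (f : bergman ℂ n α) :
    inner ℂ ((memLp_kernel hα ha).toLp _) (f : Lp ℂ 2 (nuAlpha n α)) =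
      (nuAlpha n α).real Set.univ * holRep f a := by
  rw [inner_toLp_kernel hα ha, ← integral_conj_kernel_mul hα ha (differentiableOn_holRep f)
    ((integrable_congr (coeFn_ae_eq_holRep f)).1 (integrable_coeFn_Lp hα _))]
  refine integral_congr_ae ?_
  filter_upwards [coeFn_ae_eq_holRep f] with w hw
  rw [hw]

theorem nuAlpha_univ_pos (hα : -1 < α) : 0 < (nuAlpha n α).real Set.univ := by
  have := isFiniteMeasure_nuAlpha (n := n) hα
  exact ENNReal.toReal_pos ((nuAlpha_ball_pos hα one_pos le_rfl).trans_le
    (measure_mono (Set.subset_univ _))).ne' (measure_ne_top _ _)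

/-- A limit of holomorphic functions in `L²` is a multiple of its own projection integral. -/
theorem isClosed_bergman (hα : -1 < α) : IsClosed (bergman ℂ n α : Set (Lp ℂ 2 (nuAlpha n α))) := by
  refine isClosed_of_closure_subset fun G hG => ?_
  obtain ⟨u, hu, hlim⟩ := mem_closure_iff_seq_limit.1 hG
  have hc := nuAlpha_univ_pos (n := n) hα
  obtain ⟨φ, hφ, hae⟩ := (tendstoInMeasure_of_tendsto_Lp hlim).exists_seq_tendsto_ae
  refine ⟨fun z => ((nuAlpha n α).real Set.univ : ℂ)⁻¹ *
    ∫ w, starRingEnd ℂ (kernel n α z w) * G w ∂(nuAlpha n α), ?_, ?_⟩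
  · exact (differentiableOn_integral_conj_kernel hα (integrable_coeFn_Lp hα G)).const_mul _
  have hall : ∀ᵐ z ∂(nuAlpha n α), ∀ k, u k z = holRep (⟨u k, hu k⟩ : bergman ℂ n α) z :=
    ae_all_iff.2 fun k => coeFn_ae_eq_holRep (⟨u k, hu k⟩ : bergman ℂ n α)
  filter_upwards [hae, hall, ae_mem_unitBall] with z hz1 hz2 hz
  refine tendsto_nhds_unique hz1 ?_
  have h1 : Tendsto (fun k => inner ℂ ((memLp_kernel hα hz).toLp _) (u (φ k))) atTop
      (𝓝 (inner ℂ ((memLp_kernel hα hz).toLp _) G)) :=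
    tendsto_const_nhds.inner (hlim.comp hφ.tendsto_atTop)
  rw [inner_toLp_kernel hα hz] at h1
  refine (h1.const_mul ((nuAlpha n α).real Set.univ : ℂ)⁻¹).congr fun k => ?_
  rw [inner_toLp_kernel_bergman hα hz ⟨u (φ k), hu (φ k)⟩, hz2, ← mul_assoc, inv_mul_cancel₀,
    one_mul]
  exact_mod_cast hc.ne'

theorem completeSpace_bergman (hα : -1 < α) : CompleteSpace (bergman ℂ n α) :=
  (isClosed_bergman hα).completeSpace_coe

/-! ### Operators defined by sesquilinear forms -/

/-- The Cauchy–Schwarz inequality with a weight `s`. -/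
theorem lintegral_mul_mul_le {X : Type*} [MeasurableSpace X] {μ : Measure X} {s A B : X → ℝ≥0∞}
    (hs : AEMeasurable s μ) (hA : AEMeasurable A μ) (hB : AEMeasurable B μ) :
    ∫⁻ x, s x * (A x * B x) ∂μ ≤
      (∫⁻ x, s x * A x ^ 2 ∂μ) ^ (1 / 2 : ℝ) * (∫⁻ x, s x * B x ^ 2 ∂μ) ^ (1 / 2 : ℝ) := by
  have h := ENNReal.lintegral_mul_le_Lp_mul_Lq μ Real.HolderConjugate.two_two
    ((hs.pow_const (1 / 2 : ℝ)).mul hA) ((hs.pow_const (1 / 2 : ℝ)).mul hB)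
  have e (x : X) : s x ^ (1 / 2 : ℝ) * s x ^ (1 / 2 : ℝ) = s x := by
    rw [← ENNReal.rpow_add_of_nonneg _ _ (by norm_num) (by norm_num)]
    norm_num
  have e2 (x : X) (y : ℝ≥0∞) : (s x ^ (1 / 2 : ℝ) * y) ^ (2 : ℝ) = s x * y ^ 2 := by
    rw [ENNReal.rpow_two, mul_pow, sq (s x ^ (1 / 2 : ℝ)), e]
  simp only [Pi.mul_apply, e2] at h
  refine le_trans (le_of_eq (lintegral_congr fun x => ?_)) h
  rw [mul_mul_mul_comm, e]

/-- `|σ| dν_α` is a Carleson measure for the Bergman space, with constant `K`. -/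
def CarlesonBound (n : ℕ) (α : ℝ) (σ : Cn n → ℂ) (K : ℝ) : Prop :=
  ∀ f : bergman ℂ n α, ∫⁻ w, ‖σ w‖ₑ * ‖(f : Lp ℂ 2 (nuAlpha n α)) w‖ₑ ^ 2 ∂(nuAlpha n α) ≤
    ENNReal.ofReal K * ‖f‖ₑ ^ 2

theorem lintegral_enorm_sq (f : bergman ℂ n α) :
    ∫⁻ w, ‖(f : Lp ℂ 2 (nuAlpha n α)) w‖ₑ ^ 2 ∂(nuAlpha n α) = ‖f‖ₑ ^ 2 := by
  have h : ‖f‖ₑ = eLpNorm (f : Lp ℂ 2 (nuAlpha n α)) 2 (nuAlpha n α) := by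
    rw [← Lp.enorm_def]; rfl
  rw [h, eLpNorm_eq_lintegral_rpow_enorm_toReal (by norm_num) (by norm_num), ← ENNReal.rpow_two,
    ← ENNReal.rpow_mul]
  simp

theorem CarlesonBound.lintegral_le {σ : Cn n → ℂ} (hσ : AEStronglyMeasurable σ (nuAlpha n α))
    {K : ℝ} (hK : CarlesonBound n α σ K) (f g : bergman ℂ n α) :
    ∫⁻ w, ‖starRingEnd ℂ ((g : Lp ℂ 2 (nuAlpha n α)) w) *
      (σ w * (f : Lp ℂ 2 (nuAlpha n α)) w)‖ₑ ∂(nuAlpha n α) ≤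
      ENNReal.ofReal K * (‖f‖ₑ * ‖g‖ₑ) := by
  have hm (f : bergman ℂ n α) : AEMeasurable (fun w => ‖(f : Lp ℂ 2 (nuAlpha n α)) w‖ₑ)
    (nuAlpha n α) := (Lp.aestronglyMeasurable _).enorm
  have h := lintegral_mul_mul_le hσ.enorm (hm f) (hm g)
  have e : ∫⁻ w, ‖starRingEnd ℂ ((g : Lp ℂ 2 (nuAlpha n α)) w) *
      (σ w * (f : Lp ℂ 2 (nuAlpha n α)) w)‖ₑ ∂(nuAlpha n α) =
      ∫⁻ w, ‖σ w‖ₑ * (‖(f : Lp ℂ 2 (nuAlpha n α)) w‖ₑ * ‖(g : Lp ℂ 2 (nuAlpha n α)) w‖ₑ)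
        ∂(nuAlpha n α) := by
    refine lintegral_congr fun w => ?_
    rw [enorm_mul, enorm_mul, RCLike.enorm_conj]
    ring
  rw [e]
  refine h.trans ?_
  calc _ ≤ (ENNReal.ofReal K * ‖f‖ₑ ^ 2) ^ (1 / 2 : ℝ) *
        (ENNReal.ofReal K * ‖g‖ₑ ^ 2) ^ (1 / 2 : ℝ) := by
        gcongr
        exacts [hK f, hK g]
    _ = (ENNReal.ofReal K ^ 2) ^ (1 / 2 : ℝ) * ((‖f‖ₑ ^ 2) ^ (1 / 2 : ℝ) *
        (‖g‖ₑ ^ 2) ^ (1 / 2 : ℝ)) := by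
        simp only [sq, ENNReal.mul_rpow_of_nonneg _ _ (by norm_num : (0 : ℝ) ≤ 1 / 2)]
        ring
    _ = _ := by
        simp only [← ENNReal.rpow_two, ← ENNReal.rpow_mul]
        norm_num

theorem CarlesonBound.integrable {σ : Cn n → ℂ} (hσ : AEStronglyMeasurable σ (nuAlpha n α)) {K : ℝ}
    (hK : CarlesonBound n α σ K) (f g : bergman ℂ n α) :
    Integrable (fun w => starRingEnd ℂ ((g : Lp ℂ 2 (nuAlpha n α)) w) *
      (σ w * (f : Lp ℂ 2 (nuAlpha n α)) w)) (nuAlpha n α) := by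
  refine ⟨(Complex.continuous_conj.comp_aestronglyMeasurable (Lp.aestronglyMeasurable _)).mul
    (hσ.mul (Lp.aestronglyMeasurable _)), ?_⟩
  rw [hasFiniteIntegral_iff_enorm]
  refine (hK.lintegral_le hσ f g).trans_lt (ENNReal.mul_lt_top ENNReal.ofReal_lt_top
    (ENNReal.mul_lt_top enorm_lt_top enorm_lt_top))

theorem CarlesonBound.norm_integral_le {σ : Cn n → ℂ} (hσ : AEStronglyMeasurable σ (nuAlpha n α))
    {K : ℝ} (hK0 : 0 ≤ K) (hK : CarlesonBound n α σ K) (f g : bergman ℂ n α) :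
    ‖∫ w, starRingEnd ℂ ((g : Lp ℂ 2 (nuAlpha n α)) w) *
      (σ w * (f : Lp ℂ 2 (nuAlpha n α)) w) ∂(nuAlpha n α)‖ ≤ K * ‖f‖ * ‖g‖ := by
  have h := (enorm_integral_le_lintegral_enorm _).trans (hK.lintegral_le hσ f g)
  have h2 := ENNReal.toReal_mono (by finiteness) h
  rwa [toReal_enorm, ENNReal.toReal_mul, ENNReal.toReal_mul, toReal_enorm, toReal_enorm,
    ENNReal.toReal_ofReal hK0, ← mul_assoc] at h2

/-- The operator `T` represents the Toeplitz form of `σ`: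
`⟪g, T f⟫ = ∫ conj (g w) σ(w) f(w) dν_α(w)`. -/
def IsFormOp (σ : Cn n → ℂ) (T : bergman ℂ n α →L[ℂ] bergman ℂ n α) : Prop :=
  ∀ f g : bergman ℂ n α, inner ℂ g (T f) = ∫ w, starRingEnd ℂ ((g : Lp ℂ 2 (nuAlpha n α)) w) *
      (σ w * (f : Lp ℂ 2 (nuAlpha n α)) w) ∂(nuAlpha n α)

theorem opNorm_le_of_inner {H : Type*} [NormedAddCommGroup H] [InnerProductSpace ℂ H]
    {T : H →L[ℂ] H} {K : ℝ} (hK : 0 ≤ K) (h : ∀ f g, ‖inner ℂ g (T f)‖ ≤ K * ‖f‖ * ‖g‖) :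
    ‖T‖ ≤ K := by
  refine T.opNorm_le_bound hK fun f => ?_
  have h1 := h f (T f)
  rw [inner_self_eq_norm_sq_to_K, norm_pow, RCLike.norm_ofReal, abs_norm, sq] at h1
  rcases (norm_nonneg (T f)).eq_or_lt with h0 | h0
  · rw [← h0]; positivity
  · exact le_of_mul_le_mul_right h1 h0

/-- A bounded Toeplitz form is represented by an operator (Riesz). -/
theorem exists_isFormOp (hα : -1 < α) {σ : Cn n → ℂ} (hσ : AEStronglyMeasurable σ (nuAlpha n α))
    {K : ℝ} (hK0 : 0 ≤ K) (hK : CarlesonBound n α σ K) :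
    ∃ T : bergman ℂ n α →L[ℂ] bergman ℂ n α, IsFormOp σ T := by
  have := completeSpace_bergman (n := n) hα
  have hi := fun f g => hK.integrable hσ f g
  let B : bergman ℂ n α →ₗ⋆[ℂ] bergman ℂ n α →ₗ[ℂ] ℂ :=
    LinearMap.mk₂'ₛₗ (starRingEnd ℂ) (RingHom.id ℂ)
      (fun g f => ∫ w, starRingEnd ℂ ((g : Lp ℂ 2 (nuAlpha n α)) w) *
        (σ w * (f : Lp ℂ 2 (nuAlpha n α)) w) ∂(nuAlpha n α))
      (fun g₁ g₂ f => by
        rw [← integral_add (hi f g₁) (hi f g₂)]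
        refine integral_congr_ae ?_
        filter_upwards [Lp.coeFn_add (g₁ : Lp ℂ 2 (nuAlpha n α)) g₂] with w hw
        rw [Submodule.coe_add, hw, Pi.add_apply, map_add, add_mul])
      (fun c g f => by
        rw [smul_eq_mul, ← integral_const_mul]
        refine integral_congr_ae ?_
        filter_upwards [Lp.coeFn_smul c (g : Lp ℂ 2 (nuAlpha n α))] with w hw
        rw [Submodule.coe_smul, hw, Pi.smul_apply, smul_eq_mul, map_mul, mul_assoc])
      (fun g f₁ f₂ => by
        rw [← integral_add (hi f₁ g) (hi f₂ g)]
        refine integral_congr_ae ?_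
        filter_upwards [Lp.coeFn_add (f₁ : Lp ℂ 2 (nuAlpha n α)) f₂] with w hw
        rw [Submodule.coe_add, hw, Pi.add_apply]
        ring)
      (fun c g f => by
        rw [smul_eq_mul, ← integral_const_mul]
        refine integral_congr_ae ?_
        filter_upwards [Lp.coeFn_smul c (f : Lp ℂ 2 (nuAlpha n α))] with w hw
        rw [Submodule.coe_smul, hw, Pi.smul_apply, smul_eq_mul]
        simp only [RingHom.id_apply]
        ring)
  let B' : bergman ℂ n α →L⋆[ℂ] bergman ℂ n α →L[ℂ] ℂ := B.mkContinuous₂ K fun g f => by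
    have := hK.norm_integral_le hσ hK0 f g
    rw [mul_right_comm] at this
    exact this
  refine ⟨ContinuousLinearMap.adjoint (InnerProductSpace.continuousLinearMapOfBilin B'),
    fun f g => ?_⟩
  rw [ContinuousLinearMap.adjoint_inner_right, InnerProductSpace.continuousLinearMapOfBilin_apply]
  rfl

/-! ### Weighted translations and the Carleson estimate -/

theorem norm_kernel_sq_mul {u v : Cn n} (hu : ‖u‖ < 1) :
    ‖kernel n α u v‖ ^ 2 * (1 - ‖u‖ ^ 2) ^ (n + 1 + α) = bweight n α u v := by
  have hpos := one_sub_norm_sq_pos hu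
  rw [kernel, norm_div, norm_one, Complex.norm_cpow_real, bweight, div_pow, one_pow,
    Real.div_rpow hpos.le (by positivity), ← Real.rpow_mul_natCast (norm_nonneg _),
    ← Real.rpow_natCast_mul (norm_nonneg _), mul_comm (n + 1 + α)]
  push_cast
  ring

theorem bweight_phi_mul {u w : Cn n} (hu : ‖u‖ < 1) (hw : ‖w‖ < 1) :
    bweight n α u (phi u w) * bweight n α u w = 1 := by
  have hpos := one_sub_norm_sq_pos hu
  have hd := norm_pos_iff.2 (one_sub_inner_ne_zero hu hw.le)
  have h := one_sub_inner_phi_phi hu (v := 0) (w := w) (by simp) hw.le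
  rw [phi_zero hu] at h
  have h2 : ‖1 - inner ℂ u (phi u w)‖ = (1 - ‖u‖ ^ 2) / ‖1 - inner ℂ u w‖ := by
    have e : (1 - ((‖u‖ ^ 2 : ℝ) : ℂ)) = ((1 - ‖u‖ ^ 2 : ℝ) : ℂ) := by push_cast; ring
    rw [h, inner_zero_left, inner_zero_left, sub_zero, mul_one, mul_one, norm_div, e,
      Complex.norm_real, Real.norm_of_nonneg hpos.le]
  rw [bweight, bweight, ← Real.mul_rpow (by positivity) (by positivity), h2]
  convert Real.one_rpow _
  field_simp

/-- The squared pseudohyperbolic distance `|φ_u(w)|²`, by its formula symmetric in `u` and `w`. -/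
def rhoSq (u w : Cn n) : ℝ := 1 - (1 - ‖u‖ ^ 2) * (1 - ‖w‖ ^ 2) / ‖1 - inner ℂ u w‖ ^ 2

theorem rhoSq_eq {u w : Cn n} (hu : ‖u‖ < 1) (hw : ‖w‖ ≤ 1) : rhoSq u w = ‖phi u w‖ ^ 2 := by
  rw [rhoSq, ← one_sub_norm_phi_sq hu hw]; ring

theorem rhoSq_comm (u w : Cn n) : rhoSq u w = rhoSq w u := by
  rw [rhoSq, rhoSq, mul_comm (1 - ‖u‖ ^ 2), ← conj_one_sub_inner, RCLike.norm_conj]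

theorem measurable_rhoSq : Measurable fun p : Cn n × Cn n => rhoSq p.1 p.2 := by
  unfold rhoSq; fun_prop

theorem bweight_eq {u w : Cn n} (hw : ‖w‖ < 1) :
    bweight n α u w = ((1 - rhoSq u w) / (1 - ‖w‖ ^ 2)) ^ (n + 1 + α) := by
  have hpos := one_sub_norm_sq_pos hw
  rw [bweight, rhoSq]
  congr 1
  field_simp
  ring

/-- The weighted translate `f_u(v) = f(φ_u(v)) / (1 - ⟨v, u⟩)^{n+1+α}`. -/
def translate (n : ℕ) (α : ℝ) (f : Cn n → ℂ) (u v : Cn n) : ℂ :=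
  kernel n α u v * f (phi u v)

theorem differentiableOn_translate {f : Cn n → ℂ} (hf : DifferentiableOn ℂ f (unitBall n))
    {u : Cn n} (hu : ‖u‖ < 1) : DifferentiableOn ℂ (translate n α f u) (unitBall n) :=
  (differentiableOn_kernel hu).mul (hf.comp (differentiableOn_phi hu) (mapsTo_phi hu))

theorem translate_zero (f : Cn n → ℂ) {u : Cn n} (hu : ‖u‖ < 1) :
    translate n α f u 0 = f u := by
  simp [translate, phi_zero hu, kernel]

theorem measurableSet_norm_sq_lt_half : MeasurableSet {w : Cn n | ‖w‖ ^ 2 < 1 / 2} :=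
  measurableSet_lt (by fun_prop) measurable_const

/-- The local norm of a weighted translate is a weighted integral over the pseudohyperbolic ball
about `u`. -/
theorem localSq_translate (hα : -1 < α) (f : Cn n → ℂ) {u : Cn n} (hu : ‖u‖ < 1) :
    localSq n α (translate n α f u) =
      ∫⁻ w, {p : Cn n × Cn n | rhoSq p.1 p.2 < 1 / 2}.indicator 1 (u, w) *
        ENNReal.ofReal (((1 - ‖u‖ ^ 2) ^ (n + 1 + α))⁻¹) * ‖f w‖ₑ ^ 2 ∂(nuAlpha n α) := by
  have hpos := one_sub_norm_sq_pos hu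
  have h := setLIntegral_phi_comp hα hu measurableSet_norm_sq_lt_half
    (fun w => ‖kernel n α u (phi u w)‖ₑ ^ 2 * ‖f w‖ₑ ^ 2)
  have e : localSq n α (translate n α f u) = ∫⁻ w in {w : Cn n | ‖w‖ ^ 2 < 1 / 2},
      ‖kernel n α u (phi u (phi u w))‖ₑ ^ 2 * ‖f (phi u w)‖ₑ ^ 2 ∂(nuAlpha n α) := by
    refine lintegral_congr_ae ?_
    filter_upwards [ae_restrict_of_ae ae_mem_unitBall] with w hw
    rw [phi_phi hu hw, translate, enorm_mul, mul_pow]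
  rw [e, h]
  refine lintegral_congr_ae ?_
  filter_upwards [ae_mem_unitBall] with w hw
  have e1 : ‖kernel n α u (phi u w)‖ₑ ^ 2 * ENNReal.ofReal (bweight n α u w) =
      ENNReal.ofReal (((1 - ‖u‖ ^ 2) ^ (n + 1 + α))⁻¹) := by
    rw [← ofReal_norm, ← ENNReal.ofReal_pow (norm_nonneg _),
      ← ENNReal.ofReal_mul (by positivity)]
    congr 1
    have h1 := norm_kernel_sq_mul (α := α) (v := phi u w) hu
    have h2 := bweight_phi_mul (α := α) hu hw
    have h3 : (1 - ‖u‖ ^ 2) ^ (n + 1 + α) ≠ 0 := (Real.rpow_pos_of_pos hpos _).ne'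
    rw [← h1] at h2
    field_simp
    linarith
  have e2 : ({w : Cn n | ‖w‖ ^ 2 < 1 / 2}.indicator 1 (phi u w) : ℝ≥0∞) =
      {p : Cn n × Cn n | rhoSq p.1 p.2 < 1 / 2}.indicator 1 (u, w) := by
    simp only [Set.indicator, Set.mem_ofPred_eq, rhoSq_eq hu hw.le, Pi.one_apply]
  rw [← e1, ← e2]
  ring

/-- On a pseudohyperbolic ball about `u` the weight `(1 - |u|²)^{-N}` is at most a
constant times the Berezin weight `q(w, u)`. -/
theorem indicator_rhoSq_mul_le (hα : -1 < α) {u w : Cn n} (hu : ‖u‖ < 1) :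
    {p : Cn n × Cn n | rhoSq p.1 p.2 < 1 / 2}.indicator 1 (u, w) *
        ENNReal.ofReal (((1 - ‖u‖ ^ 2) ^ (n + 1 + α))⁻¹) ≤
      ENNReal.ofReal (2 ^ (n + 1 + α)) * ENNReal.ofReal (bweight n α w u) := by
  by_cases h : rhoSq u w < 1 / 2
  · have h' : (u, w) ∈ {p : Cn n × Cn n | rhoSq p.1 p.2 < 1 / 2} := h
    rw [Set.indicator_of_mem h', Pi.one_apply, one_mul, ← ENNReal.ofReal_mul (by positivity)]
    refine ENNReal.ofReal_le_ofReal ?_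
    have hpos := one_sub_norm_sq_pos hu
    rw [rhoSq_comm] at h
    rw [bweight_eq hu, ← Real.inv_rpow hpos.le, ← Real.mul_rpow (by norm_num)
      (div_nonneg (by linarith) hpos.le)]
    refine Real.rpow_le_rpow (by positivity) ?_ (exponent_pos n hα).le
    rw [← mul_div_assoc, inv_eq_one_div]
    gcongr
    linarith
  · have h' : (u, w) ∉ {p : Cn n × Cn n | rhoSq p.1 p.2 < 1 / 2} := h
    rw [Set.indicator_of_notMem h', zero_mul]
    exact zero_le

theorem measurable_bweight : Measurable fun p : Cn n × Cn n => bweight n α p.1 p.2 := by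
  unfold bweight; fun_prop

theorem measurable_ofReal_bweight_swap :
    Measurable fun p : Cn n × Cn n => ENNReal.ofReal (bweight n α p.2 p.1) := by
  unfold bweight; fun_prop

/-- Tonelli: bounded averages of `|τ|` against the Berezin kernels control the averages of the local
norms of all weighted translates. -/
theorem lintegral_enorm_mul_localSq_le (hα : -1 < α) {τ : Cn n → ℂ}
    (hτ : AEStronglyMeasurable τ (nuAlpha n α)) {M : ℝ≥0∞}
    (hM : ∀ z : Cn n, ‖z‖ < 1 →
      ∫⁻ u, ‖τ u‖ₑ * ENNReal.ofReal (bweight n α z u) ∂(nuAlpha n α) ≤ M)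
    {f : Cn n → ℂ} (hf : AEStronglyMeasurable f (nuAlpha n α)) :
    ∫⁻ u, ‖τ u‖ₑ * localSq n α (translate n α f u) ∂(nuAlpha n α) ≤
      ENNReal.ofReal (2 ^ (n + 1 + α)) * M * ∫⁻ w, ‖f w‖ₑ ^ 2 ∂(nuAlpha n α) := by
  have := isFiniteMeasure_nuAlpha (n := n) hα
  calc ∫⁻ u, ‖τ u‖ₑ * localSq n α (translate n α f u) ∂(nuAlpha n α)
      ≤ ∫⁻ u, ∫⁻ w, ‖τ u‖ₑ * (ENNReal.ofReal (2 ^ (n + 1 + α)) *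
          ENNReal.ofReal (bweight n α w u) * ‖f w‖ₑ ^ 2) ∂(nuAlpha n α) ∂(nuAlpha n α) := by
        refine lintegral_mono_ae ?_
        filter_upwards [ae_mem_unitBall] with u hu
        rw [localSq_translate hα f hu]
        refine (lintegral_const_mul_le _ _).trans (lintegral_mono fun w => ?_)
        exact mul_le_mul_right (mul_le_mul_left (indicator_rhoSq_mul_le hα hu) _) _
    _ = ∫⁻ w, ∫⁻ u, ‖τ u‖ₑ * (ENNReal.ofReal (2 ^ (n + 1 + α)) *
          ENNReal.ofReal (bweight n α w u) * ‖f w‖ₑ ^ 2) ∂(nuAlpha n α) ∂(nuAlpha n α) := by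
        have h1 : AEStronglyMeasurable (fun p : Cn n × Cn n => τ p.1)
          ((nuAlpha n α).prod (nuAlpha n α)) := hτ.comp_fst
        have h2 : AEStronglyMeasurable (fun p : Cn n × Cn n => f p.2)
          ((nuAlpha n α).prod (nuAlpha n α)) := hf.comp_snd
        have h3 : Measurable (fun p : Cn n × Cn n => ENNReal.ofReal (bweight n α p.2 p.1)) :=
          measurable_ofReal_bweight_swap
        have h4 : AEMeasurable (fun p : Cn n × Cn n => ‖τ p.1‖ₑ *
            (ENNReal.ofReal (2 ^ (n + 1 + α)) * ENNReal.ofReal (bweight n α p.2 p.1) *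
              ‖f p.2‖ₑ ^ 2))
            ((nuAlpha n α).prod (nuAlpha n α)) :=
          AEMeasurable.mul h1.enorm (AEMeasurable.mul (AEMeasurable.const_mul h3.aemeasurable _)
            (AEMeasurable.pow_const h2.enorm 2))
        exact lintegral_lintegral_swap h4
    _ ≤ ∫⁻ w, ENNReal.ofReal (2 ^ (n + 1 + α)) * M * ‖f w‖ₑ ^ 2 ∂(nuAlpha n α) := by
        refine lintegral_mono_ae ?_
        filter_upwards [ae_mem_unitBall] with w hw
        have e (u : Cn n) : ‖τ u‖ₑ * (ENNReal.ofReal (2 ^ (n + 1 + α)) *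
          ENNReal.ofReal (bweight n α w u) * ‖f w‖ₑ ^ 2) = (ENNReal.ofReal (2 ^ (n + 1 + α)) *
          ‖f w‖ₑ ^ 2) * (‖τ u‖ₑ * ENNReal.ofReal (bweight n α w u)) := by ring
        simp only [e]
        rw [lintegral_const_mul' _ _ (by finiteness), mul_right_comm]
        gcongr
        exact hM w hw
    _ = _ := by
        rw [lintegral_const_mul'' _ (hf.enorm.pow_const 2)]

theorem aestronglyMeasurable_holRep (f : bergman ℂ n α) :
    AEStronglyMeasurable (holRep f) (nuAlpha n α) :=
  aestronglyMeasurable_of_continuousOn (differentiableOn_holRep f).continuousOn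

theorem lintegral_enorm_holRep_sq (f : bergman ℂ n α) :
    ∫⁻ w, ‖holRep f w‖ₑ ^ 2 ∂(nuAlpha n α) = ‖f‖ₑ ^ 2 := by
  rw [← lintegral_enorm_sq]
  refine lintegral_congr_ae ?_
  filter_upwards [coeFn_ae_eq_holRep f] with w hw
  rw [hw]

/-- A symbol with bounded averages of its modulus satisfies a Carleson estimate, by the sub-mean
value estimate at the centre of each weighted translate. -/
theorem carlesonBound_of_averages (hα : -1 < α) {τ : Cn n → ℂ}
    (hτ : AEStronglyMeasurable τ (nuAlpha n α)) {M : ℝ≥0∞} (hMt : M ≠ ∞)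
    (hM : ∀ z : Cn n, ‖z‖ < 1 →
      ∫⁻ u, ‖τ u‖ₑ * ENNReal.ofReal (bweight n α z u) ∂(nuAlpha n α) ≤ M) :
    ∃ K, 0 ≤ K ∧ CarlesonBound n α τ K := by
  have := isFiniteMeasure_nuAlpha (n := n) hα
  set m := nuAlpha n α (ball 0 (1 / 4))
  have hm : m ≠ 0 := (nuAlpha_ball_pos hα (by norm_num) (by norm_num)).ne'
  have hm' : m ≠ ∞ := measure_ne_top _ _
  set K : ℝ≥0∞ := m⁻¹ * ENNReal.ofReal ((16 / 9) ^ (n + 1 + α)) *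
    (ENNReal.ofReal (2 ^ (n + 1 + α)) * M) with hKdef
  have hK : K ≠ ∞ := by
    have : m⁻¹ ≠ ∞ := ENNReal.inv_ne_top.2 hm
    finiteness
  refine ⟨K.toReal, ENNReal.toReal_nonneg, fun f => ?_⟩
  rw [ENNReal.ofReal_toReal hK]
  calc ∫⁻ w, ‖τ w‖ₑ * ‖(f : Lp ℂ 2 (nuAlpha n α)) w‖ₑ ^ 2 ∂(nuAlpha n α)
      ≤ ∫⁻ w, (m⁻¹ * ENNReal.ofReal ((16 / 9) ^ (n + 1 + α))) *
          (‖τ w‖ₑ * localSq n α (translate n α (holRep f) w)) ∂(nuAlpha n α) := by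
        refine lintegral_mono_ae ?_
        filter_upwards [ae_mem_unitBall, coeFn_ae_eq_holRep f] with w hw hfw
        rw [hfw, mul_left_comm]
        gcongr
        have := enorm_sq_le_localSq hα (differentiableOn_translate (α := α)
          (differentiableOn_holRep f) hw) (v := 0) (by simp)
        rw [translate_zero _ hw] at this
        rw [mul_assoc, ← ENNReal.div_eq_inv_mul, ENNReal.le_div_iff_mul_le (Or.inl hm) (Or.inl hm'),
          mul_comm]
        exact this
    _ ≤ (m⁻¹ * ENNReal.ofReal ((16 / 9) ^ (n + 1 + α))) * (ENNReal.ofReal (2 ^ (n + 1 + α)) * M *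
          ‖f‖ₑ ^ 2) := by
        have : m⁻¹ ≠ ∞ := ENNReal.inv_ne_top.2 hm
        rw [lintegral_const_mul' _ _ (by finiteness), ← lintegral_enorm_holRep_sq]
        gcongr
        exact lintegral_enorm_mul_localSq_le hα hτ hM (aestronglyMeasurable_holRep f)
    _ = _ := by rw [hKdef]; ring

/-! ### Radial averages of the symbol -/

/-- The Möbius invariant average `∫ γ(|φ_z(u)|²) |k_z(u)|² τ(u) dν_α(u)`, which equals
`∫ γ(|w|²) τ(φ_z(w)) dν_α(w)`. For `γ = 1` it is the Berezin transform. -/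
def average (n : ℕ) (α : ℝ) (γ : ℝ → ℝ) (τ : Cn n → ℂ) (z : Cn n) : ℂ :=
  ∫ u, ((γ (rhoSq z u) * bweight n α z u : ℝ) : ℂ) * τ u ∂(nuAlpha n α)

theorem measurable_average_kernel {γ : ℝ → ℝ} (hγ : Measurable γ) :
    Measurable fun p : Cn n × Cn n => ((γ (rhoSq p.1 p.2) * bweight n α p.1 p.2 : ℝ) : ℂ) :=
  Complex.measurable_ofReal.comp ((hγ.comp measurable_rhoSq).mul measurable_bweight)

theorem aestronglyMeasurable_average_integrand (hα : -1 < α) {γ : ℝ → ℝ} (hγ : Measurable γ)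
    {τ : Cn n → ℂ} (hτ : AEStronglyMeasurable τ (nuAlpha n α)) :
    AEStronglyMeasurable (fun p : Cn n × Cn n =>
      ((γ (rhoSq p.1 p.2) * bweight n α p.1 p.2 : ℝ) : ℂ) * τ p.2)
      ((nuAlpha n α).prod (nuAlpha n α)) := by
  have := isFiniteMeasure_nuAlpha (n := n) hα
  have h1 : AEStronglyMeasurable (fun p : Cn n × Cn n => τ p.2)
    ((nuAlpha n α).prod (nuAlpha n α)) := hτ.comp_snd
  exact (measurable_average_kernel hγ).aestronglyMeasurable.mul h1

theorem aestronglyMeasurable_average (hα : -1 < α) {γ : ℝ → ℝ} (hγ : Measurable γ)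
    {τ : Cn n → ℂ} (hτ : AEStronglyMeasurable τ (nuAlpha n α)) :
    AEStronglyMeasurable (average n α γ τ) (nuAlpha n α) := by
  have := isFiniteMeasure_nuAlpha (n := n) hα
  exact (aestronglyMeasurable_average_integrand hα hγ hτ).integral_prod_right'

theorem lintegral_average_integrand_le {γ : ℝ → ℝ} {τ : Cn n → ℂ} {B : ℝ}
    (hB : ∀ t, |γ t| ≤ B) {M : ℝ≥0∞} {z : Cn n} (hz : ‖z‖ < 1)
    (hM : ∫⁻ u, ‖τ u‖ₑ * ENNReal.ofReal (bweight n α z u) ∂(nuAlpha n α) ≤ M) :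
    ∫⁻ u, ‖((γ (rhoSq z u) * bweight n α z u : ℝ) : ℂ) * τ u‖ₑ ∂(nuAlpha n α) ≤
      ENNReal.ofReal B * M := by
  refine le_trans ?_ (mul_le_mul_right hM _)
  rw [← lintegral_const_mul' _ _ ENNReal.ofReal_ne_top]
  refine lintegral_mono fun u => ?_
  have hb := bweight_nonneg (n := n) (α := α) (w := u) hz.le
  rw [enorm_mul, ← ofReal_norm, Complex.norm_real, norm_mul, Real.norm_of_nonneg hb,
    ENNReal.ofReal_mul (norm_nonneg _), mul_assoc, mul_comm ‖τ u‖ₑ]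
  gcongr
  exact hB _

theorem norm_average_le {γ : ℝ → ℝ} {τ : Cn n → ℂ} {B : ℝ}
    (hB : ∀ t, |γ t| ≤ B) {M : ℝ≥0∞} (hMt : M ≠ ∞) {z : Cn n} (hz : ‖z‖ < 1)
    (hM : ∫⁻ u, ‖τ u‖ₑ * ENNReal.ofReal (bweight n α z u) ∂(nuAlpha n α) ≤ M) :
    ‖average n α γ τ z‖ ≤ B * M.toReal := by
  have h := (enorm_integral_le_lintegral_enorm _).trans (lintegral_average_integrand_le hB hz hM)
  have h2 := ENNReal.toReal_mono (by finiteness) h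
  have hB0 : 0 ≤ B := (abs_nonneg _).trans (hB 0)
  rwa [toReal_enorm, ENNReal.toReal_mul, ENNReal.toReal_ofReal hB0] at h2

/-- Pairing an average with an integrable `p` moves the averaging onto `p`. -/
theorem integral_average_mul (hα : -1 < α) {γ : ℝ → ℝ} (hγ : Measurable γ) {τ : Cn n → ℂ}
    (hτ : AEStronglyMeasurable τ (nuAlpha n α)) {B : ℝ} (hB : ∀ t, |γ t| ≤ B)
    {M : ℝ≥0∞} (hMt : M ≠ ∞) (hM : ∀ z : Cn n, ‖z‖ < 1 →
      ∫⁻ u, ‖τ u‖ₑ * ENNReal.ofReal (bweight n α z u) ∂(nuAlpha n α) ≤ M)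
    {p : Cn n → ℂ} (hp : Integrable p (nuAlpha n α)) :
    Integrable (fun u => τ u *
        ∫ z, ((γ (rhoSq z u) * bweight n α z u : ℝ) : ℂ) * p z ∂(nuAlpha n α)) (nuAlpha n α) ∧
    ∫ z, average n α γ τ z * p z ∂(nuAlpha n α) =
      ∫ u, τ u * ∫ z, ((γ (rhoSq z u) * bweight n α z u : ℝ) : ℂ) * p z ∂(nuAlpha n α)
        ∂(nuAlpha n α) := by
  have := isFiniteMeasure_nuAlpha (n := n) hα
  have h1 : AEStronglyMeasurable (fun q : Cn n × Cn n => p q.1)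
    ((nuAlpha n α).prod (nuAlpha n α)) := hp.1.comp_fst
  have hm : AEStronglyMeasurable (fun q : Cn n × Cn n =>
      ((γ (rhoSq q.1 q.2) * bweight n α q.1 q.2 : ℝ) : ℂ) * τ q.2 * p q.1)
      ((nuAlpha n α).prod (nuAlpha n α)) :=
    (aestronglyMeasurable_average_integrand hα hγ hτ).mul h1
  have hint : Integrable (fun q : Cn n × Cn n =>
      ((γ (rhoSq q.1 q.2) * bweight n α q.1 q.2 : ℝ) : ℂ) * τ q.2 * p q.1)
      ((nuAlpha n α).prod (nuAlpha n α)) := by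
    refine ⟨hm, ?_⟩
    rw [hasFiniteIntegral_iff_enorm, lintegral_prod _ hm.enorm]
    have hle : ∫⁻ z, ∫⁻ u, ‖((γ (rhoSq z u) * bweight n α z u : ℝ) : ℂ) * τ u * p z‖ₑ
        ∂(nuAlpha n α) ∂(nuAlpha n α) ≤ ∫⁻ z, ENNReal.ofReal B * M * ‖p z‖ₑ ∂(nuAlpha n α) := by
      refine lintegral_mono_ae ?_
      filter_upwards [ae_mem_unitBall] with z hz
      simp only [enorm_mul _ (p z)]
      rw [lintegral_mul_const' _ _ enorm_ne_top]
      exact mul_le_mul_left (lintegral_average_integrand_le hB hz (hM z hz)) _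
    refine hle.trans_lt ?_
    rw [lintegral_const_mul' _ _ (by finiteness)]
    have := hp.2
    rw [hasFiniteIntegral_iff_enorm] at this
    finiteness
  have e (u : Cn n) : ∫ z, ((γ (rhoSq z u) * bweight n α z u : ℝ) : ℂ) * τ u * p z
      ∂(nuAlpha n α) = τ u * ∫ z, ((γ (rhoSq z u) * bweight n α z u : ℝ) : ℂ) * p z
        ∂(nuAlpha n α) := by
    rw [← integral_const_mul]
    refine integral_congr_ae (ae_of_all _ fun z => ?_)
    ring
  constructor
  · have := hint.integral_prod_right
    simp only [e] at this
    exact this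
  · have := integral_integral_swap (f := fun z u =>
      ((γ (rhoSq z u) * bweight n α z u : ℝ) : ℂ) * τ u * p z) hint
    simp only [e] at this
    rw [← this]
    refine integral_congr_ae (ae_of_all _ fun z => ?_)
    simp only [average]
    rw [integral_mul_const]

theorem bweight_mul_bweight_phi {u v : Cn n} (hu : ‖u‖ < 1) (hv : ‖v‖ < 1) :
    bweight n α u v * bweight n α (phi u v) u =
      (1 - ‖v‖ ^ 2) ^ (n + 1 + α) * ‖kernel n α u v‖ ^ 2 := by
  have hpu := one_sub_norm_sq_pos hu
  have hpv := one_sub_norm_sq_pos hv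
  rw [bweight_eq hu, rhoSq_comm, rhoSq_eq hu (norm_phi_lt_one hu hv).le, phi_phi hu hv,
    ← norm_kernel_sq_mul hu, Real.div_rpow hpv.le hpu.le]
  have := (Real.rpow_pos_of_pos hpu (n + 1 + α)).ne'
  field_simp

/-- In the coordinates centred at `u`, the average of `f ḡ` is a radial average of the product of
the weighted translates. -/
theorem integral_average_kernel_mul (hα : -1 < α) (γ : ℝ → ℝ) (f g : Cn n → ℂ) {u : Cn n}
    (hu : ‖u‖ < 1) :
    ∫ z, ((γ (rhoSq z u) * bweight n α z u : ℝ) : ℂ) * (f z * starRingEnd ℂ (g z))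
        ∂(nuAlpha n α) =
      ∫ v, ((γ (‖v‖ ^ 2) * (1 - ‖v‖ ^ 2) ^ (n + 1 + α) : ℝ) : ℂ) *
        (translate n α f u v * starRingEnd ℂ (translate n α g u v)) ∂(nuAlpha n α) := by
  rw [integral_comp_phi hα hu]
  refine integral_congr_ae ?_
  filter_upwards [ae_mem_unitBall] with v hv
  have h1 : rhoSq (phi u v) u = ‖v‖ ^ 2 := by
    rw [rhoSq_comm, rhoSq_eq hu (norm_phi_lt_one hu hv).le, phi_phi hu hv]
  have h2 := congrArg (fun x : ℝ => (x : ℂ)) (bweight_mul_bweight_phi (α := α) hu hv)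
  have h3 : kernel n α u v * starRingEnd ℂ (kernel n α u v) = ((‖kernel n α u v‖ ^ 2 : ℝ) : ℂ) := by
    rw [Complex.mul_conj, Complex.normSq_eq_norm_sq]
  rw [h1, Complex.real_smul, translate, translate, map_mul]
  push_cast at h2 h3 ⊢
  linear_combination (γ (‖v‖ ^ 2) : ℂ) * (f (phi u v) * starRingEnd ℂ (g (phi u v))) * h2 -
    ((γ (‖v‖ ^ 2) : ℂ) * ((1 - ‖v‖ ^ 2 : ℝ) ^ (n + 1 + α) : ℝ) *
      (f (phi u v) * starRingEnd ℂ (g (phi u v)))) * h3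

/-! ### Small averages approximate the symbol -/

/-- A radial weight `γ(|v|²)`, supported in `|v| ≤ ε` and normalized so that
`∫ γ(|v|²) (1 - |v|²)^{n+1+α} dν_α(v) = 1`. -/
structure IsBump (n : ℕ) (α ε : ℝ) (γ : ℝ → ℝ) : Prop where
  continuous : Continuous γ
  nonneg : ∀ t, 0 ≤ γ t
  support : ∀ t, ε ^ 2 ≤ t → γ t = 0
  bounded : ∃ B, ∀ t, |γ t| ≤ B
  integral_eq : ∫ v : Cn n, γ (‖v‖ ^ 2) * (1 - ‖v‖ ^ 2) ^ (n + 1 + α) ∂(nuAlpha n α) = 1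

theorem continuous_bump_weight (hα : -1 < α) {γ : ℝ → ℝ} (hγ : Continuous γ) :
    Continuous fun v : Cn n => γ (‖v‖ ^ 2) * (1 - ‖v‖ ^ 2) ^ (n + 1 + α) := by
  refine (by fun_prop : Continuous fun v : Cn n => γ (‖v‖ ^ 2)).mul ?_
  exact Continuous.rpow_const (by fun_prop) fun v => Or.inr (exponent_pos n hα).le

/-- The normalized tent functions are bumps. -/
theorem exists_isBump (hα : -1 < α) {ε : ℝ} (hε : 0 < ε) (hε1 : ε ≤ 1) :
    ∃ γ, IsBump n α ε γ := by
  have := isFiniteMeasure_nuAlpha (n := n) hα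
  let γ₀ : ℝ → ℝ := fun t => max 0 (ε ^ 2 - |t|)
  have hc : Continuous γ₀ := by fun_prop
  have h0 (t : ℝ) : 0 ≤ γ₀ t := le_max_left _ _
  have hB (t : ℝ) : γ₀ t ≤ ε ^ 2 := max_le (sq_nonneg _) (by linarith [abs_nonneg t])
  set I := ∫ v : Cn n, γ₀ (‖v‖ ^ 2) * (1 - ‖v‖ ^ 2) ^ (n + 1 + α) ∂(nuAlpha n α) with hI
  have hI0 : 0 < I := by
    rw [hI, integral_pos_iff_support_of_nonneg_ae]
    · refine (nuAlpha_ball_pos hα hε hε1).trans_le (measure_mono fun v hv => ?_)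
      rw [mem_ball_zero_iff] at hv
      have h1 := one_sub_norm_sq_pos (a := v) (by linarith)
      have h2 : 0 < γ₀ (‖v‖ ^ 2) := by
        refine lt_max_of_lt_right ?_
        rw [abs_of_nonneg (sq_nonneg _)]
        nlinarith [norm_nonneg v]
      exact (mul_pos h2 (Real.rpow_pos_of_pos h1 _)).ne'
    · filter_upwards [ae_mem_unitBall] with v hv
      exact mul_nonneg (h0 _) (Real.rpow_nonneg (one_sub_norm_sq_pos hv).le _)
    · refine integrable_of_continuousOn_of_bound hα (continuous_bump_weight hα hc).continuousOn
        (C := ε ^ 2 * 1) fun v hv => ?_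
      have h1 := one_sub_norm_sq_pos hv
      rw [norm_mul, Real.norm_of_nonneg (h0 _), Real.norm_of_nonneg (by positivity)]
      have h2 : (1 - ‖v‖ ^ 2) ^ (n + 1 + α) ≤ 1 :=
        Real.rpow_le_one h1.le (by nlinarith [norm_nonneg v]) (exponent_pos n hα).le
      exact mul_le_mul (hB _) h2 (by positivity) (sq_nonneg _)
  refine ⟨fun t => I⁻¹ * γ₀ t, by fun_prop, fun t => mul_nonneg (inv_nonneg.2 hI0.le) (h0 t),
    fun t ht => ?_, ⟨I⁻¹ * ε ^ 2, fun t => ?_⟩, ?_⟩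
  · have : γ₀ t = 0 := max_eq_left (by linarith [le_abs_self t])
    rw [this, mul_zero]
  · rw [abs_of_nonneg (mul_nonneg (inv_nonneg.2 hI0.le) (h0 t))]
    gcongr
    exact hB t
  · simp only [mul_assoc]
    rw [integral_const_mul, ← hI, inv_mul_cancel₀ hI0.ne']

/-- A bump reproduces `f ḡ` at the origin up to `O(ε)`. -/
theorem IsBump.norm_sub_le (hα : -1 < α) {ε : ℝ} (hε : 0 < ε) (hε1 : ε ≤ 1 / 4) {γ : ℝ → ℝ}
    (hγ : IsBump n α ε γ) {f g : Cn n → ℂ} (hf : DifferentiableOn ℂ f (unitBall n))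
    (hg : DifferentiableOn ℂ g (unitBall n)) {A B : ℝ} (hA : ∀ v, ‖v‖ ≤ 1 / 4 → ‖f v‖ ≤ A)
    (hB : ∀ v, ‖v‖ ≤ 1 / 4 → ‖g v‖ ≤ B) :
    ‖∫ v, ((γ (‖v‖ ^ 2) * (1 - ‖v‖ ^ 2) ^ (n + 1 + α) : ℝ) : ℂ) *
      (f v * starRingEnd ℂ (g v)) ∂(nuAlpha n α) - f 0 * starRingEnd ℂ (g 0)‖ ≤
        16 * ε * (A * B) := by
  have := isFiniteMeasure_nuAlpha (n := n) hα
  have hA0 : 0 ≤ A := (norm_nonneg _).trans (hA 0 (by simp))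
  have hB0 : 0 ≤ B := (norm_nonneg _).trans (hB 0 (by simp))
  obtain ⟨G, hG⟩ := hγ.bounded
  set Γ : Cn n → ℝ := fun v => γ (‖v‖ ^ 2) * (1 - ‖v‖ ^ 2) ^ (n + 1 + α) with hΓ
  have hΓc : Continuous Γ := continuous_bump_weight hα hγ.continuous
  have hΓ0 (v : Cn n) (hv : ‖v‖ < 1) : 0 ≤ Γ v :=
    mul_nonneg (hγ.nonneg _) (Real.rpow_nonneg (one_sub_norm_sq_pos hv).le _)
  have hΓs (v : Cn n) (hv : ε ≤ ‖v‖) : Γ v = 0 := by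
    rw [hΓ]
    simp only
    rw [hγ.support _ (by gcongr), zero_mul]
  have hΓB (v : Cn n) (hv : ‖v‖ < 1) : ‖Γ v‖ ≤ G * 1 := by
    have h1 := one_sub_norm_sq_pos hv
    rw [norm_mul]
    refine mul_le_mul (hG _) ?_ (norm_nonneg _) ((abs_nonneg _).trans (hG 0))
    rw [Real.norm_of_nonneg (by positivity)]
    exact Real.rpow_le_one h1.le (by nlinarith [norm_nonneg v]) (exponent_pos n hα).le
  have hΓi : Integrable Γ (nuAlpha n α) :=
    integrable_of_continuousOn_of_bound hα hΓc.continuousOn hΓB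
  have hint : Integrable (fun v => (Γ v : ℂ) * (f v * starRingEnd ℂ (g v))) (nuAlpha n α) := by
    refine integrable_of_continuousOn_of_bound hα (C := G * 1 * (A * B)) ?_ fun v hv => ?_
    · exact (Complex.continuous_ofReal.comp hΓc).continuousOn.mul (hf.continuousOn.mul
        (Complex.continuous_conj.comp_continuousOn hg.continuousOn))
    · rcases le_or_gt ε ‖v‖ with h | h
      · rw [hΓs v h, Complex.ofReal_zero, zero_mul, norm_zero]
        have := (norm_nonneg _).trans (hΓB v hv)
        positivity
      · rw [norm_mul, norm_mul, RCLike.norm_conj, Complex.norm_real]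
        have h1 := hA v (by linarith)
        have h2 := hB v (by linarith)
        have h3 := hΓB v hv
        gcongr
        exact (norm_nonneg _).trans h3
  have hint0 : Integrable (fun v => (Γ v : ℂ) * (f 0 * starRingEnd ℂ (g 0))) (nuAlpha n α) :=
    hΓi.ofReal.mul_const _
  have e0 : ∫ v, (Γ v : ℂ) * (f 0 * starRingEnd ℂ (g 0)) ∂(nuAlpha n α) =
      f 0 * starRingEnd ℂ (g 0) := by
    rw [integral_mul_const, integral_complex_ofReal, hγ.integral_eq, Complex.ofReal_one, one_mul]
  rw [← e0, ← integral_sub hint hint0]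
  calc ‖∫ v, ((Γ v : ℂ) * (f v * starRingEnd ℂ (g v)) - (Γ v : ℂ) * (f 0 * starRingEnd ℂ (g 0)))
        ∂(nuAlpha n α)‖ ≤ ∫ v, Γ v * (16 * ε * (A * B)) ∂(nuAlpha n α) := by
        refine norm_integral_le_of_norm_le (hΓi.mul_const _) ?_
        filter_upwards [ae_mem_unitBall] with v hv
        rw [← mul_sub, norm_mul, Complex.norm_real, Real.norm_of_nonneg (hΓ0 v hv)]
        rcases le_or_gt ε ‖v‖ with h | h
        · rw [hΓs v h, zero_mul, zero_mul]
        · have := norm_mul_conj_sub_le hf hg hA hB (v := v) (by linarith)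
          have h0 := hΓ0 v hv
          gcongr
          refine this.trans ?_
          gcongr
    _ = 16 * ε * (A * B) := by
        rw [integral_mul_const, hγ.integral_eq, one_mul]

theorem localSq_translate_ne_top (hα : -1 < α) {f : Cn n → ℂ}
    (hf : ∫⁻ w, ‖f w‖ₑ ^ 2 ∂(nuAlpha n α) ≠ ∞) {u : Cn n} (hu : ‖u‖ < 1) :
    localSq n α (translate n α f u) ≠ ∞ := by
  rw [localSq_translate hα f hu]
  refine ne_top_of_le_ne_top (b := ENNReal.ofReal (((1 - ‖u‖ ^ 2) ^ (n + 1 + α))⁻¹) *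
    ∫⁻ w, ‖f w‖ₑ ^ 2 ∂(nuAlpha n α)) (by finiteness) ?_
  rw [← lintegral_const_mul' _ _ ENNReal.ofReal_ne_top]
  refine lintegral_mono fun w => ?_
  refine mul_le_mul_left (mul_le_of_le_one_left zero_le ?_) _
  exact Set.indicator_le_self _ _ _

theorem aemeasurable_localSq_translate (hα : -1 < α) {f : Cn n → ℂ}
    (hf : AEStronglyMeasurable f (nuAlpha n α)) :
    AEMeasurable (fun u => localSq n α (translate n α f u)) (nuAlpha n α) := by
  have := isFiniteMeasure_nuAlpha (n := n) hα
  have h1 : AEStronglyMeasurable (fun p : Cn n × Cn n => f p.2)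
    ((nuAlpha n α).prod (nuAlpha n α)) := hf.comp_snd
  have h2 : MeasurableSet {p : Cn n × Cn n | rhoSq p.1 p.2 < 1 / 2} :=
    measurableSet_lt measurable_rhoSq measurable_const
  have h3 : Measurable fun p : Cn n × Cn n =>
      {p : Cn n × Cn n | rhoSq p.1 p.2 < 1 / 2}.indicator (1 : Cn n × Cn n → ℝ≥0∞) p *
        ENNReal.ofReal (((1 - ‖p.1‖ ^ 2) ^ (n + 1 + α))⁻¹) :=
    (measurable_one.indicator h2).mul (by fun_prop)
  have h4 := (h3.aemeasurable.mul (h1.enorm.pow_const 2)).lintegral_prod_right'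
  refine h4.congr ?_
  filter_upwards [ae_mem_unitBall] with u hu
  rw [localSq_translate hα f hu]
  rfl

theorem subMeanConst_nonneg : 0 ≤ subMeanConst n α := by
  unfold subMeanConst; positivity

/-- The bound `C ε M` for the form of `τ - a`, where `a` is an average of `τ` over balls of
radius `ε`. -/
theorem norm_integral_average_sub_le (hα : -1 < α) {ε : ℝ} (hε : 0 < ε) (hε1 : ε ≤ 1 / 4)
    {γ : ℝ → ℝ} (hγ : IsBump n α ε γ) {τ : Cn n → ℂ}
    (hτ : AEStronglyMeasurable τ (nuAlpha n α)) {M : ℝ≥0∞} (hMt : M ≠ ∞)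
    (hM : ∀ z : Cn n, ‖z‖ < 1 →
      ∫⁻ u, ‖τ u‖ₑ * ENNReal.ofReal (bweight n α z u) ∂(nuAlpha n α) ≤ M)
    {K : ℝ} (hK : CarlesonBound n α τ K) (F G : bergman ℂ n α) :
    ‖∫ z, starRingEnd ℂ ((G : Lp ℂ 2 (nuAlpha n α)) z) *
        (average n α γ τ z * (F : Lp ℂ 2 (nuAlpha n α)) z) ∂(nuAlpha n α) -
      ∫ z, starRingEnd ℂ ((G : Lp ℂ 2 (nuAlpha n α)) z) *
        (τ z * (F : Lp ℂ 2 (nuAlpha n α)) z) ∂(nuAlpha n α)‖ ≤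
      16 * ε * subMeanConst n α * (2 ^ (n + 1 + α) * M.toReal) * ‖F‖ * ‖G‖ := by
  have hfin := isFiniteMeasure_nuAlpha (n := n) hα
  obtain ⟨B, hB⟩ := hγ.bounded
  set f := holRep F
  set g := holRep G
  have hfd := differentiableOn_holRep F
  have hgd := differentiableOn_holRep G
  have hf2 : ∫⁻ w, ‖f w‖ₑ ^ 2 ∂(nuAlpha n α) = ‖F‖ₑ ^ 2 := lintegral_enorm_holRep_sq F
  have hg2 : ∫⁻ w, ‖g w‖ₑ ^ 2 ∂(nuAlpha n α) = ‖G‖ₑ ^ 2 := lintegral_enorm_holRep_sq G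
  have hfm : MemLp f 2 (nuAlpha n α) := (memLp_congr_ae (coeFn_ae_eq_holRep F)).1 (Lp.memLp _)
  have hgm : MemLp g 2 (nuAlpha n α) := (memLp_congr_ae (coeFn_ae_eq_holRep G)).1 (Lp.memLp _)
  have hp : Integrable (fun z => f z * starRingEnd ℂ (g z)) (nuAlpha n α) :=
    hfm.integrable_mul hgm.star
  obtain ⟨hi, he⟩ := integral_average_mul hα hγ.continuous.measurable hτ hB hMt hM hp
  have e1 : ∫ z, starRingEnd ℂ ((G : Lp ℂ 2 (nuAlpha n α)) z) *
        (average n α γ τ z * (F : Lp ℂ 2 (nuAlpha n α)) z) ∂(nuAlpha n α) =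
      ∫ z, average n α γ τ z * (f z * starRingEnd ℂ (g z)) ∂(nuAlpha n α) := by
    refine integral_congr_ae ?_
    filter_upwards [coeFn_ae_eq_holRep F, coeFn_ae_eq_holRep G] with z h1 h2
    rw [h1, h2]; ring
  have hae2 : (fun z => starRingEnd ℂ ((G : Lp ℂ 2 (nuAlpha n α)) z) *
        (τ z * (F : Lp ℂ 2 (nuAlpha n α)) z)) =ᵐ[nuAlpha n α]
      fun z => τ z * (f z * starRingEnd ℂ (g z)) := by
    filter_upwards [coeFn_ae_eq_holRep F, coeFn_ae_eq_holRep G] with z h1 h2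
    rw [h1, h2]; ring
  have hi2 := (integrable_congr hae2).1 (hK.integrable hτ F G)
  rw [e1, he, integral_congr_ae hae2, ← integral_sub hi hi2]
  set S : (Cn n → ℂ) → Cn n → ℝ≥0∞ := fun f u => localSq n α (translate n α f u)
  have hpt : ∀ u : Cn n, ‖u‖ < 1 →
      ‖τ u * (∫ z, ((γ (rhoSq z u) * bweight n α z u : ℝ) : ℂ) * (f z * starRingEnd ℂ (g z))
        ∂(nuAlpha n α)) - τ u * (f u * starRingEnd ℂ (g u))‖ₑ ≤
      ENNReal.ofReal (16 * ε * subMeanConst n α) *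
        (‖τ u‖ₑ * (S f u ^ (1 / 2 : ℝ) * S g u ^ (1 / 2 : ℝ))) := by
    intro u hu
    have hSf : S f u ≠ ∞ := localSq_translate_ne_top hα (by rw [hf2]; finiteness) hu
    have hSg : S g u ≠ ∞ := localSq_translate_ne_top hα (by rw [hg2]; finiteness) hu
    have key := hγ.norm_sub_le hα hε hε1 (differentiableOn_translate (α := α) hfd hu)
      (differentiableOn_translate (α := α) hgd hu)
      (fun v hv => norm_le_localSq hα (differentiableOn_translate (α := α) hfd hu) hSf hv)
      (fun v hv => norm_le_localSq hα (differentiableOn_translate (α := α) hgd hu) hSg hv)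
    rw [← integral_average_kernel_mul hα γ _ _ hu, translate_zero _ hu, translate_zero _ hu] at key
    rw [← mul_sub, enorm_mul, mul_left_comm]
    gcongr
    rw [← ofReal_norm]
    refine (ENNReal.ofReal_le_ofReal key).trans (le_of_eq ?_)
    rw [← ENNReal.ofReal_toReal hSf, ← ENNReal.ofReal_toReal hSg,
      ENNReal.ofReal_rpow_of_nonneg ENNReal.toReal_nonneg (by norm_num),
      ENNReal.ofReal_rpow_of_nonneg ENNReal.toReal_nonneg (by norm_num),
      ← ENNReal.ofReal_mul (by positivity),
      ← ENNReal.ofReal_mul (mul_nonneg (by positivity) subMeanConst_nonneg),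
      Real.sqrt_mul subMeanConst_nonneg, Real.sqrt_mul subMeanConst_nonneg,
      ← Real.sqrt_eq_rpow, ← Real.sqrt_eq_rpow]
    congr 1
    linear_combination 16 * ε * (√(S f u).toReal * √(S g u).toReal) *
      Real.mul_self_sqrt (subMeanConst_nonneg (n := n) (α := α))
  have hSm (f : Cn n → ℂ) (hf : AEStronglyMeasurable f (nuAlpha n α)) :
      AEMeasurable (fun u => S f u ^ (1 / 2 : ℝ)) (nuAlpha n α) :=
    (aemeasurable_localSq_translate hα hf).pow_const _
  have hsq (f : Cn n → ℂ) (u : Cn n) : (S f u ^ (1 / 2 : ℝ)) ^ 2 = S f u := by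
    rw [← ENNReal.rpow_two, ← ENNReal.rpow_mul]; norm_num
  have hbound : ‖∫ u, (τ u * (∫ z, ((γ (rhoSq z u) * bweight n α z u : ℝ) : ℂ) *
        (f z * starRingEnd ℂ (g z)) ∂(nuAlpha n α)) - τ u * (f u * starRingEnd ℂ (g u)))
          ∂(nuAlpha n α)‖ₑ ≤
      ENNReal.ofReal (16 * ε * subMeanConst n α) *
        (ENNReal.ofReal (2 ^ (n + 1 + α)) * M * (‖F‖ₑ * ‖G‖ₑ)) := by
    refine (enorm_integral_le_lintegral_enorm _).trans ?_
    refine (lintegral_mono_ae (ae_mem_unitBall.mono hpt)).trans ?_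
    rw [lintegral_const_mul' _ _ ENNReal.ofReal_ne_top]
    gcongr
    refine (lintegral_mul_mul_le hτ.enorm (hSm f hfm.1) (hSm g hgm.1)).trans ?_
    simp only [hsq]
    have h1 := lintegral_enorm_mul_localSq_le hα hτ hM hfm.1
    have h2 := lintegral_enorm_mul_localSq_le hα hτ hM hgm.1
    rw [hf2] at h1
    rw [hg2] at h2
    set C := ENNReal.ofReal (2 ^ (n + 1 + α)) * M
    calc _ ≤ (C * ‖F‖ₑ ^ 2) ^ (1 / 2 : ℝ) * (C * ‖G‖ₑ ^ 2) ^ (1 / 2 : ℝ) := by gcongr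
      _ = (C ^ 2) ^ (1 / 2 : ℝ) * ((‖F‖ₑ ^ 2) ^ (1 / 2 : ℝ) * (‖G‖ₑ ^ 2) ^ (1 / 2 : ℝ)) := by
          simp only [sq, ENNReal.mul_rpow_of_nonneg _ _ (by norm_num : (0 : ℝ) ≤ 1 / 2)]
          ring
      _ = C * (‖F‖ₑ * ‖G‖ₑ) := by
          simp only [← ENNReal.rpow_two, ← ENNReal.rpow_mul]
          norm_num
  have h2 := ENNReal.toReal_mono (by finiteness) hbound
  rw [toReal_enorm, ENNReal.toReal_mul, ENNReal.toReal_mul, ENNReal.toReal_mul, ENNReal.toReal_mul,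
    toReal_enorm, toReal_enorm, ENNReal.toReal_ofReal (mul_nonneg (by positivity)
      subMeanConst_nonneg), ENNReal.toReal_ofReal (by positivity)] at h2
  refine h2.trans (le_of_eq ?_)
  ring

/-! ### Compactness of Toeplitz operators with symbols vanishing at the boundary -/

theorem carlesonBound_of_bound {σ : Cn n → ℂ} {B : ℝ} (hB : ∀ z, ‖z‖ < 1 → ‖σ z‖ ≤ B) :
    CarlesonBound n α σ B := by
  intro f
  rw [← lintegral_enorm_sq, ← lintegral_const_mul' _ _ ENNReal.ofReal_ne_top]
  refine lintegral_mono_ae ?_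
  filter_upwards [ae_mem_unitBall] with w hw
  gcongr
  rw [← ofReal_norm]
  exact ENNReal.ofReal_le_ofReal (hB w hw)

/-- The reproducing kernel `K_a` as an element of the Bergman space (zero for `a` outside the
ball). -/
def kernelElt (hα : -1 < α) (a : Cn n) : bergman ℂ n α :=
  if ha : ‖a‖ < 1 then
    ⟨(memLp_kernel hα ha).toLp _, kernel n α a, differentiableOn_kernel ha,
      (memLp_kernel hα ha).coeFn_toLp⟩
  else 0

theorem inner_kernelElt (hα : -1 < α) {a : Cn n} (ha : ‖a‖ < 1) (f : bergman ℂ n α) :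
    inner ℂ (kernelElt hα a) f = (nuAlpha n α).real Set.univ * holRep f a := by
  rw [← inner_toLp_kernel_bergman hα ha, Submodule.coe_inner, kernelElt, dif_pos ha]

theorem inner_kernelElt_kernelElt (hα : -1 < α) {a b : Cn n} (ha : ‖a‖ < 1) (hb : ‖b‖ < 1) :
    inner ℂ (kernelElt hα a) (kernelElt hα b) =
      (nuAlpha n α).real Set.univ * kernel n α b a := by
  have := isFiniteMeasure_nuAlpha (n := n) hα
  rw [Submodule.coe_inner, kernelElt, dif_pos ha, kernelElt, dif_pos hb, inner_toLp_kernel hα ha,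
    ← integral_conj_kernel_mul hα ha (differentiableOn_kernel hb)
      ((memLp_kernel hα hb).integrable (by norm_num))]
  refine integral_congr_ae ?_
  filter_upwards [(memLp_kernel hα hb).coeFn_toLp] with w hw
  rw [hw]

theorem continuousAt_kernel {a b : Cn n} (ha : ‖a‖ < 1) (hb : ‖b‖ < 1) :
    ContinuousAt (fun p : Cn n × Cn n => kernel n α p.1 p.2) (a, b) := by
  unfold kernel
  simp only [one_div]
  refine ContinuousAt.inv₀ (ContinuousAt.cpow (by fun_prop) continuousAt_const
    (one_sub_inner_mem_slitPlane ha hb.le)) ?_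
  rw [Complex.cpow_ne_zero_iff]
  exact Or.inl (one_sub_inner_ne_zero ha hb.le)

theorem sqrt_norm_inner_sub {H : Type*} [NormedAddCommGroup H] [InnerProductSpace ℂ H] (x y : H) :
    Real.sqrt ‖inner ℂ x x - inner ℂ x y - (inner ℂ y x - inner ℂ y y)‖ = ‖x - y‖ := by
  rw [← inner_sub_right, ← inner_sub_right, ← inner_sub_left, inner_self_eq_norm_sq_to_K, norm_pow,
    RCLike.norm_ofReal, abs_norm, Real.sqrt_sq (norm_nonneg _)]

/-- The kernels depend continuously on the point: `‖K_b - K_a‖²` expands into values of the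
kernel. -/
theorem continuousAt_kernelElt (hα : -1 < α) {a : Cn n} (ha : ‖a‖ < 1) :
    ContinuousAt (kernelElt hα : Cn n → bergman ℂ n α) a := by
  set c : ℂ := Complex.ofReal ((nuAlpha n α).real Set.univ)
  rw [ContinuousAt, tendsto_iff_norm_sub_tendsto_zero]
  have hev : ∀ᶠ b in 𝓝 a, ‖b‖ < 1 :=
    (isOpen_lt continuous_norm continuous_const).mem_nhds ha
  have e : ∀ᶠ b in 𝓝 a, Real.sqrt ‖c * kernel n α b b - c * kernel n α a b -
      (c * kernel n α b a - c * kernel n α a a)‖ =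
      ‖kernelElt hα b - kernelElt hα a‖ := by
    filter_upwards [hev] with b hb
    rw [← inner_kernelElt_kernelElt hα hb hb, ← inner_kernelElt_kernelElt hα hb ha,
      ← inner_kernelElt_kernelElt hα ha hb, ← inner_kernelElt_kernelElt hα ha ha]
    exact sqrt_norm_inner_sub _ _
  refine Tendsto.congr' e ?_
  have hk := continuousAt_kernel (α := α) ha ha
  have h1 : ContinuousAt (fun b => kernel n α b b) a :=
    ContinuousAt.comp (g := fun p : Cn n × Cn n => kernel n α p.1 p.2) (f := fun b => (b, b)) hk
      (by fun_prop)
  have h2 : ContinuousAt (fun b => kernel n α a b) a :=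
    ContinuousAt.comp (g := fun p : Cn n × Cn n => kernel n α p.1 p.2) (f := fun b => (a, b)) hk
      (by fun_prop)
  have h3 : ContinuousAt (fun b => kernel n α b a) a :=
    ContinuousAt.comp (g := fun p : Cn n × Cn n => kernel n α p.1 p.2) (f := fun b => (b, a)) hk
      (by fun_prop)
  have h4 := (((h1.tendsto.const_mul c).sub (h2.tendsto.const_mul c)).sub
    ((h3.tendsto.const_mul c).sub_const (c * kernel n α a a))).norm.sqrt
  simpa using h4

theorem isCompactOperator_rankOne {H : Type*} [NormedAddCommGroup H] [InnerProductSpace ℂ H]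
    (x y : H) : IsCompactOperator (InnerProductSpace.rankOne ℂ x y) := by
  rw [InnerProductSpace.rankOne_def']
  have h : IsCompactOperator (innerSL ℂ y : H →L[ℂ] ℂ) :=
    isCompactOperator_of_locallyCompactSpace_dom _
  exact h.clm_comp (ContinuousLinearMap.toSpanSingleton ℂ x)

theorem isCompactOperator_integral {X H : Type*} [MeasurableSpace X] {μ : Measure X}
    [IsFiniteMeasure μ] [NormedAddCommGroup H] [NormedSpace ℂ H] [CompleteSpace H]
    {Φ : X → H →L[ℂ] H} (hi : Integrable Φ μ) (hc : ∀ x, IsCompactOperator (Φ x)) :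
    IsCompactOperator (∫ x, Φ x ∂μ : H →L[ℂ] H) := by
  rcases eq_or_ne μ 0 with rfl | h0
  · rw [integral_zero_measure]
    exact isCompactOperator_zero
  have : NeZero μ := ⟨h0⟩
  have hconv : Convex ℝ {f : H →L[ℂ] H | IsCompactOperator f} := by
    intro f hf g hg a b _ _ _
    exact (hf.smul a).add (hg.smul b)
  have h := hconv.average_mem isClosed_setOfPred_isCompactOperator (ae_of_all _ hc) hi
  rw [← measure_smul_average]
  exact IsCompactOperator.smul h _

/-- The integral over a compact set of the rank one operators `σ(z) ⟪k_z, ·⟫ k_z` is compact. -/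
theorem exists_isCompactOperator_integral_rankOne {X H : Type*} [MeasurableSpace X]
    [TopologicalSpace X] [OpensMeasurableSpace X] [TopologicalSpace.PseudoMetrizableSpace X]
    {μ : Measure X} [IsFiniteMeasure μ] [NormedAddCommGroup H] [InnerProductSpace ℂ H]
    [CompleteSpace H] {k : X → H} {s : Set X} (hs : IsCompact s) (hsm : MeasurableSet s)
    (hk : ContinuousOn k s) {σ : X → ℂ} (hσ : AEStronglyMeasurable σ μ) {B : ℝ}
    (hB : ∀ᵐ z ∂μ, ‖σ z‖ ≤ B) :
    ∃ T : H →L[ℂ] H, IsCompactOperator T ∧ ∀ f g : H,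
      inner ℂ g (T f) = ∫ z in s, σ z * (inner ℂ (k z) f * inner ℂ g (k z)) ∂μ := by
  let R : X → H →L[ℂ] H := fun z => InnerProductSpace.rankOne ℂ (k z) (k z)
  have hRc : ContinuousOn R s := by
    have h1 : ContinuousOn (fun z => innerSL ℂ (k z)) s :=
      (innerSL ℂ).continuous.comp_continuousOn hk
    exact ((ContinuousLinearMap.smulRightL ℂ H H).continuous.comp_continuousOn h1).clm_apply hk
  have hRi : Integrable R (μ.restrict s) := ContinuousOn.integrableOn_compact' hs hsm hRc
  have hi : Integrable (fun z => σ z • R z) (μ.restrict s) :=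
    hRi.bdd_smul B hσ.restrict (ae_restrict_of_ae hB)
  refine ⟨∫ z in s, σ z • R z ∂μ,
    isCompactOperator_integral hi fun z => (isCompactOperator_rankOne _ _).smul _, fun f g => ?_⟩
  let L : (H →L[ℂ] H) →L[ℂ] ℂ := (innerSL ℂ g).comp (ContinuousLinearMap.apply ℂ H f)
  have hL : inner ℂ g ((∫ z in s, σ z • R z ∂μ) f) = ∫ z in s, L (σ z • R z) ∂μ := by
    rw [L.integral_comp_comm hi]
    rfl
  rw [hL]
  refine integral_congr_ae (ae_of_all _ fun z => ?_)
  simp [L, R]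

/-- A bounded symbol cut off to `|z| ≤ r < 1` has a compact operator. By the reproducing formula
`⟪K_z, f⟫ = c f(z)` it is `c^{-2}` times the integral of the rank one operators of the kernels. -/
theorem exists_compact_isFormOp_indicator (hα : -1 < α) {σ : Cn n → ℂ}
    (hσ : AEStronglyMeasurable σ (nuAlpha n α)) {B : ℝ} (hB : ∀ z, ‖z‖ < 1 → ‖σ z‖ ≤ B)
    {r : ℝ} (hr : r < 1) :
    ∃ T : bergman ℂ n α →L[ℂ] bergman ℂ n α,
      IsFormOp ((closedBall 0 r).indicator σ) T ∧ IsCompactOperator T := by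
  have := isFiniteMeasure_nuAlpha (n := n) hα
  have := completeSpace_bergman (n := n) hα
  set c : ℝ := (nuAlpha n α).real Set.univ with hcdef
  have hc : (c : ℂ) ≠ 0 := by exact_mod_cast (nuAlpha_univ_pos (n := n) hα).ne'
  obtain ⟨T, hT, hTi⟩ := exists_isCompactOperator_integral_rankOne (μ := nuAlpha n α)
    (k := (kernelElt hα : Cn n → bergman ℂ n α)) (isCompact_closedBall (0 : Cn n) r)
    measurableSet_closedBall (fun z hz => (continuousAt_kernelElt hα
      ((mem_closedBall_zero_iff.1 hz).trans_lt hr)).continuousWithinAt) hσ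
    (ae_mem_unitBall.mono hB)
  refine ⟨((c : ℂ) ^ 2)⁻¹ • T, fun f g => ?_, hT.smul ((c : ℂ) ^ 2)⁻¹⟩
  rw [smul_apply, inner_smul_right, hTi, ← integral_const_mul,
    ← integral_indicator measurableSet_closedBall]
  refine integral_congr_ae ?_
  filter_upwards [ae_mem_unitBall, coeFn_ae_eq_holRep f, coeFn_ae_eq_holRep g] with z hz hf hg
  by_cases hzr : z ∈ closedBall (0 : Cn n) r
  · rw [Set.indicator_of_mem hzr, Set.indicator_of_mem hzr, hf, hg, ← inner_conj_symm g,
      inner_kernelElt hα hz f, inner_kernelElt hα hz g, map_mul, Complex.conj_ofReal, ← hcdef]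
    field_simp
  · rw [Set.indicator_of_notMem hzr, Set.indicator_of_notMem hzr, zero_mul, mul_zero]

theorem IsFormOp.norm_sub_le {σ σ' : Cn n → ℂ} {T T' : bergman ℂ n α →L[ℂ] bergman ℂ n α}
    (h : IsFormOp σ T) (h' : IsFormOp σ' T') {K : ℝ} (hK : 0 ≤ K)
    (hle : ∀ f g : bergman ℂ n α, ‖∫ w, starRingEnd ℂ ((g : Lp ℂ 2 (nuAlpha n α)) w) *
      (σ w * (f : Lp ℂ 2 (nuAlpha n α)) w) ∂(nuAlpha n α) -
      ∫ w, starRingEnd ℂ ((g : Lp ℂ 2 (nuAlpha n α)) w) *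
      (σ' w * (f : Lp ℂ 2 (nuAlpha n α)) w) ∂(nuAlpha n α)‖ ≤ K * ‖f‖ * ‖g‖) :
    ‖T - T'‖ ≤ K := by
  refine opNorm_le_of_inner hK fun f g => ?_
  rw [sub_apply, inner_sub_right, h f g, h' f g]
  exact hle f g

theorem isCompactOperator_of_forall_approx {H : Type*} [NormedAddCommGroup H] [NormedSpace ℂ H]
    [CompleteSpace H] {T : H →L[ℂ] H}
    (h : ∀ η > 0, ∃ T' : H →L[ℂ] H, IsCompactOperator T' ∧ ‖T - T'‖ ≤ η) :
    IsCompactOperator T := by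
  have hcl := isClosed_setOfPred_isCompactOperator (σ₁₂ := RingHom.id ℂ) (M₁ := H) (M₂ := H)
  refine hcl.closure_subset (Metric.mem_closure_iff.2 fun ε hε => ?_)
  obtain ⟨T', hT', hle⟩ := h (ε / 2) (by positivity)
  refine ⟨T', hT', ?_⟩
  rw [dist_eq_norm]
  linarith

/-- A bounded symbol vanishing at the boundary has a compact Toeplitz operator: cut it off to
`|z| < r`, where the operator is an integral of rank one operators. -/
theorem isCompactOperator_of_vanishing (hα : -1 < α) {σ : Cn n → ℂ}
    (hσ : AEStronglyMeasurable σ (nuAlpha n α)) {B : ℝ} (hB : ∀ z, ‖z‖ < 1 → ‖σ z‖ ≤ B)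
    (hv : ∀ η > 0, ∃ r < 1, ∀ z, r ≤ ‖z‖ → ‖z‖ < 1 → ‖σ z‖ ≤ η)
    {T : bergman ℂ n α →L[ℂ] bergman ℂ n α} (hT : IsFormOp σ T) : IsCompactOperator T := by
  have := completeSpace_bergman (n := n) hα
  refine isCompactOperator_of_forall_approx fun η hη => ?_
  obtain ⟨r, hr, hη'⟩ := hv η hη
  obtain ⟨T', hT', hc⟩ := exists_compact_isFormOp_indicator hα hσ hB hr
  refine ⟨T', hc, hT.norm_sub_le hT' hη.le fun f g => ?_⟩
  have hσ' : AEStronglyMeasurable ((closedBall 0 r).indicator σ) (nuAlpha n α) :=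
    hσ.indicator measurableSet_closedBall
  have hB0 (z : Cn n) (hz : ‖z‖ < 1) : ‖(closedBall 0 r).indicator σ z‖ ≤ B :=
    (norm_indicator_le_norm_self _ _).trans (hB z hz)
  rw [← integral_sub ((carlesonBound_of_bound hB).integrable hσ f g)
    ((carlesonBound_of_bound hB0).integrable hσ' f g)]
  have hd : CarlesonBound n α (σ - (closedBall 0 r).indicator σ) η := by
    refine carlesonBound_of_bound fun z hz => ?_
    rw [Pi.sub_apply]
    by_cases hzr : z ∈ closedBall (0 : Cn n) r
    · rw [Set.indicator_of_mem hzr, sub_self, norm_zero]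
      exact hη.le
    · rw [Set.indicator_of_notMem hzr, sub_zero]
      exact hη' z (by simpa using (not_le.1 fun h => hzr (by simpa using h)).le) hz
  refine le_trans (le_of_eq ?_) (hd.norm_integral_le (hσ.sub hσ') hη.le f g)
  congr 1
  refine integral_congr_ae (ae_of_all _ fun z => ?_)
  simp only [Pi.sub_apply]
  ring

/-! ### Radial averages vanish at the boundary -/

/-- The coefficients of a power series whose sums for small positive parameters lie in a closed
subspace lie in that subspace. -/
theorem mem_of_hasSum_pow_smul {X : Type*} [NormedAddCommGroup X] [NormedSpace ℝ X]
    [CompleteSpace X] {W : Submodule ℝ X} (hW : IsClosed (W : Set X)) {p : ℕ → X} {r : ℝ}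
    (hr : 0 < r) (hs : Summable fun m => r ^ m * ‖p m‖)
    (h : ∀ s y, 0 < s → s < r → HasSum (fun m => s ^ m • p m) y → y ∈ W) (m : ℕ) : p m ∈ W := by
  -- After subtracting the terms below `m` and dividing by `s ^ m`, the sum tends to `p m` as
  -- `s → 0`.
  induction m using Nat.strong_induction_on with
  | _ m ih =>
  have hs' : Summable fun k => r ^ k * ‖p (k + m)‖ := by
    have := ((summable_nat_add_iff m).2 hs).mul_left ((r ^ m)⁻¹)
    refine this.congr fun k => ?_
    rw [pow_add]
    field_simp
  have hb (k : ℕ) (s : ℝ) (h0 : s ∈ Set.Icc 0 r) :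
      ‖s ^ k • p (k + m)‖ ≤ r ^ k * ‖p (k + m)‖ := by
    rw [norm_smul, norm_pow, Real.norm_of_nonneg h0.1]
    gcongr
    exacts [h0.1, h0.2]
  have hcont : ContinuousOn (fun s : ℝ => ∑' k, s ^ k • p (k + m)) (Set.Icc 0 r) :=
    continuousOn_tsum (fun k => by fun_prop) hs' hb
  have h0 : ∑' k, (0 : ℝ) ^ k • p (k + m) = p m := by
    rw [tsum_eq_single 0 fun k hk => by rw [zero_pow hk, zero_smul]]
    simp
  have ht : Tendsto (fun s : ℝ => ∑' k, s ^ k • p (k + m)) (𝓝[Set.Ioo 0 r] 0) (𝓝 (p m)) := by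
    rw [← h0]
    exact (hcont 0 ⟨le_rfl, hr.le⟩).mono_left (nhdsWithin_mono _ Set.Ioo_subset_Icc_self)
  have : (𝓝[Set.Ioo 0 r] (0 : ℝ)).NeBot := left_nhdsWithin_Ioo_neBot hr
  refine hW.mem_of_tendsto ht (eventually_nhdsWithin_of_forall fun s hsr => ?_)
  have hsum : Summable fun k => s ^ k • p (k + m) :=
    Summable.of_norm_bounded hs' fun k => hb k s ⟨hsr.1.le, hsr.2.le⟩
  have h1 : HasSum (fun k => s ^ (k + m) • p (k + m)) (s ^ m • ∑' k, s ^ k • p (k + m)) := by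
    refine (hsum.hasSum.const_smul (s ^ m)).congr_fun fun k => ?_
    rw [smul_smul, pow_add, mul_comm]
  have h2 := h s _ hsr.1 hsr.2 ((hasSum_nat_add_iff m).1 h1)
  have h3 : ∑ i ∈ Finset.range m, s ^ i • p i ∈ W :=
    W.sum_mem fun i hi => W.smul_mem _ (ih i (Finset.mem_range.1 hi))
  have h4 := W.smul_mem (s ^ m)⁻¹ ((W.add_mem_iff_left h3).1 h2)
  rwa [smul_smul, inv_mul_cancel₀ (pow_pos hsr.1 m).ne', one_smul] at h4

/-- The vectors on which a family of functionals tends to zero. -/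
def vanishing {X ι : Type*} [NormedAddCommGroup X] [NormedSpace ℝ X] (L : ι → X →L[ℝ] ℂ)
    (l : Filter ι) : Submodule ℝ X where
  carrier := {x | Tendsto (fun z => L z x) l (𝓝 0)}
  zero_mem' := by simpa using tendsto_const_nhds
  add_mem' {x y} hx hy := by
    have := Tendsto.add hx hy
    simpa using this
  smul_mem' c x hx := by
    have := Tendsto.const_smul hx c
    simpa using this

theorem mem_vanishing {X ι : Type*} [NormedAddCommGroup X] [NormedSpace ℝ X] {L : ι → X →L[ℝ] ℂ}
    {l : Filter ι} {x : X} : x ∈ vanishing L l ↔ Tendsto (fun z => L z x) l (𝓝 0) := Iff.rfl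

theorem isClosed_vanishing {X ι : Type*} [NormedAddCommGroup X] [NormedSpace ℝ X]
    {L : ι → X →L[ℝ] ℂ} {l : Filter ι} {B : ℝ} (hB : ∀ z, ‖L z‖ ≤ B) :
    IsClosed (vanishing L l : Set X) := by
  refine isClosed_of_closure_subset fun x hx => ?_
  rw [SetLike.mem_coe, mem_vanishing, Metric.tendsto_nhds]
  intro ε hε
  obtain ⟨y, hy, hxy⟩ := Metric.mem_closure_iff.1 hx (ε / (2 * (|B| + 1))) (by positivity)
  filter_upwards [Metric.tendsto_nhds.1 (mem_vanishing.1 hy) (ε / 2) (by positivity)] with z hz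
  rw [dist_zero_right] at hz ⊢
  rw [dist_eq_norm] at hxy
  have h1 : ‖L z x - L z y‖ ≤ (|B| + 1) * ‖x - y‖ := by
    rw [← map_sub]
    exact (L z).le_of_opNorm_le ((hB z).trans (by linarith [le_abs_self B])) _
  have h2 : (|B| + 1) * ‖x - y‖ < ε / 2 := by
    rw [lt_div_iff₀ (by positivity)] at hxy
    linarith
  calc ‖L z x‖ ≤ ‖L z x - L z y‖ + ‖L z y‖ := norm_le_norm_sub_add _ _
    _ < ε := by linarith

/-- The coefficients of `(1 - x)^{-N}` are nonzero. -/
theorem choose_ne_zero {a : ℝ} (ha : 0 < a) (m : ℕ) : Ring.choose (a + m - 1) m ≠ 0 := by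
  rw [← Ring.multichoose_eq]
  intro h
  have h1 := Ring.factorial_nsmul_multichoose_eq_ascPochhammer a m
  rw [h, smul_zero, Polynomial.ascPochhammer_smeval_eq_eval] at h1
  exact (ascPochhammer_pos m a ha).ne h1

theorem hasSum_choose_mul_pow (a : ℝ) {x : ℝ} (hx : |x| < 1) :
    HasSum (fun m : ℕ => x ^ m * Ring.choose (a + m - 1) m) (1 / (1 - x) ^ a) := by
  have h := (Real.one_div_one_sub_rpow_hasFPowerSeriesOnBall_zero a).hasSum (y := x)
    (by
    rw [Metric.mem_eball, edist_zero_right, ← ofReal_norm, Real.norm_eq_abs]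
    exact ENNReal.ofReal_lt_one.2 hx)
  simpa [mul_comm] using h

/-- If a bounded family of functionals tends to zero on the functions `(1 - s t)^{-a}`, `0 < s < 1`,
of `t ∈ [0, 1]`, it tends to zero on every continuous function: the functions generate all monomials
by power series expansion in `s`. -/
theorem vanishing_eq_top {ι : Type*} {l : Filter ι} {L : ι → C(unitInterval, ℝ) →L[ℝ] ℂ} {B a : ℝ}
    (ha : 0 < a) (hB : ∀ z, ‖L z‖ ≤ B)
    (h : ∀ (s : ℝ) (y : C(unitInterval, ℝ)), 0 < s → s < 1 →
      (∀ t : unitInterval, y t = 1 / (1 - s * t) ^ a) → Tendsto (fun z => L z y) l (𝓝 0)) :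
    vanishing L l = ⊤ := by
  have hcl := isClosed_vanishing (l := l) hB
  set e : C(unitInterval, ℝ) := ⟨fun t => t, by fun_prop⟩ with he
  have hn (m : ℕ) : ‖e ^ m‖ ≤ 1 := by
    rw [ContinuousMap.norm_le _ zero_le_one]
    intro t
    rw [ContinuousMap.pow_apply, norm_pow, he, ContinuousMap.coe_mk,
      Real.norm_of_nonneg t.2.1]
    exact pow_le_one₀ t.2.1 t.2.2
  have hmem (m : ℕ) : e ^ m ∈ vanishing L l := by
    have hsum : Summable fun m : ℕ => (1 / 2 : ℝ) ^ m * ‖Ring.choose (a + m - 1) m • e ^ m‖ := by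
      have h1 := (hasSum_choose_mul_pow a (x := 1 / 2) (by norm_num [abs_lt])).summable.norm
      refine Summable.of_nonneg_of_le (fun m => by positivity) (fun m => ?_) h1
      rw [norm_smul, norm_mul, Real.norm_of_nonneg (by positivity : (0 : ℝ) ≤ (1 / 2) ^ m)]
      refine mul_le_mul_of_nonneg_left ?_ (by positivity)
      exact mul_le_of_le_one_right (norm_nonneg _) (hn m)
    have key := mem_of_hasSum_pow_smul hcl (by norm_num) hsum (fun s y hs hs1 hy => ?_) m
    · have := (vanishing L l).smul_mem (Ring.choose (a + m - 1) m)⁻¹ key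
      rwa [smul_smul, inv_mul_cancel₀ (choose_ne_zero ha m), one_smul] at this
    · refine h s y hs (by linarith) fun t => ?_
      have h2 := hy.map (ContinuousMap.evalCLM ℝ t) (ContinuousMap.evalCLM ℝ t).continuous
      have h3 := hasSum_choose_mul_pow a (x := s * t) (by
        rw [abs_of_nonneg (mul_nonneg hs.le t.2.1)]
        nlinarith [t.2.1, t.2.2])
      refine HasSum.unique h2 (h3.congr_fun fun m => ?_)
      simp [he, mul_pow]
      ring
  rw [eq_top_iff]
  intro y _
  have hy : y ∈ (polynomialFunctions unitInterval).topologicalClosure := by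
    rw [polynomialFunctions_closure_eq_top']
    trivial
  refine hcl.closure_subset_iff.2 (fun q hq => ?_) hy
  obtain ⟨p, rfl⟩ := (polynomialFunctions_coe unitInterval).subset hq
  clear hq
  induction p using Polynomial.induction_on' with
  | add p q hp hq => rw [map_add]; exact (vanishing L l).add_mem hp hq
  | monomial m c =>
    have : Polynomial.toContinuousMapOnAlgHom unitInterval (Polynomial.monomial m c) =
        c • e ^ m := by
      ext t
      simp [he]
    rw [this]
    exact (vanishing L l).smul_mem c (hmem m)

/-- The cocycle identity of the Berezin weights. -/
theorem bweight_phi_left {z a w : Cn n} (hz : ‖z‖ < 1) (ha : ‖a‖ < 1) (hw : ‖w‖ < 1) :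
    bweight n α (phi z a) w = bweight n α a (phi z w) * bweight n α z w := by
  have hb := norm_phi_lt_one hz ha
  have hpa := one_sub_norm_sq_pos ha
  have hpz := one_sub_norm_sq_pos hz
  have hpb := one_sub_norm_sq_pos hb
  have d1 := norm_pos_iff.2 (one_sub_inner_ne_zero hz hw.le)
  have d2 := norm_pos_iff.2 (one_sub_inner_ne_zero hb hw.le)
  have d3 := norm_pos_iff.2 (one_sub_inner_ne_zero hz hb.le)
  have h1 := one_sub_norm_phi_sq hz hb.le
  have h2 := congrArg norm (one_sub_inner_phi_phi hz hb.le hw.le)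
  rw [phi_phi hz ha] at h1 h2
  have e : (1 - ((‖z‖ ^ 2 : ℝ) : ℂ)) = ((1 - ‖z‖ ^ 2 : ℝ) : ℂ) := by push_cast; ring
  rw [e, norm_div, norm_mul, norm_mul, Complex.norm_real, Real.norm_of_nonneg hpz.le,
    ← conj_one_sub_inner z (phi z a), RCLike.norm_conj] at h2
  rw [bweight, bweight, bweight, ← Real.mul_rpow (by positivity) (by positivity), h1, h2]
  congr 1
  field_simp

theorem berezin_eq_integral_bweight {τ : Cn n → ℂ} {z : Cn n} (hz : ‖z‖ < 1) :
    berezin n α τ z = ∫ w, (bweight n α z w : ℂ) * τ w ∂(nuAlpha n α) := by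
  simp only [berezin, norm_normKernel_sq hz, smul_eq_mul]

/-- The norm formula `‖K_a‖² = c (1 - |a|²)^{-N}`, as the total mass of the Berezin weight. -/
theorem integral_norm_kernel_sq (hα : -1 < α) {a : Cn n} (ha : ‖a‖ < 1) :
    ∫ u, ‖kernel n α a u‖ ^ 2 ∂(nuAlpha n α) =
      (nuAlpha n α).real Set.univ * (1 / (1 - ‖a‖ ^ 2) ^ (n + 1 + α)) := by
  have hp := Real.rpow_pos_of_pos (one_sub_norm_sq_pos ha) (n + 1 + α)
  have h := integral_phi_comp hα ha (fun _ => (1 : ℝ))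
  simp only [integral_const, smul_eq_mul, mul_one, ← norm_kernel_sq_mul ha,
    integral_mul_const] at h
  rw [h, mul_assoc, mul_one_div_cancel hp.ne', mul_one]

theorem norm_kernel_smul_comm (s : ℝ) (u v : Cn n) :
    ‖kernel n α ((s : ℂ) • u) v‖ = ‖kernel n α ((s : ℂ) • v) u‖ := by
  rw [kernel, kernel, norm_div, norm_div, Complex.norm_cpow_real, Complex.norm_cpow_real,
    ← conj_one_sub_inner, RCLike.norm_conj, inner_smul_left, inner_smul_right, Complex.conj_ofReal]

theorem measurable_phi (z : Cn n) : Measurable (phi z) := by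
  unfold phi
  split_ifs
  · fun_prop
  · fun_prop

theorem integrable_bweight_mul {τ : Cn n → ℂ}
    (hτ : AEStronglyMeasurable τ (nuAlpha n α)) {M : ℝ≥0∞} (hMt : M ≠ ∞) {z : Cn n} (hz : ‖z‖ < 1)
    (hM : ∫⁻ u, ‖τ u‖ₑ * ENNReal.ofReal (bweight n α z u) ∂(nuAlpha n α) ≤ M) :
    Integrable (fun w => (bweight n α z w : ℂ) * τ w) (nuAlpha n α) := by
  have hb : Measurable fun w => bweight n α z w := by unfold bweight; fun_prop
  refine ⟨(Complex.measurable_ofReal.comp hb).aestronglyMeasurable.mul hτ, ?_⟩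
  rw [hasFiniteIntegral_iff_enorm]
  have := lintegral_average_integrand_le (γ := fun _ => 1) (B := 1) (by simp) hz hM
  simp only [one_mul, ENNReal.ofReal_one] at this
  exact this.trans_lt (lt_top_iff_ne_top.2 hMt)

/-- The radial average with weight `(1 - s² t)^{-N}`, `t = |φ_z|²`, is an average of the Berezin
transform over the points `φ_z(s u)`: the norm formula for the kernels, applied in the variable `u`,
gives the weight. -/
theorem average_kernel_eq (hα : -1 < α) {τ : Cn n → ℂ}
    (hτ : AEStronglyMeasurable τ (nuAlpha n α)) {M : ℝ≥0∞} (hMt : M ≠ ∞) {z : Cn n} (hz : ‖z‖ < 1)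
    (hM : ∫⁻ u, ‖τ u‖ₑ * ENNReal.ofReal (bweight n α z u) ∂(nuAlpha n α) ≤ M) {s : ℝ}
    (hs : 0 ≤ s) (hs1 : s < 1) :
    (nuAlpha n α).real Set.univ *
        average n α (fun t => 1 / (1 - s ^ 2 * t) ^ (n + 1 + α)) τ z =
      ∫ u, ((1 / (1 - ‖(s : ℂ) • u‖ ^ 2) ^ (n + 1 + α) : ℝ) : ℂ) *
        berezin n α τ (phi z ((s : ℂ) • u)) ∂(nuAlpha n α) := by
  have := isFiniteMeasure_nuAlpha (n := n) hα
  have hsu (u : Cn n) (hu : ‖u‖ < 1) : ‖(s : ℂ) • u‖ ≤ s := by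
    rw [norm_smul, Complex.norm_real, Real.norm_of_nonneg hs]
    exact mul_le_of_le_one_right hs hu.le
  have hI := integrable_bweight_mul hτ hMt hz hM
  have hint : Integrable (fun p : Cn n × Cn n =>
      ((‖kernel n α ((s : ℂ) • p.1) (phi z p.2)‖ ^ 2 : ℝ) : ℂ) * ((bweight n α z p.2 : ℂ) * τ p.2))
      ((nuAlpha n α).prod (nuAlpha n α)) := by
    have h1 : Integrable (fun p : Cn n × Cn n => (bweight n α z p.2 : ℂ) * τ p.2)
      ((nuAlpha n α).prod (nuAlpha n α)) := hI.comp_snd _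
    have hm : Measurable fun p : Cn n × Cn n => phi z p.2 := (measurable_phi z).comp measurable_snd
    have hk : Measurable fun p : Cn n × Cn n =>
        ((‖kernel n α ((s : ℂ) • p.1) (phi z p.2)‖ ^ 2 : ℝ) : ℂ) := by
      unfold kernel; fun_prop
    refine h1.bdd_mul (c := (1 / (1 - s) ^ (n + 1 + α)) ^ 2) hk.aestronglyMeasurable ?_
    have hae : ∀ᵐ p ∂((nuAlpha n α).prod (nuAlpha n α)), ‖p.1‖ < 1 ∧ ‖p.2‖ < 1 :=
      (Measure.quasiMeasurePreserving_fst.ae ae_mem_unitBall).and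
        (Measure.quasiMeasurePreserving_snd.ae ae_mem_unitBall)
    filter_upwards [hae] with p hp
    have ha := hsu _ hp.1
    have hpos : 0 < 1 - s := by linarith
    rw [Complex.norm_real, norm_pow, norm_norm]
    have hk := norm_kernel_le hα (ha.trans_lt hs1) (norm_phi_lt_one hz hp.2).le
    refine pow_le_pow_left₀ (norm_nonneg _) (hk.trans ?_) 2
    have := exponent_pos n hα
    gcongr
  have hswap := integral_integral_swap (f := fun u w =>
    ((‖kernel n α ((s : ℂ) • u) (phi z w)‖ ^ 2 : ℝ) : ℂ) * ((bweight n α z w : ℂ) * τ w)) hint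
  have hl : ∫ w, ∫ u, ((‖kernel n α ((s : ℂ) • u) (phi z w)‖ ^ 2 : ℝ) : ℂ) *
      ((bweight n α z w : ℂ) * τ w) ∂(nuAlpha n α) ∂(nuAlpha n α) = (nuAlpha n α).real Set.univ *
        average n α (fun t => 1 / (1 - s ^ 2 * t) ^ (n + 1 + α)) τ z := by
    rw [average, ← integral_const_mul]
    refine integral_congr_ae ?_
    filter_upwards [ae_mem_unitBall] with w hw
    have hv := norm_phi_lt_one hz hw
    rw [integral_mul_const, integral_complex_ofReal]
    simp only [norm_kernel_smul_comm s _ (phi z w)]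
    rw [integral_norm_kernel_sq hα ((hsu _ hv).trans_lt hs1), rhoSq_eq hz hw.le, norm_smul,
      Complex.norm_real, Real.norm_of_nonneg hs, mul_pow]
    push_cast
    ring
  rw [← hl, ← hswap]
  refine integral_congr_ae ?_
  filter_upwards [ae_mem_unitBall] with u hu
  have ha := (hsu u hu).trans_lt hs1
  have hp := Real.rpow_pos_of_pos (one_sub_norm_sq_pos ha) (n + 1 + α)
  rw [berezin_eq_integral_bweight (norm_phi_lt_one hz ha), ← integral_const_mul]
  refine integral_congr_ae ?_
  filter_upwards [ae_mem_unitBall] with w hw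
  rw [bweight_phi_left hz ha hw, ← norm_kernel_sq_mul ha (v := phi z w)]
  have : (((1 - ‖(s : ℂ) • u‖ ^ 2) ^ (n + 1 + α) : ℝ) : ℂ) ≠ 0 := by exact_mod_cast hp.ne'
  push_cast at this ⊢
  field_simp

/-- The points `φ_z(a)`, `|a| ≤ s < 1`, tend to the boundary uniformly as `|z| → 1`. -/
theorem eventually_le_norm_phi {s r : ℝ} (hs1 : s < 1) (hr : r < 1) :
    ∀ᶠ z : Cn n in comap (fun z => ‖z‖) (𝓝[<] 1), ‖z‖ < 1 ∧
      ∀ a : Cn n, ‖a‖ ≤ s → r ≤ ‖phi z a‖ := by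
  have h1 : ∀ᶠ x : ℝ in 𝓝[<] 1, 1 - x ^ 2 < (1 - r) * (1 - s) ^ 2 := by
    refine eventually_nhdsWithin_of_eventually_nhds ?_
    have hc : ContinuousAt (fun x : ℝ => 1 - x ^ 2) 1 := by fun_prop
    refine hc.eventually_lt continuousAt_const ?_
    have h2 : 0 < 1 - r := by linarith
    have h3 : 0 < 1 - s := by linarith
    rw [one_pow, sub_self]
    positivity
  have h2 : ∀ᶠ x : ℝ in 𝓝[<] 1, x < 1 := self_mem_nhdsWithin
  filter_upwards [tendsto_comap.eventually h1, tendsto_comap.eventually h2] with z hz1 hz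
  refine ⟨hz, fun a ha => ?_⟩
  have ha1 := ha.trans_lt hs1
  have hd : 1 - s ≤ ‖1 - inner ℂ z a‖ := by
    rw [← conj_one_sub_inner, RCLike.norm_conj]
    linarith [one_sub_norm_le (z := a) hz.le]
  have h3 := one_sub_norm_phi_sq hz ha1.le
  have hpz := one_sub_norm_sq_pos hz
  have hs : 0 < 1 - s := by linarith
  have h4 : 1 - ‖phi z a‖ ^ 2 ≤ 1 - r := by
    rw [h3, div_le_iff₀ (pow_pos (hs.trans_le hd) 2)]
    calc (1 - ‖z‖ ^ 2) * (1 - ‖a‖ ^ 2) ≤ 1 - ‖z‖ ^ 2 :=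
          mul_le_of_le_one_right hpz.le (by linarith [sq_nonneg ‖a‖])
      _ ≤ (1 - r) * (1 - s) ^ 2 := hz1.le
      _ ≤ _ := by gcongr
  have h5 := norm_phi_lt_one hz ha1
  nlinarith [norm_nonneg (phi z a)]

theorem exists_radius_of_tendsto {σ : Cn n → ℂ}
    (h : Tendsto σ (comap (fun z => ‖z‖) (𝓝[<] 1)) (𝓝 0)) {η : ℝ} (hη : 0 < η) :
    ∃ r < 1, ∀ z, r ≤ ‖z‖ → ‖z‖ < 1 → ‖σ z‖ ≤ η := by
  have h1 := h.norm.eventually (Iio_mem_nhds (by simpa using hη : ‖(0 : ℂ)‖ < η))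
  obtain ⟨t, ht, hts⟩ := mem_comap.1 h1
  obtain ⟨l, hl, hlt⟩ := (mem_nhdsLT_iff_exists_Ioo_subset' (zero_lt_one' ℝ)).1 ht
  refine ⟨(l + 1) / 2, by linarith [Set.mem_Iio.1 hl],
    fun z hz hz1 => ?_⟩
  have : l < ‖z‖ := by linarith [Set.mem_Iio.1 hl]
  exact (hts (a := z) (hlt ⟨this, hz1⟩) : ‖σ z‖ < η).le

/-- The averages with the weights `(1 - s² t)^{-N}` vanish at the boundary. -/
theorem tendsto_average_kernel (hα : -1 < α) {τ : Cn n → ℂ}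
    (hτ : AEStronglyMeasurable τ (nuAlpha n α)) {M : ℝ≥0∞} (hMt : M ≠ ∞) (hM : ∀ z : Cn n, ‖z‖ < 1 →
      ∫⁻ u, ‖τ u‖ₑ * ENNReal.ofReal (bweight n α z u) ∂(nuAlpha n α) ≤ M)
    (hlim : Tendsto (berezin n α τ) (comap (fun z => ‖z‖) (𝓝[<] 1)) (𝓝 0)) {s : ℝ}
    (hs : 0 ≤ s) (hs1 : s < 1) :
    Tendsto (average n α (fun t => 1 / (1 - s ^ 2 * t) ^ (n + 1 + α)) τ)
      (comap (fun z => ‖z‖) (𝓝[<] 1)) (𝓝 0) := by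
  have := isFiniteMeasure_nuAlpha (n := n) hα
  have hc := nuAlpha_univ_pos (n := n) hα
  set c := (nuAlpha n α).real Set.univ with hcdef
  have hps : 0 < 1 - s ^ 2 := by nlinarith
  set D : ℝ := 1 / (1 - s ^ 2) ^ (n + 1 + α) with hD
  have hD0 : 0 < D := by positivity
  rw [Metric.tendsto_nhds]
  intro ε hε
  obtain ⟨r, hr, hσ⟩ := exists_radius_of_tendsto hlim (η := ε / (2 * D)) (by positivity)
  filter_upwards [eventually_le_norm_phi hs1 hr] with z hz
  have hle : ‖∫ u, ((1 / (1 - ‖(s : ℂ) • u‖ ^ 2) ^ (n + 1 + α) : ℝ) : ℂ) *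
      berezin n α τ (phi z ((s : ℂ) • u)) ∂(nuAlpha n α)‖ ≤ ε / 2 * c := by
    refine norm_integral_le_of_norm_le_const (ae_mem_unitBall.mono fun u hu => ?_)
    have ha : ‖(s : ℂ) • u‖ ≤ s := by
      rw [norm_smul, Complex.norm_real, Real.norm_of_nonneg hs]
      exact mul_le_of_le_one_right hs hu.le
    have ha1 := ha.trans_lt hs1
    have hpa := one_sub_norm_sq_pos ha1
    have h1 := hσ _ (hz.2 _ ha) (norm_phi_lt_one hz.1 ha1)
    have h2 : 1 / (1 - ‖(s : ℂ) • u‖ ^ 2) ^ (n + 1 + α) ≤ D := by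
      have := exponent_pos n hα
      refine one_div_le_one_div_of_le (by positivity) (Real.rpow_le_rpow hps.le ?_ this.le)
      gcongr
    rw [norm_mul, Complex.norm_real, Real.norm_of_nonneg (by positivity)]
    calc _ ≤ D * (ε / (2 * D)) := by gcongr
      _ = ε / 2 := by field_simp
  rw [← average_kernel_eq hα hτ hMt hz.1 (hM z hz.1) hs hs1, norm_mul, Complex.norm_real,
    Real.norm_of_nonneg hc.le, mul_comm, mul_le_mul_iff_left₀ hc] at hle
  rw [dist_zero_right]
  linarith

theorem norm_lt_one_eventually :
    ∀ᶠ z : Cn n in comap (fun z => ‖z‖) (𝓝[<] 1), ‖z‖ < 1 :=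
  tendsto_comap.eventually (p := fun x : ℝ => x < 1) self_mem_nhdsWithin

theorem average_congr {γ γ' : ℝ → ℝ} (h : ∀ t ∈ Set.Icc (0 : ℝ) 1, γ t = γ' t) (τ : Cn n → ℂ)
    {z : Cn n} (hz : ‖z‖ < 1) : average n α γ τ z = average n α γ' τ z := by
  refine integral_congr_ae ?_
  filter_upwards [ae_mem_unitBall] with w hw
  have hp := norm_phi_lt_one hz hw
  have : rhoSq z w ∈ Set.Icc (0 : ℝ) 1 := by
    rw [rhoSq_eq hz hw.le]
    exact ⟨by positivity, pow_le_one₀ (norm_nonneg _) hp.le⟩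
  rw [h _ this]

/-- For `z` in the ball, `γ ↦ average γ τ z` is a bounded functional on continuous functions. -/
theorem exists_averageCLM {τ : Cn n → ℂ}
    (hτ : AEStronglyMeasurable τ (nuAlpha n α)) {M : ℝ≥0∞} (hMt : M ≠ ∞) {z : Cn n} (hz : ‖z‖ < 1)
    (hM : ∫⁻ u, ‖τ u‖ₑ * ENNReal.ofReal (bweight n α z u) ∂(nuAlpha n α) ≤ M) :
    ∃ L : C(unitInterval, ℝ) →L[ℝ] ℂ, ‖L‖ ≤ M.toReal ∧
      ∀ γ, L γ = average n α (Set.IccExtend zero_le_one γ) τ z := by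
  have hI := integrable_bweight_mul hτ hMt hz hM
  have hr : Measurable fun w => rhoSq z w := by unfold rhoSq; fun_prop
  have hb (γ : C(unitInterval, ℝ)) (t : ℝ) : |Set.IccExtend zero_le_one γ t| ≤ ‖γ‖ :=
    γ.norm_coe_le_norm _
  have hint (γ : C(unitInterval, ℝ)) : Integrable (fun u =>
      ((Set.IccExtend zero_le_one γ (rhoSq z u) * bweight n α z u : ℝ) : ℂ) * τ u)
      (nuAlpha n α) := by
    have hm : Measurable fun u => ((Set.IccExtend zero_le_one γ (rhoSq z u) : ℝ) : ℂ) :=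
      Complex.measurable_ofReal.comp (γ.continuous.Icc_extend'.measurable.comp hr)
    have := hI.bdd_mul (c := ‖γ‖) hm.aestronglyMeasurable (ae_of_all _ fun u => by
      rw [Complex.norm_real]
      exact hb γ _)
    refine this.congr (ae_of_all _ fun u => ?_)
    push_cast
    ring
  let L₀ : C(unitInterval, ℝ) →ₗ[ℝ] ℂ :=
    { toFun := fun γ => average n α (Set.IccExtend zero_le_one γ) τ z
      map_add' := fun γ γ' => by
        rw [average, average, average, ← integral_add (hint γ) (hint γ')]
        refine integral_congr_ae (ae_of_all _ fun u => ?_)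
        simp [Set.IccExtend]
        ring
      map_smul' := fun c γ => by
        rw [average, average, ← integral_smul]
        refine integral_congr_ae (ae_of_all _ fun u => ?_)
        simp [Set.IccExtend]
        ring }
  refine ⟨L₀.mkContinuous M.toReal fun γ => ?_, L₀.mkContinuous_norm_le ENNReal.toReal_nonneg _,
    fun γ => rfl⟩
  rw [mul_comm]
  exact norm_average_le (hb γ) hMt hz hM

/-- If the Berezin transform vanishes at the boundary, then so do all radial averages with a
continuous weight. -/
theorem tendsto_average (hα : -1 < α) {τ : Cn n → ℂ}
    (hτ : AEStronglyMeasurable τ (nuAlpha n α)) {M : ℝ≥0∞} (hMt : M ≠ ∞) (hM : ∀ z : Cn n, ‖z‖ < 1 →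
      ∫⁻ u, ‖τ u‖ₑ * ENNReal.ofReal (bweight n α z u) ∂(nuAlpha n α) ≤ M)
    (hlim : Tendsto (berezin n α τ) (comap (fun z => ‖z‖) (𝓝[<] 1)) (𝓝 0)) {γ : ℝ → ℝ}
    (hγ : Continuous γ) :
    Tendsto (average n α γ τ) (comap (fun z => ‖z‖) (𝓝[<] 1)) (𝓝 0) := by
  have hL (z : Cn n) : ∃ L : C(unitInterval, ℝ) →L[ℝ] ℂ, ‖L‖ ≤ M.toReal ∧
      (‖z‖ < 1 → ∀ γ, L γ = average n α (Set.IccExtend zero_le_one γ) τ z) := by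
    by_cases hz : ‖z‖ < 1
    · obtain ⟨L, h1, h2⟩ := exists_averageCLM hτ hMt hz (hM z hz)
      exact ⟨L, h1, fun _ => h2⟩
    · exact ⟨0, ContinuousLinearMap.opNorm_zero.trans_le ENNReal.toReal_nonneg,
        fun h => absurd h hz⟩
  choose L hB hL using hL
  have htop := vanishing_eq_top (l := comap (fun z : Cn n => ‖z‖) (𝓝[<] 1)) (exponent_pos n hα) hB
    (fun s y hs hs1 hy => ?_)
  · have h : (⟨fun t => γ t, by fun_prop⟩ : C(unitInterval, ℝ)) ∈
        vanishing L (comap (fun z : Cn n => ‖z‖) (𝓝[<] 1)) := by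
      rw [htop]
      trivial
    refine (mem_vanishing.1 h).congr' ?_
    filter_upwards [norm_lt_one_eventually] with z hz
    rw [hL z hz]
    refine average_congr (fun t ht => ?_) τ hz
    rw [Set.IccExtend_of_mem _ _ ht]
    rfl
  · have h := tendsto_average_kernel hα hτ hMt hM hlim (Real.sqrt_nonneg s)
      (by rwa [Real.sqrt_lt' one_pos, one_pow])
    rw [Real.sq_sqrt hs.le] at h
    refine h.congr' ?_
    filter_upwards [norm_lt_one_eventually] with z hz
    rw [hL z hz]
    refine average_congr (fun t ht => ?_) τ hz
    rw [Set.IccExtend_of_mem _ _ ht, hy]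

/-! ### The scalar Toeplitz operator -/

/-- A `BMO¹` symbol with bounded Berezin transform has bounded averages of its modulus. -/
theorem exists_average_bound (hα : -1 < α) {τ : Cn n → ℂ} (hτ : MemBMO n α τ)
    (hbdd : ∃ C : ℝ, ∀ z ∈ unitBall n, ‖berezin n α τ z‖ ≤ C) :
    ∃ M : ℝ≥0∞, M ≠ ∞ ∧ ∀ z : Cn n, ‖z‖ < 1 →
      ∫⁻ u, ‖τ u‖ₑ * ENNReal.ofReal (bweight n α z u) ∂(nuAlpha n α) ≤ M := by
  have := isFiniteMeasure_nuAlpha (n := n) hα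
  obtain ⟨C, hC⟩ := hbdd
  refine ⟨_ + ENNReal.ofReal C * nuAlpha n α Set.univ,
    ENNReal.add_ne_top.2 ⟨hτ.2.ne, by finiteness⟩,
    fun z hz => ?_⟩
  have hz' : z ∈ unitBall n := by simpa using hz
  rw [← lintegral_phi_comp hα hz fun u => ‖τ u‖ₑ]
  calc ∫⁻ w, ‖τ (phi z w)‖ₑ ∂(nuAlpha n α)
      ≤ ∫⁻ w, (‖τ (phi z w) - berezin n α τ z‖ₑ + ENNReal.ofReal C) ∂(nuAlpha n α) := by
        refine lintegral_mono fun w => ?_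
        have h1 : ‖berezin n α τ z‖ₑ ≤ ENNReal.ofReal C := by
          rw [← ofReal_norm]
          exact ENNReal.ofReal_le_ofReal (hC z hz')
        calc ‖τ (phi z w)‖ₑ = ‖(τ (phi z w) - berezin n α τ z) + berezin n α τ z‖ₑ := by
              rw [sub_add_cancel]
          _ ≤ _ := (enorm_add_le _ _).trans (by gcongr)
    _ = eLpNorm (fun w => τ (phi z w) - berezin n α τ z) 1 (nuAlpha n α) +
          ENNReal.ofReal C * nuAlpha n α Set.univ := by
        rw [lintegral_add_right _ measurable_const, lintegral_const, eLpNorm_one_eq_lintegral_enorm]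
    _ ≤ _ := by
        gcongr
        exact le_iSup₂ (f := fun z (_ : z ∈ unitBall n) =>
          eLpNorm (fun w => τ (phi z w) - berezin n α τ z) 1 (nuAlpha n α)) z hz'

/-- The operator of the Toeplitz form of `τ` is compact: it is a norm limit of the operators of
small radial averages of `τ`, which vanish at the boundary. -/
theorem isCompactOperator_isFormOp (hα : -1 < α) {τ : Cn n → ℂ}
    (hτ : AEStronglyMeasurable τ (nuAlpha n α)) {M : ℝ≥0∞} (hMt : M ≠ ∞) (hM : ∀ z : Cn n, ‖z‖ < 1 →
      ∫⁻ u, ‖τ u‖ₑ * ENNReal.ofReal (bweight n α z u) ∂(nuAlpha n α) ≤ M)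
    (hlim : Tendsto (berezin n α τ) (comap (fun z => ‖z‖) (𝓝[<] 1)) (𝓝 0))
    {T : bergman ℂ n α →L[ℂ] bergman ℂ n α} (hT : IsFormOp τ T) : IsCompactOperator T := by
  have := completeSpace_bergman (n := n) hα
  obtain ⟨K, _, hK⟩ := carlesonBound_of_averages hα hτ hMt hM
  set A : ℝ := 16 * subMeanConst n α * (2 ^ (n + 1 + α) * M.toReal) with hA
  have hA0 : 0 ≤ A := by
    have := subMeanConst_nonneg (n := n) (α := α)
    positivity
  refine isCompactOperator_of_forall_approx fun η hη => ?_
  -- The radius keeps the error `A ε` below `η`, within the range `ε ≤ 1 / 4` of the estimate.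
  set ε : ℝ := min (1 / 4) (η / (A + 1)) with hε
  have hε0 : 0 < ε := by positivity
  have hε1 : ε ≤ 1 / 4 := min_le_left _ _
  have hεA : ε * A ≤ η := by
    have h1 : ε ≤ η / (A + 1) := min_le_right _ _
    rw [le_div_iff₀ (by positivity)] at h1
    nlinarith
  obtain ⟨γ, hγ⟩ := exists_isBump (n := n) hα hε0 (by linarith)
  obtain ⟨B, hB⟩ := hγ.bounded
  have hbd (z : Cn n) (hz : ‖z‖ < 1) : ‖average n α γ τ z‖ ≤ B * M.toReal :=
    norm_average_le hB hMt hz (hM z hz)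
  have hB0 : 0 ≤ B := (abs_nonneg _).trans (hB 0)
  have hm := aestronglyMeasurable_average hα hγ.continuous.measurable hτ
  obtain ⟨T', hT'⟩ := exists_isFormOp hα hm (by positivity) (carlesonBound_of_bound hbd)
  have hv := tendsto_average hα hτ hMt hM hlim hγ.continuous
  refine ⟨T', isCompactOperator_of_vanishing hα hm hbd
    (fun η hη => exists_radius_of_tendsto hv hη) hT', ?_⟩
  refine (hT.norm_sub_le hT' (K := 16 * ε * subMeanConst n α * (2 ^ (n + 1 + α) * M.toReal)) ?_
    fun f g => (norm_sub_rev _ _).trans_le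
      (norm_integral_average_sub_le hα hε0 hε1 hγ hτ hMt hM hK f g)).trans ?_
  · have := subMeanConst_nonneg (n := n) (α := α)
    positivity
  · refine le_trans (le_of_eq ?_) hεA
    rw [hA]
    ring

/-- The operator of the Toeplitz form is the Toeplitz integral up to the total mass of `ν_α`,
the factor in the reproducing formula. -/
theorem IsFormOp.ae_eq_integral (hα : -1 < α) {τ : Cn n → ℂ}
    {T : bergman ℂ n α →L[ℂ] bergman ℂ n α} (hT : IsFormOp τ T) (F : bergman ℂ n α) :
    (((((nuAlpha n α).real Set.univ : ℝ) : ℂ) • T) F : Lp ℂ 2 (nuAlpha n α)) =ᵐ[nuAlpha n α]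
      fun z => ∫ w, starRingEnd ℂ (kernel n α z w) * (τ w * (F : Lp ℂ 2 (nuAlpha n α)) w)
        ∂(nuAlpha n α) := by
  rw [smul_apply, Submodule.coe_smul]
  filter_upwards [ae_mem_unitBall, coeFn_ae_eq_holRep (T F), Lp.coeFn_smul
    (((nuAlpha n α).real Set.univ : ℝ) : ℂ) (T F : Lp ℂ 2 (nuAlpha n α))] with z hz h1 h2
  rw [h2, Pi.smul_apply, smul_eq_mul, h1, ← inner_kernelElt hα hz, hT]
  refine integral_congr_ae ?_
  have h3 : (kernelElt hα z : Lp ℂ 2 (nuAlpha n α)) =ᵐ[nuAlpha n α] kernel n α z := by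
    rw [kernelElt, dif_pos hz]
    exact (memLp_kernel hα hz).coeFn_toLp
  filter_upwards [h3] with w hw
  rw [hw]

/-! ### Vector-valued functions -/

section Map

variable {E F G : Type*} [NormedAddCommGroup E] [NormedSpace ℂ E] [NormedAddCommGroup F]
  [NormedSpace ℂ F] [NormedAddCommGroup G] [NormedSpace ℂ G]

/-- The operator between vector-valued Bergman spaces given by applying a fixed bounded operator to
the values. -/
def bergmanMap (n : ℕ) (α : ℝ) (A : E →L[ℂ] F) : bergman E n α →L[ℂ] bergman F n α :=
  ((A.compLpL 2 (nuAlpha n α)).comp (bergman E n α).subtypeL).codRestrict _ fun f =>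
    ⟨fun z => A (holRep f z), A.differentiable.comp_differentiableOn (differentiableOn_holRep f), by
      filter_upwards [A.coeFn_compLpL (p := 2) (f : Lp E 2 (nuAlpha n α)), coeFn_ae_eq_holRep f]
        with z h1 h2
      rw [← h2]
      exact h1⟩

theorem coeFn_bergmanMap (A : E →L[ℂ] F) (f : bergman E n α) :
    (bergmanMap n α A f : Lp F 2 (nuAlpha n α)) =ᵐ[nuAlpha n α]
      fun z => A ((f : Lp E 2 (nuAlpha n α)) z) :=
  A.coeFn_compLpL (p := 2) (f : Lp E 2 (nuAlpha n α))

theorem norm_bergmanMap_le (A : E →L[ℂ] F) : ‖bergmanMap n α A‖ ≤ ‖A‖ := by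
  refine ContinuousLinearMap.opNorm_le_bound _ (norm_nonneg _) fun f => ?_
  exact (A.compLpL 2 (nuAlpha n α)).le_of_opNorm_le A.norm_compLpL_le (f : Lp E 2 (nuAlpha n α))

theorem bergmanMap_bergmanMap (A : F →L[ℂ] G) (B : E →L[ℂ] F) (f : bergman E n α) :
    bergmanMap n α A (bergmanMap n α B f) = bergmanMap n α (A.comp B) f := by
  refine Subtype.ext (Lp.ext ?_)
  filter_upwards [coeFn_bergmanMap A (bergmanMap n α B f), coeFn_bergmanMap B f,
    coeFn_bergmanMap (A.comp B) f] with z h1 h2 h3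
  rw [h1, h2, h3, ContinuousLinearMap.comp_apply]

theorem bergmanMap_id (f : bergman E n α) : bergmanMap n α (ContinuousLinearMap.id ℂ E) f = f := by
  refine Subtype.ext (Lp.ext ?_)
  filter_upwards [coeFn_bergmanMap (ContinuousLinearMap.id ℂ E) f] with z h
  rw [h, ContinuousLinearMap.id_apply]

theorem bergmanMap_zero (f : bergman E n α) : bergmanMap n α (0 : E →L[ℂ] F) f = 0 := by
  refine Subtype.ext (Lp.ext ?_)
  filter_upwards [coeFn_bergmanMap (0 : E →L[ℂ] F) f, Lp.coeFn_zero F 2 (nuAlpha n α)] with z h h'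
  rw [h, Submodule.coe_zero, h', zero_apply, Pi.zero_apply]

end Map

/-- The coordinate functionals of `ℓ²`. -/
def coord (i : ℕ) : ell2 →L[ℂ] ℂ := lp.evalCLM ℂ (fun _ : ℕ => ℂ) 2 i

theorem coord_apply (i : ℕ) (x : ell2) : coord i x = x i := rfl

theorem norm_coord_le (i : ℕ) : ‖coord i‖ ≤ 1 :=
  ContinuousLinearMap.opNorm_le_bound _ zero_le_one fun x => by
    rw [one_mul]
    exact lp.norm_apply_le_norm (by norm_num) x i

theorem ell2_ext {x y : ell2} (h : ∀ i, coord i x = coord i y) : x = y :=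
  lp.ext (funext h)

/-- The embedding of `ℂ` as the `i`-th coordinate axis of `ℓ²`. -/
def axis (i : ℕ) : ℂ →L[ℂ] ell2 := ContinuousLinearMap.toSpanSingleton ℂ (basisVec i)

theorem norm_axis (i : ℕ) : ‖axis i‖ = 1 := by
  rw [axis, ContinuousLinearMap.norm_toSpanSingleton, basisVec, lp.norm_single (by norm_num),
    norm_one]

theorem coord_comp_axis (i j : ℕ) :
    (coord j).comp (axis i) = if i = j then ContinuousLinearMap.id ℂ ℂ else 0 := by
  ext
  by_cases h : i = j
  · subst h
    simp [axis, coord_apply, basisVec]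
  · simp [axis, coord_apply, basisVec, h, Ne.symm h]

theorem coord_diagOp (j : ℕ) (x : ell2) : coord j (diagOp x) = (1 / 2 ^ (j + 1)) * coord j x := rfl

theorem integrable_conj_kernel_smul {E : Type*} [NormedAddCommGroup E] [NormedSpace ℂ E]
    (hα : -1 < α) {z : Cn n} (hz : ‖z‖ < 1) {ψ : Cn n → E} (hψ : Integrable ψ (nuAlpha n α)) :
    Integrable (fun w => starRingEnd ℂ (kernel n α z w) • ψ w) (nuAlpha n α) := by
  refine hψ.bdd_smul (1 / (1 - ‖z‖) ^ (n + 1 + α))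
    (Complex.continuous_conj.comp_aestronglyMeasurable (memLp_kernel hα hz).1)
    (ae_mem_unitBall.mono fun w hw => ?_)
  rw [RCLike.norm_conj]
  exact norm_kernel_le hα hz hw.le

/-- A limit of holomorphic `ℓ²`-valued functions agrees with its projection integral, coordinate by
coordinate. -/
theorem isClosed_bergman_ell2 (hα : -1 < α) :
    IsClosed (bergman ell2 n α : Set (Lp ell2 2 (nuAlpha n α))) := by
  refine isClosed_of_closure_subset fun G hG => ?_
  have hc : (((nuAlpha n α).real Set.univ : ℝ) : ℂ) ≠ 0 := by
    exact_mod_cast (nuAlpha_univ_pos (n := n) hα).ne'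
  have hi := integrable_coeFn_Lp hα G
  refine ⟨fun z => (((nuAlpha n α).real Set.univ : ℝ) : ℂ)⁻¹ •
    ∫ w, starRingEnd ℂ (kernel n α z w) • G w ∂(nuAlpha n α),
    (differentiableOn_integral_conj_kernel hα hi).fun_const_smul _, ?_⟩
  have hmem (j : ℕ) : (coord j).compLpL 2 (nuAlpha n α) G ∈ bergman ℂ n α := by
    have h := map_mem_closure ((coord j).compLpL 2 (nuAlpha n α)).continuous hG
      (t := (bergman ℂ n α : Set (Lp ℂ 2 (nuAlpha n α)))) fun H hH =>
        (bergmanMap n α (coord j) ⟨H, hH⟩).2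
    rwa [(isClosed_bergman hα).closure_eq] at h
  have hall : ∀ᵐ z ∂(nuAlpha n α), ∀ j, coord j (G z) = holRep ⟨_, hmem j⟩ z := by
    refine ae_all_iff.2 fun j => ?_
    filter_upwards [(coord j).coeFn_compLpL (p := 2) G, coeFn_ae_eq_holRep ⟨_, hmem j⟩]
      with z h1 h2
    rw [← h1, ← h2]
  filter_upwards [hall, ae_mem_unitBall] with z h1 hz
  refine ell2_ext fun j => ?_
  have hki := integrable_conj_kernel_smul hα hz hi
  rw [h1, map_smul, ← (coord j).integral_comp_comm hki]
  have h2 := inner_toLp_kernel_bergman hα hz ⟨_, hmem j⟩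
  rw [inner_toLp_kernel hα hz] at h2
  have h3 : ∫ w, coord j (starRingEnd ℂ (kernel n α z w) • G w) ∂(nuAlpha n α) =
      ∫ w, starRingEnd ℂ (kernel n α z w) * (coord j).compLpL 2 (nuAlpha n α) G w
        ∂(nuAlpha n α) := by
    refine integral_congr_ae ?_
    filter_upwards [(coord j).coeFn_compLpL (p := 2) G] with w hw
    rw [hw, map_smul, smul_eq_mul]
  rw [h3, h2, smul_eq_mul, inv_mul_cancel_left₀ hc]

theorem completeSpace_bergman_ell2 (hα : -1 < α) : CompleteSpace (bergman ell2 n α) :=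
  (isClosed_bergman_ell2 hα).completeSpace_coe

theorem isCompactOperator_of_hasSum {H : Type*} [NormedAddCommGroup H] [NormedSpace ℂ H]
    [CompleteSpace H] {T : H →L[ℂ] H} {S : ℕ → H →L[ℂ] H} (h : HasSum S T)
    (hS : ∀ i, IsCompactOperator (S i)) : IsCompactOperator T := by
  refine isCompactOperator_of_tendsto h (Eventually.of_forall fun s => ?_)
  induction s using Finset.induction_on with
  | empty => exact isCompactOperator_zero
  | insert i s hi ih =>
    rw [Finset.sum_insert hi]
    exact (hS i).add ih

/-- If `Y` contains copies `ι i` of `X` with projections `π i`, a compact operator on `X` acts on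
`Y` through `diag(2^{-1}, 2^{-2}, …)` as a compact operator: the sum over the coordinates converges
in norm. -/
theorem exists_isCompactOperator_diag {X Y : Type*} [NormedAddCommGroup X] [NormedSpace ℂ X]
    [NormedAddCommGroup Y] [NormedSpace ℂ Y] [CompleteSpace Y] {S : X →L[ℂ] X}
    (hS : IsCompactOperator S) {ι : ℕ → X →L[ℂ] Y} {π : ℕ → Y →L[ℂ] X} (hι : ∀ i, ‖ι i‖ ≤ 1)
    (hπ : ∀ i, ‖π i‖ ≤ 1) (h1 : ∀ i x, π i (ι i x) = x) (h0 : ∀ i j x, i ≠ j → π j (ι i x) = 0) :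
    ∃ T : Y →L[ℂ] Y, IsCompactOperator T ∧
      ∀ j y, π j (T y) = (1 / 2 ^ (j + 1) : ℂ) • S (π j y) := by
  let R : ℕ → Y →L[ℂ] Y := fun i => (1 / 2 ^ (i + 1) : ℂ) • (ι i).comp (S.comp (π i))
  have hR (i : ℕ) : ‖R i‖ ≤ (1 / 2) ^ i * ‖S‖ := by
    have h1 : ‖(1 / 2 ^ (i + 1) : ℂ)‖ ≤ (1 / 2) ^ i := by
      rw [norm_div, norm_pow, norm_one, Complex.norm_ofNat, one_div_pow]
      gcongr
      · norm_num
      · omega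
    have h2 : ‖(ι i).comp (S.comp (π i))‖ ≤ ‖S‖ := by
      calc _ ≤ ‖ι i‖ * (‖S‖ * ‖π i‖) :=
            (ContinuousLinearMap.opNorm_comp_le _ _).trans
              (mul_le_mul_of_nonneg_left (ContinuousLinearMap.opNorm_comp_le _ _) (norm_nonneg _))
        _ ≤ 1 * (‖S‖ * 1) := by
            gcongr
            exacts [hι i, hπ i]
        _ = ‖S‖ := by ring
    calc ‖R i‖ ≤ _ := ContinuousLinearMap.opNorm_smul_le _ _
      _ ≤ _ := mul_le_mul h1 h2 (norm_nonneg _) (by positivity)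
  have hsum : Summable R := Summable.of_norm_bounded
    ((summable_geometric_of_lt_one (by norm_num) (by norm_num)).mul_right _) hR
  refine ⟨∑' i, R i, isCompactOperator_of_hasSum hsum.hasSum fun i => ?_, fun j y => ?_⟩
  · exact ((hS.comp_clm (π i)).clm_comp (ι i)).smul (1 / 2 ^ (i + 1) : ℂ)
  · have h2 := (hsum.hasSum.mapL (ContinuousLinearMap.apply ℂ Y y)).mapL (π j)
    refine h2.unique ?_
    have e (i : ℕ) : π j (ContinuousLinearMap.apply ℂ Y y (R i)) =
        if i = j then (1 / 2 ^ (j + 1) : ℂ) • S (π j y) else 0 := by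
      simp only [R, ContinuousLinearMap.apply_apply, map_smul,
        ContinuousLinearMap.comp_apply]
      split_ifs with h
      · subst h
        rw [h1]
      · rw [h0 i j _ h, smul_zero]
    simp only [e]
    exact hasSum_ite_eq j _

end VectorBergman

end

open VectorBergman in
theorem theorem6p1 (n : ℕ) (α : ℝ) (hα : -1 < α) (τ : VectorBergman.Cn n → ℂ)
    (hτ : VectorBergman.MemBMO n α τ)
    (hbdd : ∃ C : ℝ, ∀ z ∈ VectorBergman.unitBall n, ‖VectorBergman.berezin n α τ z‖ ≤ C)
    (hlim : Filter.Tendsto (VectorBergman.berezin n α τ)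
      (Filter.comap (fun z : VectorBergman.Cn n => ‖z‖) (nhdsWithin 1 (Set.Iio 1)))
      (nhds 0)) :
    ∃ T : VectorBergman.bergman VectorBergman.ell2 n α →L[ℂ]
        VectorBergman.bergman VectorBergman.ell2 n α,
      VectorBergman.IsToeplitz n α (VectorBergman.diagSymbol τ) T ∧ IsCompactOperator T := by
  obtain ⟨M, hMt, hM⟩ := exists_average_bound hα hτ hbdd
  have hτm := hτ.1.1
  obtain ⟨K, hK0, hK⟩ := carlesonBound_of_averages hα hτm hMt hM
  obtain ⟨S, hS⟩ := exists_isFormOp hα hτm hK0 hK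
  have hSc := isCompactOperator_isFormOp hα hτm hMt hM hlim hS
  have := completeSpace_bergman_ell2 (n := n) hα
  obtain ⟨T, hTc, hT⟩ := exists_isCompactOperator_diag
    (S := (((nuAlpha n α).real Set.univ : ℝ) : ℂ) • S)
    (hSc.smul (((nuAlpha n α).real Set.univ : ℝ) : ℂ))
    (ι := fun i => bergmanMap n α (axis i)) (π := fun i => bergmanMap n α (coord i))
    (fun i => (norm_bergmanMap_le _).trans (norm_axis i).le)
    (fun i => (norm_bergmanMap_le _).trans (norm_coord_le i))
    (fun i F => by rw [bergmanMap_bergmanMap, coord_comp_axis, if_pos rfl, bergmanMap_id])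
    (fun i j F h => by rw [bergmanMap_bergmanMap, coord_comp_axis, if_neg h, bergmanMap_zero])
  refine ⟨T, fun f hf G hG => ?_, hTc⟩
  obtain ⟨hfd, C, hC⟩ := hf
  have hψ : Integrable (fun w => diagSymbol τ w (f w)) (nuAlpha n α) := by
    have h1 : AEStronglyMeasurable (fun w => diagOp (f w)) (nuAlpha n α) :=
      diagOp.continuous.comp_aestronglyMeasurable
        (aestronglyMeasurable_of_continuousOn hfd.continuousOn)
    refine hτ.1.smul_bdd (‖diagOp‖ * C) h1 (ae_mem_unitBall.mono fun w hw => ?_)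
    exact (diagOp.le_opNorm _).trans (by
      gcongr
      exact hC w (by simpa using hw))
  have hall : ∀ᵐ z ∂(nuAlpha n α), ∀ j, coord j ((T G : Lp ell2 2 (nuAlpha n α)) z) =
      (1 / 2 ^ (j + 1)) * ∫ w, starRingEnd ℂ (kernel n α z w) * (τ w * coord j (f w))
        ∂(nuAlpha n α) := by
    refine ae_all_iff.2 fun j => ?_
    filter_upwards [coeFn_bergmanMap (coord j) (T G),
      hS.ae_eq_integral hα (bergmanMap n α (coord j) G),
      Lp.coeFn_smul (1 / 2 ^ (j + 1) : ℂ) (((((nuAlpha n α).real Set.univ : ℝ) : ℂ) • S)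
        (bergmanMap n α (coord j) G) : Lp ℂ 2 (nuAlpha n α))] with z h1 h2 h3
    rw [← h1, hT, Submodule.coe_smul, h3, Pi.smul_apply, h2, smul_eq_mul]
    congr 1
    refine integral_congr_ae ?_
    filter_upwards [coeFn_bergmanMap (coord j) G, hG] with w h4 h5
    rw [h4, h5]
  filter_upwards [hall, ae_mem_unitBall] with z hz hz1
  refine ell2_ext fun j => ?_
  -- The Bochner integral in the Toeplitz operator converges, so coordinates may be taken inside.
  have h := (coord j).integral_comp_comm (integrable_conj_kernel_smul hα hz1 hψ)
  refine (hz j).trans (Eq.trans ?_ h)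
  rw [← integral_const_mul]
  refine integral_congr_ae (ae_of_all _ fun w => ?_)
  simp only [map_smul, diagSymbol, smul_apply, coord_diagOp, smul_eq_mul]
  ring
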